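/- Let $k \ge 0$ and $j \in \{0,1,2\}$ be integers, let $H$ be a fixed graph with $3k+j$ vertices, and let $\omega$ be a real number such that two $n \times n$ matrices can be multiplied in $O(n^{\omega})$ time (it suffices that, for any two zero-one matrices, a matrix with the same nonzero positions as their product can be computed, as the Boolean or the integer product does). Then there is a deterministic algorithm which, given a graph $G=(V,E)$ with $n \ge 2$ vertices and an edge-coloring $c : E \to C$, finds in $O(n^{\omega k + j} \log n)$ time a rainbow $H$-subgraph of $G$ (a not necessarily induced subgraph of $G$ isomorphic to $H$ all of whose edges have distinct colors), or reports that none exists. The constant hidden in the $O$-notation depends only on $H$, $\omega$ and the matrix multiplication algorithm, not on $G$, $c$ or the number of colors. Here time is the number of steps on a random access machine with $w$-bit words, for every $w$ that is at least a suitable constant times $\log (n+2)$ and large enough for each color to be one word; graphs are given by their adjacency matrices, and memory that does not hold the input is uninitialized. -/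

import Mathlib

/-! ## A random access machine with `w`-bit words

Programs are finite texts over registers `0, 1, 2, …` and arrays `0, 1, 2, …`. Registers and
array cells hold words, i.e. natural numbers below `2 ^ w`; arithmetic is reduced modulo `2 ^ w`.
Array cells are addressed indirectly, by the content of a register. Every instruction and every
test costs one step. The word size `w` is not visible in the program: one program serves all
inputs and all word sizes. Memory that does not hold the input is uninitialised. -/

namespace WordRAM

/-- The arithmetic operations. -/
inductive Op where
  | add | sub | mul | div

/-- The result of an operation on `w`-bit words: subtraction is truncated at `0`, division is
rounded down (and division by `0` gives `0`), overflow is discarded. -/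
def Op.eval (w : ℕ) : Op → ℕ → ℕ → ℕ
  | .add, x, y => (x + y) % 2 ^ w
  | .sub, x, y => (x - y) % 2 ^ w
  | .mul, x, y => (x * y) % 2 ^ w
  | .div, x, y => (x / y) % 2 ^ w

/-- Programs. The letters `x y z` stand for registers and `a` for an array. -/
inductive Prog where
  /-- do nothing (for one step) -/
  | skip : Prog
  /-- `x := v` for a literal `v` -/
  | const (x v : ℕ) : Prog
  /-- `x := o y z` -/
  | arith (o : Op) (x y z : ℕ) : Prog
  /-- `x := a[y]` -/
  | load (x a y : ℕ) : Prog
  /-- `a[x] := y` -/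
  | store (a x y : ℕ) : Prog
  /-- `p; q` -/
  | seq (p q : Prog) : Prog
  /-- `if x < y then p else q` -/
  | branch (x y : ℕ) (p q : Prog) : Prog
  /-- `while x < y do p` -/
  | loop (x y : ℕ) (p : Prog) : Prog

/-- A memory state: the contents of the registers and of the cells of the arrays. -/
structure State where
  /-- `reg x` is the content of register `x`. -/
  reg : ℕ → ℕ
  /-- `mem a i` is the content of cell `i` of array `a`. -/
  mem : ℕ → ℕ → ℕ

/-- Write `v` into register `x`. -/
def State.setReg (s : State) (x v : ℕ) : State :=
  { s with reg := Function.update s.reg x v }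

/-- Write `v` into cell `i` of array `a`. -/
def State.setMem (s : State) (a i v : ℕ) : State :=
  { s with mem := Function.update s.mem a (Function.update (s.mem a) i v) }

/-- All registers and cells hold `w`-bit words. -/
def State.Fits (w : ℕ) (s : State) : Prop :=
  (∀ x, s.reg x < 2 ^ w) ∧ ∀ a i, s.mem a i < 2 ^ w

/-- `Exec w p s t s'`: on the machine with `w`-bit words, the program `p`, started in state `s`,
halts after exactly `t` steps in state `s'`. -/
inductive Exec (w : ℕ) : Prog → State → ℕ → State → Prop where
  | skip (s : State) : Exec w .skip s 1 s
  | const (s : State) (x v : ℕ) : Exec w (.const x v) s 1 (s.setReg x (v % 2 ^ w))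
  | arith (s : State) (o : Op) (x y z : ℕ) :
      Exec w (.arith o x y z) s 1 (s.setReg x (o.eval w (s.reg y) (s.reg z)))
  | load (s : State) (x a y : ℕ) :
      Exec w (.load x a y) s 1 (s.setReg x (s.mem a (s.reg y)))
  | store (s : State) (a x y : ℕ) :
      Exec w (.store a x y) s 1 (s.setMem a (s.reg x) (s.reg y))
  | seq {p q : Prog} {s s₁ s₂ : State} {t₁ t₂ : ℕ} :
      Exec w p s t₁ s₁ → Exec w q s₁ t₂ s₂ → Exec w (.seq p q) s (t₁ + t₂) s₂
  | branchTrue {x y : ℕ} {p q : Prog} {s s₁ : State} {t : ℕ} :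
      s.reg x < s.reg y → Exec w p s t s₁ → Exec w (.branch x y p q) s (t + 1) s₁
  | branchFalse {x y : ℕ} {p q : Prog} {s s₁ : State} {t : ℕ} :
      ¬ s.reg x < s.reg y → Exec w q s t s₁ → Exec w (.branch x y p q) s (t + 1) s₁
  | loopTrue {x y : ℕ} {p : Prog} {s s₁ s₂ : State} {t₁ t₂ : ℕ} :
      s.reg x < s.reg y → Exec w p s t₁ s₁ → Exec w (.loop x y p) s₁ t₂ s₂ →
      Exec w (.loop x y p) s (t₁ + t₂ + 1) s₂
  | loopFalse {x y : ℕ} {p : Prog} {s : State} :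
      ¬ s.reg x < s.reg y → Exec w (.loop x y p) s 1 s

/-! ## Matrix multiplication -/

/-- The state holds two `n × n` matrices with entries `0` and `1`: register `0` contains `n`, and
arrays `0` and `1` contain the matrices row by row. Nothing is said about the other cells. -/
def HoldsMatrices (n : ℕ) (A B : Matrix (Fin n) (Fin n) Bool) (s : State) : Prop :=
  s.reg 0 = n ∧
  (∀ i l : Fin n, s.mem 0 (i * n + l) = if A i l then 1 else 0) ∧
  (∀ i l : Fin n, s.mem 1 (i * n + l) = if B i l then 1 else 0)

/-- Array `2` contains, row by row, an `n × n` matrix whose nonzero entries are those of the product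
of `A` and `B`. Both the ordinary product over the integers and the Boolean product qualify. -/
def HoldsProduct (n : ℕ) (A B : Matrix (Fin n) (Fin n) Bool) (s : State) : Prop :=
  ∀ i l : Fin n, s.mem 2 (i * n + l) ≠ 0 ↔ ∃ r : Fin n, A i r = true ∧ B r l = true

/-- `n × n` matrices can be multiplied in time `O(n ^ ω)`: some program multiplies any two zero-one
matrices of any order `n ≥ 1` in at most `C * n ^ ω` steps, on words of at least `d * log₂ (n + 2)`
bits, for some constants `C` and `d`. -/
def MatrixMulInTime (ω : ℝ) : Prop :=
  ∃ (P : Prog) (d : ℕ) (C : ℝ), ∀ (n : ℕ) (A B : Matrix (Fin n) (Fin n) Bool) (w : ℕ) (s : State),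
    1 ≤ n → (n + 2) ^ d ≤ 2 ^ w → s.Fits w → HoldsMatrices n A B s →
      ∃ (t : ℕ) (s' : State), Exec w P s t s' ∧ HoldsProduct n A B s' ∧ (t : ℝ) ≤ C * (n : ℝ) ^ ω

/-! ## Rainbow subgraphs -/

/-- A copy of `H` in the edge-colored graph `G` is rainbow if its edges have distinct colors. -/
def IsRainbow {V W : Type} {H : SimpleGraph V} {G : SimpleGraph W} (c : G.edgeSet → ℕ)
    (φ : SimpleGraph.Copy H G) : Prop :=
  Function.Injective fun e : H.edgeSet => c (φ.toHom.mapEdgeSet e)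

open Classical in
/-- The state holds the edge-colored graph `G` on `n` vertices: register `0` contains `n`, array `0`
contains the adjacency matrix row by row, and array `1` contains, at the positions of the edges,
their colors. Nothing is said about the other cells. -/
def HoldsColoredGraph {n : ℕ} (G : SimpleGraph (Fin n)) (c : G.edgeSet → ℕ) (s : State) : Prop :=
  s.reg 0 = n ∧
  (∀ u v : Fin n, s.mem 0 (u * n + v) = if G.Adj u v then 1 else 0) ∧
  (∀ (u v : Fin n) (h : s(u, v) ∈ G.edgeSet), s.mem 1 (u * n + v) = c ⟨s(u, v), h⟩)

/-- The state answers the search for a rainbow copy of `H`: either register `0` contains `1` and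
the first cells of array `2` contain the vertices of such a copy, in the order of the vertices of
`H`, or register `0` contains `0` and there is no such copy. -/
def HoldsRainbowAnswer {h n : ℕ} (H : SimpleGraph (Fin h)) (G : SimpleGraph (Fin n))
    (c : G.edgeSet → ℕ) (s : State) : Prop :=
  (s.reg 0 = 1 ∧ ∃ φ : SimpleGraph.Copy H G, IsRainbow c φ ∧ ∀ v : Fin h, s.mem 2 v = φ v) ∨
  (s.reg 0 = 0 ∧ ¬ ∃ φ : SimpleGraph.Copy H G, IsRainbow c φ)

end WordRAM

namespace WordRAM

/-! ## Reasoning about programs -/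

/-! Derandomized color coding reduces the problem to a bounded number of edge labels, and for
prescribed labels the search is a triangle search by matrix multiplication.

Reduction to labels. Let Q = 4^σ with σ = |E(H)|² + 1, and let g map colors to Q labels. Try every
injective labelling of E(H) by these labels, and look for an injective vertex map that sends each
edge of H to an edge of G whose color has the prescribed label. Whatever g is, a map that is found
is a rainbow copy, because distinct labels come from distinct colors (`LabelsEdges.sound`). If g is
injective on the colors of some rainbow copy, then a copy is found (`LabelsEdges.solvable`). So
O(log n) functions g suffice, provided that every set of |E(H)| colors is separated by one of them.

One labelling. Every requirement concerns a pair of vertices of H. Fix the images of the last j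
vertices in n^j ways, and split the other 3k vertices into three blocks of size k. A pair meets at
most two blocks, so every requirement avoids one block (`sat_iff_avoiding`). A solution is a
triangle in a tripartite graph with n^k nodes in each part; it is detected by multiplying two
zero-one matrices of order n^k and comparing the product with the third pair of parts
(`run_searchBlocks`). Filling and scanning the matrices takes O(n^(2k)) steps. The multiplication
pays for this: a correct program must be able to overwrite all cells of the product, so its time
bound is at least quadratic (`sq_le_of_multiplies`).

The hash functions. A color is first replaced by a position in the color matrix, a number below n²
(`run_tabulate`), so the number and size of the colors do not matter. Let c = 6σ and let b be about
n^(1/c). A constant number T of pairwise coprime moduli of size Θ(b) is used; distinct numbers below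
n² ≤ b^(2c) agree modulo fewer than 2c of them (`card_collisions_lt`), so a union bound over pairs
of edges yields a modulus that separates the residues (`exists_separating`). The residue selects a
word in a code of length R = O(log n) over Q letters in which two words agree in fewer than R/σ
places; the same union bound yields a place at which the selected words all differ
(`exists_injOn_hashVal`). This makes T·R = O(log n) functions.

The code. A maximal code found greedily has at least 2^R words by a volume bound (`card_ball_le`,
`IsCode.le_card`), enough for all residues. Brute force over the Q^R words costs O((Q^R)³) =
O(2^(6σR)) = O(b^(6σ)) = O(n), which explains the exponent c = 6σ (`code_cube_le`, `codeTime_le`).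

If H has at most one vertex, the time bound can be below the size of the input, and the answer is
written down directly. -/

@[simp] theorem State.reg_setReg (s : State) (x v y : ℕ) :
    (s.setReg x v).reg y = if y = x then v else s.reg y := by
  simp [State.setReg, Function.update_apply]

@[simp] theorem State.mem_setReg (s : State) (x v : ℕ) : (s.setReg x v).mem = s.mem := rfl

@[simp] theorem State.reg_setMem (s : State) (a i v : ℕ) : (s.setMem a i v).reg = s.reg := rfl

@[simp] theorem State.mem_setMem (s : State) (a i v b : ℕ) :
    (s.setMem a i v).mem b = if b = a then Function.update (s.mem a) i v else s.mem b := by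
  simp [State.setMem, Function.update_apply]

theorem State.Fits.setReg {w : ℕ} {s : State} (h : s.Fits w) {x v : ℕ} (hv : v < 2 ^ w) :
    (s.setReg x v).Fits w := by
  refine ⟨fun y => ?_, fun a i => h.2 a i⟩
  rw [State.reg_setReg]; split
  · exact hv
  · exact h.1 y

theorem State.Fits.setMem {w : ℕ} {s : State} (h : s.Fits w) {a i v : ℕ} (hv : v < 2 ^ w) :
    (s.setMem a i v).Fits w := by
  refine ⟨fun y => h.1 y, fun b l => ?_⟩
  rw [State.mem_setMem]; split
  · rw [Function.update_apply]; split
    · exact hv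
    · exact h.2 a l
  · exact h.2 b l

theorem Op.eval_lt (w : ℕ) (o : Op) (x y : ℕ) : o.eval w x y < 2 ^ w := by
  cases o <;> exact Nat.mod_lt _ (by positivity)

/-! ### Syntactic write sets and what a run preserves -/

/-- The registers that a program may write. -/
def Prog.WritesReg : Prog → ℕ → Prop
  | .skip, _ => False
  | .const x _, z => z = x
  | .arith _ x _ _, z => z = x
  | .load x _ _, z => z = x
  | .store _ _ _, _ => False
  | .seq p q, z => p.WritesReg z ∨ q.WritesReg z
  | .branch _ _ p q, z => p.WritesReg z ∨ q.WritesReg z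
  | .loop _ _ p, z => p.WritesReg z

/-- The arrays that a program may write. -/
def Prog.WritesArr : Prog → ℕ → Prop
  | .skip, _ => False
  | .const _ _, _ => False
  | .arith _ _ _ _, _ => False
  | .load _ _ _, _ => False
  | .store a _ _, b => b = a
  | .seq p q, z => p.WritesArr z ∨ q.WritesArr z
  | .branch _ _ p q, z => p.WritesArr z ∨ q.WritesArr z
  | .loop _ _ p, z => p.WritesArr z

/-- What is the same before and after any run of `p`. -/
structure Frame (w : ℕ) (p : Prog) (s s' : State) : Prop where
  fits : s.Fits w → s'.Fits w
  reg : ∀ x, ¬ p.WritesReg x → s'.reg x = s.reg x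
  mem : ∀ a, ¬ p.WritesArr a → s'.mem a = s.mem a

theorem Frame.refl (w : ℕ) (p : Prog) (s : State) : Frame w p s s :=
  ⟨id, fun _ _ => rfl, fun _ _ => rfl⟩

theorem Frame.trans {w : ℕ} {p : Prog} {s₁ s₂ s₃ : State} (h : Frame w p s₁ s₂)
    (h' : Frame w p s₂ s₃) : Frame w p s₁ s₃ :=
  ⟨fun hs => h'.fits (h.fits hs), fun x hx => (h'.reg x hx).trans (h.reg x hx),
    fun a ha => (h'.mem a ha).trans (h.mem a ha)⟩

theorem Frame.mono {w : ℕ} {p q : Prog} {s s' : State} (h : Frame w p s s')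
    (hr : ∀ x, p.WritesReg x → q.WritesReg x) (ha : ∀ a, p.WritesArr a → q.WritesArr a) :
    Frame w q s s' :=
  ⟨h.fits, fun x hx => h.reg x fun h' => hx (hr x h'), fun a hx => h.mem a fun h' => hx (ha a h')⟩

/-- Induction on the run. Since the write sets are read off from the text of the program, later loop
invariants only have to mention what actually changes. -/
theorem Exec.frame {w : ℕ} {p : Prog} {s s' : State} {t : ℕ} (h : Exec w p s t s') :
    Frame w p s s' := by
  induction h with
  | skip s => exact .refl ..
  | const s x v =>
    exact ⟨fun hs => hs.setReg (Nat.mod_lt _ (by positivity)),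
      fun y hy => by simp [show y ≠ x from hy], fun _ _ => rfl⟩
  | arith s o x y z =>
    exact ⟨fun hs => hs.setReg (o.eval_lt ..),
      fun y hy => by simp [show y ≠ x from hy], fun _ _ => rfl⟩
  | load s x a y =>
    exact ⟨fun hs => hs.setReg (hs.2 _ _),
      fun y hy => by simp [show y ≠ x from hy], fun _ _ => rfl⟩
  | store s a x y =>
    exact ⟨fun hs => hs.setMem (hs.1 _), fun _ _ => rfl,
      fun b hb => by simp [show b ≠ a from hb]⟩
  | seq _ _ ih₁ ih₂ =>
    exact (ih₁.mono (fun _ => Or.inl) fun _ => Or.inl).trans (ih₂.mono (fun _ => Or.inr) fun _ => Or.inr)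
  | branchTrue _ _ ih => exact ih.mono (fun _ => Or.inl) fun _ => Or.inl
  | branchFalse _ _ ih => exact ih.mono (fun _ => Or.inr) fun _ => Or.inr
  | loopTrue _ _ _ ih₁ ih₂ => exact Frame.trans (ih₁.mono (fun _ => id) fun _ => id) ih₂
  | loopFalse _ => exact .refl ..

/-- Started in state `s`, the program `p` halts within `T` steps, and then `Q` holds. -/
def Run (w : ℕ) (p : Prog) (s : State) (T : ℕ) (Q : State → Prop) : Prop :=
  ∃ t s', Exec w p s t s' ∧ t ≤ T ∧ Q s'

/-! ### Hoare-style rules with step counts -/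

section Rules

variable {w : ℕ} {p q : Prog} {s : State} {T T₁ T₂ : ℕ} {Q Q' : State → Prop}

theorem Run.mono (h : Run w p s T₁ Q) (hT : T₁ ≤ T₂) (hQ : ∀ s', Q s' → Q' s') :
    Run w p s T₂ Q' := by
  obtain ⟨t, s', he, ht, hq⟩ := h
  exact ⟨t, s', he, ht.trans hT, hQ s' hq⟩

theorem Run.frame (h : Run w p s T Q) : Run w p s T fun s' => Q s' ∧ Frame w p s s' := by
  obtain ⟨t, s', he, ht, hq⟩ := h
  exact ⟨t, s', he, ht, hq, he.frame⟩

theorem Run.seq (h : Run w p s T₁ fun s' => Run w q s' T₂ Q) :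
    Run w (.seq p q) s (T₁ + T₂) Q := by
  obtain ⟨t, s', he, ht, t', s'', he', ht', hq⟩ := h
  exact ⟨_, s'', .seq he he', by omega, hq⟩

/-- Sequencing, with what the first program leaves unchanged. -/
theorem Run.bind (h : Run w p s T₁ Q) (h' : ∀ s', Q s' → Frame w p s s' → Run w q s' T₂ Q') :
    Run w (.seq p q) s (T₁ + T₂) Q' :=
  .seq (h.frame.mono le_rfl fun s' hs => h' s' hs.1 hs.2)

theorem Run.skip (h : Q s) : Run w .skip s 1 Q := ⟨1, s, .skip s, le_rfl, h⟩

/-- In this and the following arithmetic rules the result `v` is an exact natural number; the side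
condition that it fits into a word removes the reduction modulo `2 ^ w`. -/
theorem Run.const {x v : ℕ} (hv : v < 2 ^ w) (h : Q (s.setReg x v)) :
    Run w (.const x v) s 1 Q :=
  ⟨1, _, .const s x v, le_rfl, by rwa [Nat.mod_eq_of_lt hv]⟩

theorem Run.add {x y z v : ℕ} (hv : s.reg y + s.reg z = v) (hlt : v < 2 ^ w)
    (h : Q (s.setReg x v)) : Run w (.arith .add x y z) s 1 Q :=
  ⟨1, _, .arith s .add x y z, le_rfl, by simpa [Op.eval, hv, Nat.mod_eq_of_lt hlt] using h⟩

theorem Run.mul {x y z v : ℕ} (hv : s.reg y * s.reg z = v) (hlt : v < 2 ^ w)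
    (h : Q (s.setReg x v)) : Run w (.arith .mul x y z) s 1 Q :=
  ⟨1, _, .arith s .mul x y z, le_rfl, by simpa [Op.eval, hv, Nat.mod_eq_of_lt hlt] using h⟩

theorem Run.sub {x y z v : ℕ} (hv : s.reg y - s.reg z = v) (hlt : v < 2 ^ w)
    (h : Q (s.setReg x v)) : Run w (.arith .sub x y z) s 1 Q :=
  ⟨1, _, .arith s .sub x y z, le_rfl, by simpa [Op.eval, hv, Nat.mod_eq_of_lt hlt] using h⟩

theorem Run.div {x y z v : ℕ} (hv : s.reg y / s.reg z = v) (hlt : v < 2 ^ w)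
    (h : Q (s.setReg x v)) : Run w (.arith .div x y z) s 1 Q :=
  ⟨1, _, .arith s .div x y z, le_rfl, by simpa [Op.eval, hv, Nat.mod_eq_of_lt hlt] using h⟩

theorem Run.load {x a y v : ℕ} (hv : s.mem a (s.reg y) = v) (h : Q (s.setReg x v)) :
    Run w (.load x a y) s 1 Q :=
  ⟨1, _, .load s x a y, le_rfl, by rwa [hv]⟩

theorem Run.store {a x y i v : ℕ} (hi : s.reg x = i) (hv : s.reg y = v)
    (h : Q (s.setMem a i v)) : Run w (.store a x y) s 1 Q :=
  ⟨1, _, .store s a x y, le_rfl, by rwa [hi, hv]⟩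

theorem Run.one_seq (h : Run w p s 1 fun s' => Run w q s' T Q) : Run w (.seq p q) s (T + 1) Q :=
  (Run.seq h).mono (by omega) fun _ => id

theorem Run.const_seq {x v : ℕ} (hv : v < 2 ^ w) (h : Run w q (s.setReg x v) T Q) :
    Run w (.seq (.const x v) q) s (T + 1) Q := .one_seq (.const hv h)

theorem Run.add_seq {x y z v : ℕ} (hv : s.reg y + s.reg z = v) (hlt : v < 2 ^ w)
    (h : Run w q (s.setReg x v) T Q) : Run w (.seq (.arith .add x y z) q) s (T + 1) Q :=
  .one_seq (.add hv hlt h)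

theorem Run.mul_seq {x y z v : ℕ} (hv : s.reg y * s.reg z = v) (hlt : v < 2 ^ w)
    (h : Run w q (s.setReg x v) T Q) : Run w (.seq (.arith .mul x y z) q) s (T + 1) Q :=
  .one_seq (.mul hv hlt h)

theorem Run.sub_seq {x y z v : ℕ} (hv : s.reg y - s.reg z = v) (hlt : v < 2 ^ w)
    (h : Run w q (s.setReg x v) T Q) : Run w (.seq (.arith .sub x y z) q) s (T + 1) Q :=
  .one_seq (.sub hv hlt h)

theorem Run.div_seq {x y z v : ℕ} (hv : s.reg y / s.reg z = v) (hlt : v < 2 ^ w)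
    (h : Run w q (s.setReg x v) T Q) : Run w (.seq (.arith .div x y z) q) s (T + 1) Q :=
  .one_seq (.div hv hlt h)

theorem Run.load_seq {x a y v : ℕ} (hv : s.mem a (s.reg y) = v)
    (h : Run w q (s.setReg x v) T Q) : Run w (.seq (.load x a y) q) s (T + 1) Q :=
  .one_seq (.load hv h)

theorem Run.store_seq {a x y i v : ℕ} (hi : s.reg x = i) (hv : s.reg y = v)
    (h : Run w q (s.setMem a i v) T Q) : Run w (.seq (.store a x y) q) s (T + 1) Q :=
  .one_seq (.store hi hv h)

theorem Run.branch {x y : ℕ} (ht : s.reg x < s.reg y → Run w p s T Q)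
    (hf : ¬ s.reg x < s.reg y → Run w q s T Q) : Run w (.branch x y p q) s (T + 1) Q := by
  by_cases h : s.reg x < s.reg y
  · obtain ⟨t, s', he, hT, hq⟩ := ht h
    exact ⟨_, s', .branchTrue h he, by omega, hq⟩
  · obtain ⟨t, s', he, hT, hq⟩ := hf h
    exact ⟨_, s', .branchFalse h he, by omega, hq⟩

/-- A loop that makes exactly `L` rounds. -/
theorem Run.loop {x y : ℕ} (I : ℕ → State → Prop) (L : ℕ) (h0 : I 0 s)
    (step : ∀ m s', m < L → I m s' → Frame w p s s' →
      s'.reg x < s'.reg y ∧ Run w p s' T (I (m + 1)))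
    (hend : ∀ s', I L s' → Frame w p s s' → ¬ s'.reg x < s'.reg y) :
    Run w (.loop x y p) s (L * (T + 1) + 1) (I L) := by
  -- Induction on the number `r` of remaining rounds. The frame relative to the initial state
  -- travels along, so that each round may use whatever the body never writes.
  have key : ∀ r m s', m + r = L → I m s' → Frame w p s s' →
      ∃ t s'', Exec w (.loop x y p) s' t s'' ∧ t ≤ r * (T + 1) + 1 ∧ I L s'' := by
    intro r
    induction r with
    | zero =>
      intro m s' hm hI hF
      obtain rfl : m = L := by omega
      exact ⟨1, s', .loopFalse (hend s' hI hF), by omega, hI⟩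
    | succ r ih =>
      intro m s' hm hI hF
      obtain ⟨hlt, t, s₁, he, ht, hI'⟩ := step m s' (by omega) hI hF
      obtain ⟨t', s₂, he', ht', hI''⟩ := ih (m + 1) s₁ (by omega) hI' (hF.trans he.frame)
      exact ⟨_, s₂, .loopTrue hlt he he', by linarith, hI''⟩
  exact key L 0 s (by omega) h0 (.refl ..)

end Rules

/-! ## Relocating a program -/

/-- The program with all registers and arrays moved up by `100`. -/
def Prog.shift : Prog → Prog
  | .skip => .skip
  | .const x v => .const (x + 100) v
  | .arith o x y z => .arith o (x + 100) (y + 100) (z + 100)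
  | .load x a y => .load (x + 100) (a + 100) (y + 100)
  | .store a x y => .store (a + 100) (x + 100) (y + 100)
  | .seq p q => .seq p.shift q.shift
  | .branch x y p q => .branch (x + 100) (y + 100) p.shift q.shift
  | .loop x y p => .loop (x + 100) (y + 100) p.shift

/-- The part of the memory that a relocated program sees. -/
def State.upper (s : State) : State :=
  ⟨fun x => s.reg (x + 100), fun a => s.mem (a + 100)⟩

theorem State.upper_setReg (s : State) (x v : ℕ) :
    (s.setReg (x + 100) v).upper = s.upper.setReg x v := by
  simp only [State.upper, State.setReg, State.mk.injEq, and_true]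
  funext y
  simp [Function.update_apply]

theorem State.upper_setMem (s : State) (a i v : ℕ) :
    (s.setMem (a + 100) i v).upper = s.upper.setMem a i v := by
  simp only [State.upper, State.setMem, State.mk.injEq, true_and]
  funext b
  simp [Function.update_apply]

/-- The given multiplication program may use any registers and arrays. Renaming is injective, so the
relocated program behaves identically on the memory from `100` on, and everything below `100` is
safe from it. -/
theorem Exec.shift {w : ℕ} {p : Prog} {u u' : State} {t : ℕ} (h : Exec w p u t u') :
    ∀ s : State, s.upper = u → ∃ s', Exec w p.shift s t s' ∧ s'.upper = u' := by
  induction h with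
  | skip u => exact fun s hs => ⟨s, .skip s, hs⟩
  | const u x v => exact fun s hs => ⟨_, .const s _ v, by rw [State.upper_setReg, hs]⟩
  | arith u o x y z =>
    exact fun s hs => ⟨_, .arith s o _ _ _, by rw [State.upper_setReg, hs, ← hs]; rfl⟩
  | load u x a y =>
    exact fun s hs => ⟨_, .load s _ _ _, by rw [State.upper_setReg, hs, ← hs]; rfl⟩
  | store u a x y =>
    exact fun s hs => ⟨_, .store s _ _ _, by rw [State.upper_setMem, hs, ← hs]; rfl⟩
  | seq _ _ ih₁ ih₂ =>
    intro s hs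
    obtain ⟨s₁, he₁, h₁⟩ := ih₁ s hs
    obtain ⟨s₂, he₂, h₂⟩ := ih₂ s₁ h₁
    exact ⟨s₂, .seq he₁ he₂, h₂⟩
  | branchTrue hlt _ ih =>
    intro s hs
    obtain ⟨s₁, he₁, h₁⟩ := ih s hs
    subst hs
    exact ⟨s₁, .branchTrue hlt he₁, h₁⟩
  | branchFalse hlt _ ih =>
    intro s hs
    obtain ⟨s₁, he₁, h₁⟩ := ih s hs
    subst hs
    exact ⟨s₁, .branchFalse hlt he₁, h₁⟩
  | loopTrue hlt _ _ ih₁ ih₂ =>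
    intro s hs
    obtain ⟨s₁, he₁, h₁⟩ := ih₁ s hs
    obtain ⟨s₂, he₂, h₂⟩ := ih₂ s₁ h₁
    subst hs
    exact ⟨s₂, .loopTrue hlt he₁ he₂, h₂⟩
  | loopFalse hlt =>
    intro s hs
    subst hs
    exact ⟨s, .loopFalse hlt, rfl⟩

theorem Prog.WritesReg.shift_ge : ∀ {p : Prog} {x : ℕ}, p.shift.WritesReg x → 100 ≤ x
  | .const _ _, _, h | .arith _ _ _ _, _, h | .load _ _ _, _, h => by
    simp only [Prog.shift, Prog.WritesReg] at h; omega
  | .seq _ _, _, h | .branch _ _ _ _, _, h => h.elim shift_ge shift_ge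
  | .loop _ _ p, _, h => shift_ge (p := p) h

theorem Prog.WritesArr.shift_ge : ∀ {p : Prog} {a : ℕ}, p.shift.WritesArr a → 100 ≤ a
  | .store _ _ _, _, h => by
    simp only [Prog.shift, Prog.WritesArr] at h; omega
  | .seq _ _, _, h | .branch _ _ _ _, _, h => h.elim shift_ge shift_ge
  | .loop _ _ p, _, h => shift_ge (p := p) h

/-! ## Multiplying matrices takes quadratic time -/

/-- In `t` steps, at most `t` cells of an array change. -/
theorem Exec.exists_changed {w : ℕ} {p : Prog} {s s' : State} {t : ℕ} (h : Exec w p s t s')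
    (a : ℕ) : ∃ F : Finset ℕ, F.card ≤ t ∧ ∀ i ∉ F, s'.mem a i = s.mem a i := by
  induction h with
  | skip | const | arith | load | loopFalse => exact ⟨∅, by simp, fun _ _ => rfl⟩
  | store s b x y =>
    refine ⟨{s.reg x}, by simp, fun i hi => ?_⟩
    have hi : i ≠ s.reg x := by simpa using hi
    rw [State.mem_setMem]
    split
    · next hab => simp [hi, hab]
    · rfl
  | seq _ _ ih₁ ih₂ | loopTrue _ _ _ ih₁ ih₂ =>
    obtain ⟨F₁, hc₁, h₁⟩ := ih₁
    obtain ⟨F₂, hc₂, h₂⟩ := ih₂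
    refine ⟨F₁ ∪ F₂, by have := Finset.card_union_le F₁ F₂; omega, fun i hi => ?_⟩
    rw [Finset.mem_union, not_or] at hi
    rw [h₂ i hi.2, h₁ i hi.1]
  | branchTrue _ _ ih | branchFalse _ _ ih =>
    obtain ⟨F, hc, h⟩ := ih
    exact ⟨F, by omega, h⟩

/-- A bound on the time for multiplying matrices of order `n` is at least `n ^ 2`, because every
cell of the product may have to be overwritten. -/
theorem sq_le_of_multiplies {P : Prog} {d n : ℕ} {b : ℝ} (hn : 1 ≤ n)
    (hP : ∀ (A B : Matrix (Fin n) (Fin n) Bool) (w : ℕ) (s : State),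
      (n + 2) ^ d ≤ 2 ^ w → s.Fits w → HoldsMatrices n A B s →
        ∃ (t : ℕ) (s' : State), Exec w P s t s' ∧ HoldsProduct n A B s' ∧ (t : ℝ) ≤ b) :
    (n : ℝ) ^ 2 ≤ b := by
  have hlt : n + 2 < 2 ^ (n + 2) := Nat.lt_two_pow_self
  have hw : (n + 2) ^ (d + 1) ≤ 2 ^ ((n + 2) * (d + 1)) := by
    rw [pow_mul]; exact Nat.pow_le_pow_left hlt.le _
  have hn2 : n + 2 ≤ 2 ^ ((n + 2) * (d + 1)) :=
    hlt.le.trans (Nat.pow_le_pow_right (by omega) (Nat.le_mul_of_pos_right _ (by omega)))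
  -- Both factors are zero while array `2` is filled with ones. The product is zero, so each of its
  -- `n * n` cells has to change.
  obtain ⟨t, s', he, hprod, ht⟩ := hP (fun _ _ => false) (fun _ _ => false) ((n + 2) * (d + 1))
    ⟨fun x => if x = 0 then n else 0, fun a _ => if a = 2 then 1 else 0⟩
    ((Nat.pow_le_pow_right (by omega) (by omega)).trans hw)
    ⟨fun x => by dsimp only; split <;> omega, fun a i => by dsimp only; split <;> omega⟩
    ⟨rfl, fun _ _ => rfl, fun _ _ => rfl⟩
  obtain ⟨F, hF, hFc⟩ := he.exists_changed 2
  have hsub : Finset.range (n * n) ⊆ F := by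
    intro m hm
    rw [Finset.mem_range] at hm
    by_contra hmF
    have h1 := hFc m hmF
    have h2 := hprod ⟨m / n, Nat.div_lt_of_lt_mul hm⟩ ⟨m % n, Nat.mod_lt _ (by omega)⟩
    simp only [Nat.div_add_mod' m n, h1] at h2
    simp at h2
  have hcard := Finset.card_le_card hsub
  rw [Finset.card_range] at hcard
  have : ((n * n : ℕ) : ℝ) ≤ t := by exact_mod_cast hcard.trans hF
  rw [sq]; push_cast at this; linarith

/-! ## Digits -/

/-- Guarantees that a counter running below `n ^ k` enumerates all assignments of `k` vertices. -/
theorem exists_digits {n : ℕ} : ∀ (k : ℕ) (g : ℕ → ℕ), (∀ i < k, g i < n) →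
    ∃ x < n ^ k, ∀ i < k, x / n ^ i % n = g i := by
  intro k
  induction k with
  | zero => exact fun g _ => ⟨0, by simp, by simp⟩
  | succ k ih =>
    intro g hg
    obtain ⟨x, hx, hd⟩ := ih (fun i => g (i + 1)) fun i hi => hg (i + 1) (by omega)
    have h0 := hg 0 (by omega)
    refine ⟨g 0 + n * x, ?_, fun i hi => ?_⟩
    · calc g 0 + n * x < n + n * x := by omega
        _ = n * (x + 1) := by ring
        _ ≤ n * n ^ k := Nat.mul_le_mul_left _ hx
        _ = n ^ (k + 1) := by ring
    · cases i with
      | zero => simp [Nat.mod_eq_of_lt h0]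
      | succ i =>
        rw [pow_succ', ← Nat.div_div_eq_div_mul, Nat.add_mul_div_left _ _ (by omega),
          Nat.div_eq_of_lt h0, zero_add]
        exact hd i (by omega)

theorem mod_pow_div_pow_mod {n k i : ℕ} (x : ℕ) (hi : i < k) :
    x % n ^ k / n ^ i % n = x / n ^ i % n := by
  obtain ⟨r, rfl⟩ : ∃ r, k = i + 1 + r := ⟨k - (i + 1), by omega⟩
  rw [show n ^ (i + 1 + r) = n ^ i * n ^ (r + 1) by ring, Nat.mod_mul_right_div_self,
    Nat.mod_mod_of_dvd _ (dvd_pow_self n (by omega))]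

theorem eq_of_digits_eq {Q : ℕ} : ∀ {R x y : ℕ}, x < Q ^ R → y < Q ^ R →
    (∀ r < R, x / Q ^ r % Q = y / Q ^ r % Q) → x = y := by
  intro R
  induction R with
  | zero => intro x y hx hy _; simp at hx hy; omega
  | succ R ih =>
    intro x y hx hy h
    have h1 : x / Q = y / Q := by
      refine ih (Nat.div_lt_of_lt_mul (by rwa [← pow_succ']))
        (Nat.div_lt_of_lt_mul (by rwa [← pow_succ'])) fun r hr => ?_
      rw [Nat.div_div_eq_div_mul, Nat.div_div_eq_div_mul, ← pow_succ']
      exact h (r + 1) (by omega)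
    have h0 := h 0 (by omega)
    simp only [pow_zero, Nat.div_one] at h0
    rw [← Nat.div_add_mod x Q, ← Nat.div_add_mod y Q, h1, h0]

/-- The function `v` with the digits of `x` to base `n`, lowest first, written at the positions
in `l`. -/
def writeDigits (n : ℕ) : ℕ → List ℕ → (ℕ → ℕ) → ℕ → ℕ
  | _, [], v => v
  | x, a :: l, v => writeDigits n (x / n) l (Function.update v a (x % n))

theorem writeDigits_of_notMem {n : ℕ} : ∀ {l : List ℕ} {x : ℕ} {v : ℕ → ℕ} {a : ℕ}, a ∉ l →
    writeDigits n x l v a = v a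
  | [], _, _, _, _ => rfl
  | b :: l, x, v, a, h => by
    rw [List.mem_cons, not_or] at h
    rw [writeDigits, writeDigits_of_notMem h.2, Function.update_of_ne h.1]

theorem writeDigits_append {n : ℕ} : ∀ (l l' : List ℕ) (x : ℕ) (v : ℕ → ℕ),
    writeDigits n x (l ++ l') v = writeDigits n (x / n ^ l.length) l' (writeDigits n x l v)
  | [], l', x, v => by simp [writeDigits]
  | a :: l, l', x, v => by
    rw [List.cons_append, writeDigits, writeDigits, writeDigits_append l l', List.length_cons,
      pow_succ', Nat.div_div_eq_div_mul]

theorem writeDigits_lt {n m : ℕ} (hn : 1 ≤ n) : ∀ {l : List ℕ} {x : ℕ} {v : ℕ → ℕ},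
    (∀ a < m, v a < n) → ∀ a < m, writeDigits n x l v a < n
  | [], _, _, h => h
  | b :: l, x, v, h => by
    rw [writeDigits]
    refine writeDigits_lt hn fun a ha => ?_
    rw [Function.update_apply]
    split
    · exact Nat.mod_lt _ hn
    · exact h a ha

/-- The positions in `l` are overwritten, so their old contents do not matter. A sweep can therefore
decode each number on top of the previous candidate without restoring it. -/
theorem writeDigits_congr {n : ℕ} : ∀ {l : List ℕ} {x : ℕ} {v v' : ℕ → ℕ},
    (∀ a ∉ l, v a = v' a) → writeDigits n x l v = writeDigits n x l v'
  | [], _, _, _, h => funext fun a => h a (by simp)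
  | b :: l, x, v, v', h => by
    rw [writeDigits, writeDigits]
    have h' : ∀ a ∉ l, Function.update v b (x % n) a = Function.update v' b (x % n) a := by
      intro a ha
      rw [Function.update_apply, Function.update_apply]
      split
      · rfl
      · next hab => exact h a (by simp [hab, ha])
    exact writeDigits_congr h'

theorem writeDigits_range' {n : ℕ} : ∀ (k o x : ℕ) (v : ℕ → ℕ) (a : ℕ),
    writeDigits n x (List.range' o k) v a =
      if o ≤ a ∧ a < o + k then x / n ^ (a - o) % n else v a := by
  intro k
  induction k with
  | zero => intro o x v a; rw [if_neg (by omega)]; rfl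
  | succ k ih =>
    intro o x v a
    rw [List.range'_succ, writeDigits, ih]
    by_cases h : a = o
    · subst h
      rw [if_neg (by omega), if_pos (by omega)]
      simp
    · rw [Function.update_of_ne h]
      by_cases h' : o + 1 ≤ a ∧ a < o + 1 + k
      · rw [if_pos h', if_pos (by omega), Nat.div_div_eq_div_mul, ← pow_succ',
          show a - (o + 1) + 1 = a - o by omega]
      · rw [if_neg h', if_neg (by omega)]

/-! ## Separating finitely many items -/

/-- If every two items collide at few indices, then some index separates all items. -/
theorem exists_separating {E ι : Type*} [DecidableEq E] [DecidableEq ι] (S : Finset E)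
    (I : Finset ι) (bad : E → E → ι → Prop) [∀ e e', DecidablePred (bad e e')] {s : ℕ}
    (hs : S.card ^ 2 ≤ s) (hI : I.Nonempty)
    (h : ∀ e ∈ S, ∀ e' ∈ S, e ≠ e' → s * (I.filter (bad e e')).card < I.card) :
    ∃ i ∈ I, ∀ e ∈ S, ∀ e' ∈ S, e ≠ e' → ¬ bad e e' i := by
  by_contra! hcon
  have hsub : I ⊆ S.offDiag.biUnion fun e => I.filter (bad e.1 e.2) := by
    intro i hi
    obtain ⟨e, he, e', he', hne, hb⟩ := hcon i hi
    simp only [Finset.mem_biUnion, Finset.mem_offDiag, Finset.mem_filter]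
    exact ⟨(e, e'), ⟨he, he', hne⟩, hi, hb⟩
  have hle := (Finset.card_le_card hsub).trans Finset.card_biUnion_le
  -- The strict union bound needs at least one pair; without pairs, the nonemptiness of `I`
  -- contradicts the covering instead.
  rcases S.offDiag.eq_empty_or_nonempty with h0 | hne
  · rw [h0, Finset.sum_empty] at hle
    have := hI.card_pos
    omega
  · have h1 : ∑ e ∈ S.offDiag, s * (I.filter (bad e.1 e.2)).card < ∑ _e ∈ S.offDiag, I.card := by
      refine Finset.sum_lt_sum_of_nonempty hne fun e he => ?_
      rw [Finset.mem_offDiag] at he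
      exact h e.1 he.1 e.2 he.2.1 he.2.2
    rw [← Finset.mul_sum, Finset.sum_const, smul_eq_mul, Finset.offDiag_card] at h1
    have h2 : (S.card * S.card - S.card) * I.card ≤ s * I.card :=
      Nat.mul_le_mul_right _ ((Nat.sub_le _ _).trans (by rwa [← sq]))
    have h3 := Nat.mul_le_mul_left s hle
    omega

/-! ### Moduli -/

open Nat in
/-- For a fixed `b`, the numbers `modulus T b i` with `i < T` are pairwise coprime. -/
def modulus (T b i : ℕ) : ℕ := (i + 1) * (T ! * b) + 1

/-- A common prime divides the difference `(j - i) * (T ! * b)`. As `j - i < T`, a prime factor of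
`j - i` already divides `T !`; so the prime divides `T ! * b` in every case, and hence it divides 1.
-/
theorem coprime_modulus {T b i j : ℕ} (hij : i < j) (hj : j < T) :
    Nat.Coprime (modulus T b i) (modulus T b j) := by
  refine Nat.coprime_of_dvd fun p hp hi hj' => ?_
  have hsub : p ∣ (j - i) * (T.factorial * b) := by
    have := Nat.dvd_sub hj' hi
    rwa [modulus, modulus, Nat.add_sub_add_right, ← Nat.sub_mul, Nat.add_sub_add_right] at this
  have hM : p ∣ T.factorial * b := by
    rcases hp.dvd_mul.1 hsub with h | h
    · exact Dvd.dvd.mul_right ((hp.dvd_factorial.2 ((Nat.le_of_dvd (by omega) h).trans (by omega)))) _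
    · exact h
  exact hp.one_lt.ne' (Nat.dvd_one.1 ((Nat.dvd_add_right (hM.mul_left (i + 1))).1 hi))

theorem le_modulus {T b i : ℕ} : b ≤ modulus T b i := by
  have h1 : b ≤ T.factorial * b := Nat.le_mul_of_pos_left _ T.factorial_pos
  have h2 : T.factorial * b ≤ (i + 1) * (T.factorial * b) := Nat.le_mul_of_pos_left _ (by omega)
  rw [modulus]; omega

/-- By coprimality the product of the moduli at which `x` and `y` agree divides `y - x`. With `2 *
c` such moduli, each at least `b`, the product would be at least `b ^ (2 * c) ≥ n ^ 2`, more than a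
nonzero difference can be. -/
theorem card_collisions_lt {T b c n x y : ℕ} (hb : 1 ≤ b) (hn : n ≤ b ^ c) (hx : x < n ^ 2)
    (hy : y < n ^ 2) (hxy : x ≠ y) :
    ((Finset.range T).filter fun i => x % modulus T b i = y % modulus T b i).card < 2 * c := by
  by_contra! hcard
  set F := (Finset.range T).filter fun i => x % modulus T b i = y % modulus T b i with hF
  have hdvd : ((∏ i ∈ F, modulus T b i : ℕ) : ℤ) ∣ (y : ℤ) - x := by
    rw [Nat.cast_prod]
    refine Finset.prod_dvd_of_coprime (fun i hi j hj hij => ?_) fun i hi => ?_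
    · have hi' := Finset.mem_range.1 (Finset.mem_filter.1 (Finset.mem_coe.1 hi)).1
      have hj' := Finset.mem_range.1 (Finset.mem_filter.1 (Finset.mem_coe.1 hj)).1
      rw [Function.onFun, Nat.isCoprime_iff_coprime]
      rcases lt_or_gt_of_ne hij with h | h
      · exact coprime_modulus h hj'
      · exact (coprime_modulus h hi').symm
    · exact (Nat.modEq_iff_dvd).1 (Finset.mem_filter.1 hi).2
  have h1 : b ^ F.card ≤ ∏ i ∈ F, modulus T b i := by
    rw [← Finset.prod_const]
    exact Finset.prod_le_prod' fun i _ => le_modulus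
  have h2 : n ^ 2 ≤ b ^ F.card :=
    calc n ^ 2 ≤ (b ^ c) ^ 2 := Nat.pow_le_pow_left hn 2
      _ = b ^ (2 * c) := by rw [← pow_mul, mul_comm]
      _ ≤ b ^ F.card := Nat.pow_le_pow_right hb hcard
  have h3 := Int.le_of_dvd (b := |(y : ℤ) - x|) (abs_pos.2 (by omega)) ((dvd_abs _ _).2 hdvd)
  have h4 : |(y : ℤ) - x| < (n ^ 2 : ℕ) := by rw [abs_lt]; omega
  have h5 : ((n ^ 2 : ℕ) : ℤ) ≤ ((∏ i ∈ F, modulus T b i : ℕ) : ℤ) := by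
    exact_mod_cast h2.trans h1
  omega

/-! ### A greedy code -/

/-- The number of common digits of `u` and `v` among the `R` lowest digits to base `Q`. -/
def agreement (Q R u v : ℕ) : ℕ :=
  ((Finset.range R).filter fun r => u / Q ^ r % Q = v / Q ^ r % Q).card

theorem agreement_succ (Q R u v : ℕ) : agreement Q (R + 1) u v =
    agreement Q R u v + if u / Q ^ R % Q = v / Q ^ R % Q then 1 else 0 := by
  rw [agreement, agreement, Finset.range_add_one, Finset.filter_insert]
  split
  · rw [Finset.card_insert_of_notMem (by simp)]
  · rfl

theorem agreement_le (Q R u v : ℕ) : agreement Q R u v ≤ R :=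
  (Finset.card_filter_le _ _).trans (by simp)

theorem agreement_self (Q R u : ℕ) : agreement Q R u u = R := by simp [agreement]

theorem agreement_comm (Q R u v : ℕ) : agreement Q R u v = agreement Q R v u := by
  simp only [agreement, eq_comm]

/-- A word with prescribed digits on `S` is determined by its digits at the other `R - S.card`
places. -/
theorem card_prescribed_le {Q R u : ℕ} (hQ : 1 ≤ Q) {S : Finset ℕ} (hS : S ⊆ Finset.range R) :
    ((Finset.range (Q ^ R)).filter fun v => ∀ r ∈ S, u / Q ^ r % Q = v / Q ^ r % Q).card ≤
      Q ^ (R - S.card) := by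
  have hcard : Fintype.card (↥(Finset.range R \ S) → Fin Q) = Q ^ (R - S.card) := by
    rw [Fintype.card_fun, Fintype.card_fin, Fintype.card_coe, Finset.card_sdiff_of_subset hS,
      Finset.card_range]
  rw [← hcard, ← Finset.card_univ]
  refine Finset.card_le_card_of_injOn (fun v r => ⟨v / Q ^ (r : ℕ) % Q, Nat.mod_lt _ hQ⟩)
    (fun _ _ => Finset.mem_coe.2 (Finset.mem_univ _)) fun v hv v' hv' heq => ?_
  simp only [Finset.coe_filter, Finset.mem_range, Set.mem_ofPred_eq] at hv hv'
  refine eq_of_digits_eq hv.1 hv'.1 fun r hr => ?_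
  by_cases hrS : r ∈ S
  · rw [← hv.2 r hrS, ← hv'.2 r hrS]
  · have := congrFun heq ⟨r, Finset.mem_sdiff.2 ⟨Finset.mem_range.2 hr, hrS⟩⟩
    simpa using this

/-- Sort the words by the set `S` of places at which they agree with `u`. There are at most `2 ^ R`
sets, and each with `R ≤ s * S.card` admits at most a fraction `(4 ^ s) ^ (-S.card) ≤ 4 ^ (-R)` of
all words. The alphabet size `4 ^ s` is chosen so that a factor `2 ^ R` remains. -/
theorem card_ball_le (s R u : ℕ) :
    ((Finset.range ((4 ^ s) ^ R)).filter fun v => R ≤ s * agreement (4 ^ s) R u v).card * 2 ^ R ≤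
      (4 ^ s) ^ R := by
  set Q := 4 ^ s with hQ
  have hQ1 : 1 ≤ Q := Nat.one_le_pow _ _ (by omega)
  set F := (Finset.range R).powerset.filter fun S => R ≤ s * S.card with hF
  have hsub : ((Finset.range (Q ^ R)).filter fun v => R ≤ s * agreement Q R u v) ⊆
      F.biUnion fun S => (Finset.range (Q ^ R)).filter fun v =>
        ∀ r ∈ S, u / Q ^ r % Q = v / Q ^ r % Q := by
    intro v hv
    rw [Finset.mem_filter] at hv
    rw [Finset.mem_biUnion]
    refine ⟨(Finset.range R).filter fun r => u / Q ^ r % Q = v / Q ^ r % Q, ?_, ?_⟩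
    · rw [hF, Finset.mem_filter, Finset.mem_powerset]
      exact ⟨Finset.filter_subset _ _, hv.2⟩
    · rw [Finset.mem_filter]
      exact ⟨hv.1, fun r hr => (Finset.mem_filter.1 hr).2⟩
  have hle := (Finset.card_le_card hsub).trans Finset.card_biUnion_le
  have hterm : ∀ S ∈ F, ((Finset.range (Q ^ R)).filter fun v =>
      ∀ r ∈ S, u / Q ^ r % Q = v / Q ^ r % Q).card * 4 ^ R ≤ Q ^ R := by
    intro S hS
    rw [hF, Finset.mem_filter, Finset.mem_powerset] at hS
    have hc : S.card ≤ R := by simpa using Finset.card_le_card hS.1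
    calc _ ≤ Q ^ (R - S.card) * 4 ^ (s * S.card) :=
          Nat.mul_le_mul (card_prescribed_le hQ1 hS.1) (Nat.pow_le_pow_right (by omega) hS.2)
      _ = Q ^ R := by rw [pow_mul, ← hQ, ← pow_add, Nat.sub_add_cancel hc]
  have hFc : F.card ≤ 2 ^ R := (Finset.card_filter_le _ _).trans (by simp)
  have h1 := Nat.mul_le_mul_right (4 ^ R) hle
  rw [Finset.sum_mul] at h1
  have h2 := h1.trans (Finset.sum_le_sum hterm)
  rw [Finset.sum_const, smul_eq_mul] at h2
  have h3 := h2.trans (Nat.mul_le_mul_right _ hFc)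
  rw [show (4 : ℕ) ^ R = 2 ^ R * 2 ^ R by rw [← mul_pow]; norm_num, mul_left_comm] at h3
  exact Nat.le_of_mul_le_mul_left h3 (by positivity)

/-- The first `cnt` values of `W` form a maximal code in which any two words agree in fewer than
`R / s` of the `R` digits to base `4 ^ s`. -/
structure IsCode (s R cnt : ℕ) (W : ℕ → ℕ) : Prop where
  separated : ∀ i < cnt, ∀ i' < cnt, i ≠ i' → s * agreement (4 ^ s) R (W i) (W i') < R
  covering : ∀ v < (4 ^ s) ^ R, ∃ i < cnt, R ≤ s * agreement (4 ^ s) R (W i) v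

/-- By maximality the balls around the code words cover everything, and each ball is at most a
fraction `2 ^ (-R)` of the whole. -/
theorem IsCode.le_card {s R cnt : ℕ} {W : ℕ → ℕ} (h : IsCode s R cnt W) : 2 ^ R ≤ cnt := by
  have hsub : Finset.range ((4 ^ s) ^ R) ⊆ (Finset.range cnt).biUnion fun i =>
      (Finset.range ((4 ^ s) ^ R)).filter fun v => R ≤ s * agreement (4 ^ s) R (W i) v := by
    intro v hv
    obtain ⟨i, hi, hv'⟩ := h.covering v (Finset.mem_range.1 hv)
    rw [Finset.mem_biUnion]
    exact ⟨i, Finset.mem_range.2 hi, Finset.mem_filter.2 ⟨hv, hv'⟩⟩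
  have hle := (Finset.card_le_card hsub).trans Finset.card_biUnion_le
  rw [Finset.card_range] at hle
  have h1 := Nat.mul_le_mul_right (2 ^ R) hle
  rw [Finset.sum_mul] at h1
  have h2 := h1.trans (Finset.sum_le_sum fun i _ => card_ball_le s R (W i))
  rw [Finset.sum_const, Finset.card_range, smul_eq_mul, mul_comm] at h2
  exact Nat.le_of_mul_le_mul_right h2 (by positivity)

/-- The hash functions: a digit of the code word whose number is a residue. -/
def hashVal (s T b : ℕ) (W : ℕ → ℕ) (i r x : ℕ) : ℕ :=
  W (x % modulus T b i) / (4 ^ s) ^ r % 4 ^ s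

/-- Two applications of `exists_separating`: first a modulus that keeps the values of `f` apart,
then a digit that keeps apart the code words numbered by their residues. -/
theorem exists_injOn_hashVal {E : Type*} [DecidableEq E] (S : Finset E) (f : E → ℕ)
    {s T b c n R cnt : ℕ} {W : ℕ → ℕ} (hs : S.card ^ 2 ≤ s) (hT : T = 2 * c * s + 1) (hb : 1 ≤ b)
    (hn : n ≤ b ^ c) (hR : modulus T b (T - 1) ≤ 2 ^ R) (hR0 : 1 ≤ R) (hW : IsCode s R cnt W)
    (hf : ∀ e ∈ S, f e < n ^ 2) (hinj : Set.InjOn f S) :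
    ∃ i < T, ∃ r < R, Set.InjOn (fun e => hashVal s T b W i r (f e)) S := by
  obtain ⟨i, hi, h1⟩ := exists_separating S (Finset.range T)
    (fun e e' i => f e % modulus T b i = f e' % modulus T b i) hs
    (Finset.nonempty_range_iff.2 (by omega)) fun e he e' he' hne => by
      have := card_collisions_lt (T := T) hb hn (hf e he) (hf e' he')
        fun h => hne (hinj he he' h)
      rw [Finset.card_range]
      calc _ ≤ s * (2 * c) := Nat.mul_le_mul_left _ this.le
        _ < T := by rw [hT]; linarith
  rw [Finset.mem_range] at hi
  -- Every residue numbers a code word: even the largest modulus is at most `2 ^ R`, and the code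
  -- has at least that many words.
  have hlt : ∀ x, x % modulus T b i < cnt := fun x =>
    calc x % modulus T b i < modulus T b i := Nat.mod_lt _ (by rw [modulus]; omega)
      _ ≤ modulus T b (T - 1) := by
        rw [modulus, modulus]
        exact Nat.add_le_add_right (Nat.mul_le_mul_right _ (by omega)) _
      _ ≤ 2 ^ R := hR
      _ ≤ cnt := hW.le_card
  obtain ⟨r, hr, h2⟩ := exists_separating S (Finset.range R)
    (fun e e' r => hashVal s T b W i r (f e) = hashVal s T b W i r (f e')) hs
    (Finset.nonempty_range_iff.2 (by omega)) fun e he e' he' hne => by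
      rw [Finset.card_range]
      exact hW.separated _ (hlt _) _ (hlt _) (h1 e he e' he' hne)
  refine ⟨i, hi, r, Finset.mem_range.1 hr, fun e he e' he' heq => ?_⟩
  by_contra hne
  exact h2 e he e' he' hne heq

infixr:60 " ⨾ " => Prog.seq

/-! ## Testing candidates

The candidates are functions from `{0, …, h - 1}` to `{0, …, n - 1}`, stored in array `5`. Register
`0` contains `n`, and registers `1` and `2` contain the literals `1` and `0`. -/

/-- The candidate `v` meets the constraint `(a, b, q)`: for `q = 0` the vertices `v a` and `v b` are
distinct, and for `q > 0` the entry of the matrix `hm` at `v a` and `v b` is `q`. -/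
def Meets (hm : ℕ → ℕ) (n : ℕ) (v : ℕ → ℕ) (c : ℕ × ℕ × ℕ) : Prop :=
  if c.2.2 = 0 then v c.1 ≠ v c.2.1 else hm (v c.1 * n + v c.2.1) = c.2.2

/-- The candidate `v` meets all constraints. -/
def Sat (hm : ℕ → ℕ) (n : ℕ) (v : ℕ → ℕ) (cs : List (ℕ × ℕ × ℕ)) : Prop :=
  ∀ c ∈ cs, Meets hm n v c

theorem Sat.congr {hm : ℕ → ℕ} {n : ℕ} {v v' : ℕ → ℕ} {cs : List (ℕ × ℕ × ℕ)}
    (h : ∀ c ∈ cs, v c.1 = v' c.1 ∧ v c.2.1 = v' c.2.1) : Sat hm n v cs ↔ Sat hm n v' cs := by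
  refine forall₂_congr fun c hc => ?_
  rw [Meets, Meets, (h c hc).1, (h c hc).2]

/-- Write the digits of the content of register `20` into the candidate. -/
def decode : List ℕ → Prog
  | [] => .skip
  | a :: l => .const 21 a ⨾ .arith .div 22 20 0 ⨾ .arith .mul 23 22 0 ⨾ .arith .sub 23 20 23 ⨾
      .store 5 21 23 ⨾ .arith .add 20 22 2 ⨾ decode l

theorem decode_writesReg : ∀ {l : List ℕ} {x : ℕ}, (decode l).WritesReg x → 20 ≤ x ∧ x < 24
  | [], _, h => h.elim
  | a :: l, x, h => by
    simp only [decode, Prog.WritesReg, false_or] at h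
    rcases h with h | h | h | h | h | h
    on_goal 6 => exact decode_writesReg h
    all_goals omega

theorem decode_writesArr : ∀ {l : List ℕ} {a : ℕ}, (decode l).WritesArr a → a = 5
  | [], _, h => h.elim
  | b :: l, a, h => by
    simp only [decode, Prog.WritesArr] at h
    have := decode_writesArr (l := l) (a := a)
    tauto

theorem run_decode {w n : ℕ} : ∀ {l : List ℕ} {x : ℕ} {s : State}, s.reg 0 = n → s.reg 2 = 0 →
    s.reg 20 = x → x < 2 ^ w → (∀ a ∈ l, a < 2 ^ w) →
    Run w (decode l) s (6 * l.length + 1) fun s' => s'.mem 5 = writeDigits n x l (s.mem 5)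
  | [], _, _, _, _, _, _, _ => .skip rfl
  | a :: l, x, s, hn, h0, hx, hlt, hl => by
    have h1 : x / n < 2 ^ w := (Nat.div_le_self _ _).trans_lt hlt
    refine .const_seq (hl a (by simp)) (.div_seq (v := x / n) (by simp [hn, hx]) h1
      (.mul_seq (v := x / n * n) (by simp [hn]) ((Nat.div_mul_le_self _ _).trans_lt hlt)
      (.sub_seq (v := x % n) ?_ ((Nat.mod_le _ _).trans_lt hlt)
      (.store_seq (i := a) (v := x % n) (by simp) (by simp)
      (.add_seq (v := x / n) (by simp [h0]) h1 ?_)))))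
    · have := Nat.div_add_mod' x n
      simp [hx]; omega
    · refine (run_decode (n := n) (x := x / n) (by simp [hn]) (by simp [h0]) (by simp) h1
        fun a ha => hl a (by simp [ha])).mono le_rfl fun s' hs' => ?_
      rw [hs']
      simp [writeDigits]

/-- Set register `24` to `0` if the candidate does not meet the constraint. -/
def checkOne (c : ℕ × ℕ × ℕ) : Prog :=
  .const 21 c.1 ⨾ .load 22 5 21 ⨾ .const 21 c.2.1 ⨾ .load 23 5 21 ⨾
    if c.2.2 = 0 then .branch 22 23 .skip (.branch 23 22 .skip (.const 24 0))
    else .arith .mul 22 22 0 ⨾ .arith .add 22 22 23 ⨾ .load 22 6 22 ⨾ .const 23 c.2.2 ⨾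
      .branch 22 23 (.const 24 0) (.branch 23 22 (.const 24 0) .skip)

/-- Set register `24` to `0` if the candidate does not meet all constraints. -/
def check : List (ℕ × ℕ × ℕ) → Prog
  | [] => .skip
  | c :: cs => checkOne c ⨾ check cs

theorem check_writesReg : ∀ {cs : List (ℕ × ℕ × ℕ)} {x : ℕ},
    (check cs).WritesReg x → 20 ≤ x ∧ x < 25
  | [], _, h => h.elim
  | c :: cs, x, h => by
    rw [check, Prog.WritesReg] at h
    rcases h with h | h
    · rw [checkOne] at h
      split at h <;> simp [Prog.WritesReg] at h <;> omega
    · exact check_writesReg h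

theorem check_writesArr : ∀ {cs : List (ℕ × ℕ × ℕ)} {a : ℕ}, ¬ (check cs).WritesArr a
  | [], _, h => h.elim
  | c :: cs, a, h => by
    rw [check, Prog.WritesArr] at h
    rcases h with h | h
    · rw [checkOne] at h
      split at h <;> simp [Prog.WritesArr] at h
    · exact check_writesArr h

theorem mul_add_lt_sq {n x y : ℕ} (hx : x < n) (hy : y < n) : x * n + y < n ^ 2 :=
  calc x * n + y < x * n + n := by omega
    _ = (x + 1) * n := by ring
    _ ≤ n * n := Nat.mul_le_mul_right _ hx
    _ = n ^ 2 := (sq n).symm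

open Classical in
-- The machine only tests `<`, so equality shows up as the failure of both strict comparisons. The
-- longest path consists of four steps to fetch the vertices, four to fetch the entry and the label,
-- and three for the nested tests.
theorem run_checkOne {w n h : ℕ} {c : ℕ × ℕ × ℕ} {s : State} (hn : s.reg 0 = n)
    (hw : n ^ 2 < 2 ^ w) (hhw : h < 2 ^ w) (hcells : ∀ a < h, s.mem 5 a < n)
    (hc : c.1 < h ∧ c.2.1 < h ∧ c.2.2 < 2 ^ w) :
    Run w (checkOne c) s 11 fun s' =>
      s'.reg 24 = if Meets (s.mem 6) n (s.mem 5) c then s.reg 24 else 0 := by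
  obtain ⟨a, b, q⟩ := c
  obtain ⟨ha, hb, hq⟩ := hc
  dsimp only at ha hb hq
  refine .const_seq (ha.trans hhw) (.load_seq (v := s.mem 5 a) (by simp) (.const_seq (hb.trans hhw)
    (.load_seq (v := s.mem 5 b) (by simp) ?_)))
  by_cases h0 : q = 0
  · rw [if_pos h0]
    refine Run.mono (.branch (T := 2) (fun h1 => (Run.skip ?_).mono (by omega) fun _ => id)
      fun h1 => .branch (fun h2 => .skip ?_) fun h2 => .const (by positivity) ?_) (by omega)
      fun _ => id
    all_goals simp only [State.reg_setReg, Nat.reduceEqDiff, if_true, if_false] at *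
    all_goals simp only [Meets, h0, if_true]
    · rw [if_pos (by omega)]
    · rw [if_pos (by omega)]
    · rw [if_neg (by omega)]
  · rw [if_neg h0]
    have hlt := mul_add_lt_sq (hcells a ha) (hcells b hb)
    refine Run.mono (.mul_seq (v := s.mem 5 a * n) (by simp [hn]) (by omega)
      (.add_seq (v := s.mem 5 a * n + s.mem 5 b) (by simp) (by omega)
      (.load_seq (v := s.mem 6 (s.mem 5 a * n + s.mem 5 b)) (by simp)
      (.const_seq hq (.branch (T := 2)
        (fun h1 => (Run.const (by positivity) ?_).mono (by omega) fun _ => id)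
        fun h1 => .branch (fun h2 => .const (by positivity) ?_) fun h2 => .skip ?_)))))
      (by omega) fun _ => id
    all_goals simp only [State.reg_setReg, Nat.reduceEqDiff, if_true, if_false] at *
    all_goals simp only [Meets, h0, if_false]
    · rw [if_neg (by omega)]
    · rw [if_neg (by omega)]
    · rw [if_pos (by omega)]

open Classical in
theorem run_check {w n h : ℕ} {hm v : ℕ → ℕ} (hw : n ^ 2 < 2 ^ w) (hhw : h < 2 ^ w)
    (hcells : ∀ a < h, v a < n) : ∀ {cs : List (ℕ × ℕ × ℕ)} {s : State}, s.reg 0 = n →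
    s.mem 5 = v → s.mem 6 = hm → (∀ c ∈ cs, c.1 < h ∧ c.2.1 < h ∧ c.2.2 < 2 ^ w) →
    Run w (check cs) s (11 * cs.length + 1) fun s' =>
      s'.reg 24 = if Sat hm n v cs then s.reg 24 else 0
  | [], s, _, _, _, _ => .skip (by simp [Sat])
  | c :: cs, s, hn, h5, h6, hcs => by
    subst h5 h6
    refine (Run.bind (run_checkOne hn hw hhw hcells (hcs c (by simp))) fun s' hs' hF => ?_).mono
      (T₁ := 11 + (11 * cs.length + 1)) (by simp; omega) fun _ => id
    have hreg : ∀ x, x < 20 → s'.reg x = s.reg x := fun x hx =>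
      hF.reg x fun h' => by
        have := check_writesReg (cs := [c]) (Or.inl h')
        omega
    have hmem : s'.mem = s.mem := funext fun a =>
      hF.mem a fun h' => check_writesArr (cs := [c]) (Or.inl h')
    refine (run_check hw hhw hcells (by rw [hreg 0 (by omega), hn]) (by rw [hmem]) (by rw [hmem])
      fun c hc => hcs c (by simp [hc])).mono le_rfl fun s'' hs'' => ?_
    rw [hs'', hs']
    simp only [Sat, List.mem_cons, forall_eq_or_imp]
    by_cases h1 : Meets (s.mem 6) n (s.mem 5) c <;>
      by_cases h2 : ∀ c ∈ cs, Meets (s.mem 6) n (s.mem 5) c <;> simp only [h1, h2] <;> simp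

/-! ## Sweeping over candidates -/

/-- The memory in which the search takes place, for candidates with `h` entries. -/
structure Ready (w n h : ℕ) (s : State) : Prop where
  fits : s.Fits w
  size : s.reg 0 = n
  one : s.reg 1 = 1
  zero : s.reg 2 = 0
  cells : ∀ a < h, s.mem 5 a < n

/-- What the word size has to accommodate, for candidates with `h` entries. -/
structure Roomy (w n h : ℕ) : Prop where
  sq_lt : n ^ 2 < 2 ^ w
  length_lt : h < 2 ^ w

/-- The constraints concern the entries of a candidate, and can be represented by words. -/
def Wellformed (w h : ℕ) (cs : List (ℕ × ℕ × ℕ)) : Prop :=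
  ∀ c ∈ cs, c.1 < h ∧ c.2.1 < h ∧ c.2.2 < 2 ^ w

/-- Decode register `25` and test the candidate, with the result in register `24`. -/
def probe (l : List ℕ) (cs : List (ℕ × ℕ × ℕ)) : Prog :=
  .arith .add 20 25 2 ⨾ decode l ⨾ .const 24 1 ⨾ check cs

theorem probe_writesReg {l : List ℕ} {cs : List (ℕ × ℕ × ℕ)} {x : ℕ}
    (h : (probe l cs).WritesReg x) : 20 ≤ x ∧ x < 25 := by
  simp only [probe, Prog.WritesReg] at h
  rcases h with h | h | h | h
  · omega
  · have := decode_writesReg h; omega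
  · omega
  · exact check_writesReg h

theorem probe_writesArr {l : List ℕ} {cs : List (ℕ × ℕ × ℕ)} {a : ℕ}
    (h : (probe l cs).WritesArr a) : a = 5 := by
  simp only [probe, Prog.WritesArr, false_or] at h
  exact h.elim decode_writesArr fun h => (check_writesArr h).elim

open Classical in
theorem run_probe {w n h x : ℕ} {l : List ℕ} {cs : List (ℕ × ℕ × ℕ)} {s : State}
    (hs : Ready w n h s) (hw : Roomy w n h) (hn : 1 ≤ n) (hx : s.reg 25 = x) (hl : ∀ a ∈ l, a < h)
    (hcs : Wellformed w h cs) :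
    Run w (probe l cs) s (6 * l.length + 11 * cs.length + 4) fun s' =>
      s'.mem 5 = writeDigits n x l (s.mem 5) ∧
      s'.reg 24 = if Sat (s.mem 6) n (writeDigits n x l (s.mem 5)) cs then 1 else 0 := by
  have hxw : x < 2 ^ w := hx ▸ hs.fits.1 25
  refine Run.mono (.add_seq (v := x) (by rw [hx, hs.zero]; rfl) hxw (.bind (run_decode (n := n)
    (x := x) (w := w) (by simp [hs.size]) (by simp [hs.zero]) (by simp) hxw
    fun a ha => (hl a ha).trans hw.length_lt) fun s' hs' hF => ?_))
    (show _ + (11 * cs.length + 2) + 1 ≤ _ by omega) fun _ => id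
  rw [State.mem_setReg] at hs'
  have hreg : s'.reg 0 = n := by
    rw [hF.reg 0 fun h' => by have := decode_writesReg h'; omega]; simp [hs.size]
  have hm : s'.mem 6 = s.mem 6 := hF.mem 6 fun h' => by have := decode_writesArr h'; omega
  refine .const_seq (hs.one ▸ hs.fits.1 1) ?_
  refine (run_check hw.sq_lt hw.length_lt (writeDigits_lt hn hs.cells) (by simp [hreg])
    (by simp [hs']; rfl) rfl hcs).frame.mono le_rfl fun s'' hs'' => ⟨?_, ?_⟩
  · rw [hs''.2.mem 5 check_writesArr, State.mem_setReg, hs']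
  · rw [hs''.1]; simp [hm]

/-- Test all candidates that arise by decoding numbers below the content of register `lim`. -/
def sweep (lim : ℕ) (l : List ℕ) (cs : List (ℕ × ℕ × ℕ)) (act : Prog) : Prog :=
  .const 25 0 ⨾ .loop 25 lim (probe l cs ⨾ act ⨾ .arith .add 25 25 1)

theorem sweep_writesReg {lim x : ℕ} {l : List ℕ} {cs : List (ℕ × ℕ × ℕ)} {act : Prog}
    (h : (sweep lim l cs act).WritesReg x) : (20 ≤ x ∧ x < 26) ∨ act.WritesReg x := by
  simp only [sweep, Prog.WritesReg] at h
  rcases h with h | h | h | h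
  · omega
  · have := probe_writesReg h; omega
  · exact .inr h
  · omega

theorem sweep_writesArr {lim a : ℕ} {l : List ℕ} {cs : List (ℕ × ℕ × ℕ)} {act : Prog}
    (h : (sweep lim l cs act).WritesArr a) : a = 5 ∨ act.WritesArr a := by
  simp only [sweep, Prog.WritesArr, false_or, or_false] at h
  exact h.imp_left probe_writesArr

/-- The states differ only where `probe` and the counter of `sweep` are written. -/
def SameButScratch (s s' : State) : Prop :=
  (∀ x, x < 20 ∨ 25 < x → s'.reg x = s.reg x) ∧ ∀ a ≠ 5, s'.mem a = s.mem a

open Classical in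
-- The invariant `I` belongs to the action and has to ignore scratch memory. Round `m` sees the
-- digits of `m` written into the initial candidate, not into that of the preceding round, so rounds
-- are independent of each other.
theorem run_sweep {w n h lim L Ta : ℕ} {l : List ℕ} {cs : List (ℕ × ℕ × ℕ)} {act : Prog}
    {s : State} (hs : Ready w n h s) (hw : Roomy w n h) (hn : 1 ≤ n) (hlim : s.reg lim = L)
    (hlim' : lim < 20) (hl : ∀ a ∈ l, a < h) (hcs : Wellformed w h cs)
    (hr : ∀ x ∈ [0, 1, 2, 25, lim], ¬ act.WritesReg x) (ha : ∀ a ∈ [5, 6], ¬ act.WritesArr a)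
    (I : ℕ → State → Prop) (h0 : I 0 s)
    (hI : ∀ m s₁ s₂, SameButScratch s₁ s₂ → I m s₁ → I m s₂)
    (step : ∀ m s', m < L → I m s' → s'.reg 2 = 0 → s'.reg 25 = m → s'.Fits w →
      s'.mem 5 = writeDigits n m l (s.mem 5) →
      (s'.reg 24 = if Sat (s.mem 6) n (writeDigits n m l (s.mem 5)) cs then 1 else 0) →
      Run w act s' Ta (I (m + 1))) :
    Run w (sweep lim l cs act) s (L * (6 * l.length + 11 * cs.length + Ta + 6) + 2) fun s' =>
      I L s' ∧ Ready w n h s' ∧ ∀ a ∉ l, s'.mem 5 a = s.mem 5 a := by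
  have hw0 : 0 < 2 ^ w := by positivity
  refine .const_seq hw0 ?_
  refine (Run.loop (fun m s' => I m s' ∧ s'.reg 25 = m ∧ Ready w n h s' ∧ s'.reg lim = L ∧
    s'.mem 6 = s.mem 6 ∧ ∀ a ∉ l, s'.mem 5 a = s.mem 5 a) L
    (T := (6 * l.length + 11 * cs.length + 4) + (Ta + 1)) ?_ ?_ ?_).mono
    (by linarith) fun s' hs' => ⟨hs'.1, hs'.2.2.1, hs'.2.2.2.2.2⟩
  · refine ⟨hI 0 s _ ⟨fun x hx => ?_, fun _ _ => rfl⟩ h0, by simp, ⟨hs.fits.setReg hw0,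
      by simp [hs.size], by simp [hs.one], by simp [hs.zero], hs.cells⟩, ?_, rfl, fun _ _ => rfl⟩
    · rw [State.reg_setReg, if_neg (by omega)]
    · rw [State.reg_setReg, if_neg (by omega), hlim]
  · rintro m s₁ hm ⟨hI₁, h25, hs₁, hlim₁, h6₁, h5₁⟩ -
    refine ⟨by rw [h25, hlim₁]; exact hm, .bind (run_probe hs₁ hw hn h25 hl hcs)
      fun s₂ ⟨hm₂, ht₂⟩ hF₂ => ?_⟩
    have hreg : ∀ x, x < 20 ∨ 24 < x → s₂.reg x = s₁.reg x := fun x hx =>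
      hF₂.reg x fun h' => by have := probe_writesReg h'; omega
    have hmem : ∀ a ≠ 5, s₂.mem a = s₁.mem a := fun a ha =>
      hF₂.mem a fun h' => ha (probe_writesArr h')
    -- Earlier rounds altered the candidate only at positions in `l`, which the present decoding
    -- overwrites.
    rw [writeDigits_congr h5₁] at hm₂ ht₂
    rw [h6₁] at ht₂
    refine .bind (step m s₂ hm (hI m _ _ ⟨fun x hx => hreg x (by omega), hmem⟩ hI₁)
      (by rw [hreg 2 (by omega), hs₁.zero]) (by rw [hreg 25 (by omega), h25])
      (hF₂.fits hs₁.fits) hm₂ ht₂) fun s₃ hI₃ hF₃ => ?_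
    have h0₃ := (hF₃.reg 0 (hr 0 (by simp))).trans (hreg 0 (by omega))
    have h1₃ := (hF₃.reg 1 (hr 1 (by simp))).trans (hreg 1 (by omega))
    have h2₃ := (hF₃.reg 2 (hr 2 (by simp))).trans (hreg 2 (by omega))
    have h25₃ := (hF₃.reg 25 (hr 25 (by simp))).trans (hreg 25 (by omega))
    have hl₃ := (hF₃.reg lim (hr lim (by simp))).trans (hreg lim (by omega))
    have h5₃ := hF₃.mem 5 (ha 5 (by simp))
    have h6₃ := (hF₃.mem 6 (ha 6 (by simp))).trans (hmem 6 (by omega))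
    have hf₃ := hF₃.fits (hF₂.fits hs₁.fits)
    have hmw : m + 1 < 2 ^ w := lt_of_le_of_lt hm (hlim₁ ▸ hs₁.fits.1 lim)
    refine .add (v := m + 1) (by rw [h25₃, h1₃, h25, hs₁.one]) hmw ⟨hI _ s₃ _ ⟨fun x hx => ?_,
      fun _ _ => rfl⟩ hI₃, by simp, ⟨hf₃.setReg hmw, by simp [h0₃, hs₁.size],
      by simp [h1₃, hs₁.one], by simp [h2₃, hs₁.zero], ?_⟩, ?_, ?_, ?_⟩
    · rw [State.reg_setReg, if_neg (by omega)]
    · rw [State.mem_setReg, h5₃, hm₂]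
      exact writeDigits_lt hn hs.cells
    · rw [State.reg_setReg, if_neg (by omega), hl₃, hlim₁]
    · rw [State.mem_setReg, h6₃, h6₁]
    · intro a ha
      rw [State.mem_setReg, h5₃, hm₂, writeDigits_of_notMem ha]
  · rintro s' ⟨-, h25, -, hlim', -⟩ -
    omega

/-! ## Finding the last vertices by matrix multiplication -/

/-- The row-major index of the matrix entry `(x, y)` is also the counter whose digits assign `y` to
the first listed block and `x` to the second. Hence one counter both generates the candidate and
addresses the matrix. -/
theorem writeDigits_two_blocks {n k x y o₁ o₂ : ℕ} (hy : y < n ^ k) (v : ℕ → ℕ) (a : ℕ) :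
    writeDigits n (x * n ^ k + y) (List.range' o₁ k ++ List.range' o₂ k) v a =
      if o₂ ≤ a ∧ a < o₂ + k then x / n ^ (a - o₂) % n
      else if o₁ ≤ a ∧ a < o₁ + k then y / n ^ (a - o₁) % n else v a := by
  have hpos : 0 < n ^ k := by omega
  rw [writeDigits_append, writeDigits_range', List.length_range', writeDigits_range',
    mul_comm, Nat.mul_add_div hpos, Nat.div_eq_of_lt hy, add_zero]
  split
  · rfl
  · split
    · next h =>
      rw [← mod_pow_div_pow_mod (k := k) (n ^ k * x + y) (by omega), Nat.mul_add_mod,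
        Nat.mod_eq_of_lt hy]
    · rfl

/-- The candidate with the digits of `x`, `y` and `z` in the first three blocks of length `k`. -/
def assemble (n k x y z : ℕ) (v : ℕ → ℕ) : ℕ → ℕ := fun a =>
  if a < k then x / n ^ a % n else if a < 2 * k then y / n ^ (a - k) % n
  else if a < 3 * k then z / n ^ (a - 2 * k) % n else v a

/-- The constraints that do not concern the block that starts at `o`. -/
def avoiding (k o : ℕ) (cs : List (ℕ × ℕ × ℕ)) : List (ℕ × ℕ × ℕ) :=
  cs.filter fun c => (c.1 < o ∨ o + k ≤ c.1) ∧ (c.2.1 < o ∨ o + k ≤ c.2.1)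

/-- Every constraint avoids one of the three blocks. -/
theorem sat_iff_avoiding {hm v : ℕ → ℕ} {n k : ℕ} {cs : List (ℕ × ℕ × ℕ)} :
    Sat hm n v cs ↔ Sat hm n v (avoiding k (2 * k) cs) ∧ Sat hm n v (avoiding k 0 cs) ∧
      Sat hm n v (avoiding k k cs) := by
  refine ⟨fun h => ⟨fun c hc => h c (List.mem_of_mem_filter hc),
    fun c hc => h c (List.mem_of_mem_filter hc), fun c hc => h c (List.mem_of_mem_filter hc)⟩,
    fun ⟨h₁, h₂, h₃⟩ c hc => ?_⟩
  by_cases c₁ : (c.1 < 2 * k ∨ 2 * k + k ≤ c.1) ∧ (c.2.1 < 2 * k ∨ 2 * k + k ≤ c.2.1)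
  · exact h₁ c (List.mem_filter.2 ⟨hc, by simpa using c₁⟩)
  by_cases c₂ : (c.1 < 0 ∨ 0 + k ≤ c.1) ∧ (c.2.1 < 0 ∨ 0 + k ≤ c.2.1)
  · exact h₂ c (List.mem_filter.2 ⟨hc, by simpa using c₂⟩)
  -- The constraint meets both the third and the first block, so its two positions are used up and
  -- it avoids the second.
  · exact h₃ c (List.mem_filter.2 ⟨hc, by simp only [decide_eq_true_eq]; omega⟩)

theorem Sat.congr_avoiding {hm v v' : ℕ → ℕ} {n k o : ℕ} {cs : List (ℕ × ℕ × ℕ)}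
    (h : ∀ a, a < o ∨ o + k ≤ a → v a = v' a) :
    Sat hm n v (avoiding k o cs) ↔ Sat hm n v' (avoiding k o cs) := by
  refine Sat.congr fun c hc => ?_
  have := (List.mem_filter.1 hc).2
  simp only [decide_eq_true_eq] at this
  exact ⟨h _ this.1, h _ this.2⟩

/-! ### Pairs of blocks versus assembled candidates -/

section Blocks

variable {n k x y z : ℕ} {hm v v' : ℕ → ℕ} {cs : List (ℕ × ℕ × ℕ)}

/-- The constraints in question ignore the remaining block, so whatever that block contains, the
test on two blocks decides them. This and the next two lemmas are the three edges of the triangle.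
-/
theorem sat_first_second (hy : y < n ^ k) (hv : ∀ a, 3 * k ≤ a → v' a = v a) :
    Sat hm n (writeDigits n (x * n ^ k + y) (List.range' k k ++ List.range' 0 k) v')
      (avoiding k (2 * k) cs) ↔ Sat hm n (assemble n k x y z v) (avoiding k (2 * k) cs) := by
  refine Sat.congr_avoiding fun a ha => ?_
  rw [writeDigits_two_blocks hy, assemble]
  split_ifs <;> first | rfl | omega | exact hv a (by omega)

theorem sat_second_third (hz : z < n ^ k) (hv : ∀ a, 3 * k ≤ a → v' a = v a) :
    Sat hm n (writeDigits n (y * n ^ k + z) (List.range' (2 * k) k ++ List.range' k k) v')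
      (avoiding k 0 cs) ↔ Sat hm n (assemble n k x y z v) (avoiding k 0 cs) := by
  refine Sat.congr_avoiding fun a ha => ?_
  rw [writeDigits_two_blocks hz, assemble]
  split_ifs <;> first | rfl | omega | exact hv a (by omega)

theorem sat_first_third (hz : z < n ^ k) (hv : ∀ a, 3 * k ≤ a → v' a = v a) :
    Sat hm n (writeDigits n (x * n ^ k + z) (List.range' (2 * k) k ++ List.range' 0 k) v')
      (avoiding k k cs) ↔ Sat hm n (assemble n k x y z v) (avoiding k k cs) := by
  refine Sat.congr_avoiding fun a ha => ?_
  rw [writeDigits_two_blocks hz, assemble]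
  split_ifs <;> first | rfl | omega | exact hv a (by omega)

theorem writeDigits_eq_assemble (hz : z < n ^ k) (hv : ∀ a, 3 * k ≤ a → v' a = v a) :
    writeDigits n y (List.range' k k)
      (writeDigits n (x * n ^ k + z) (List.range' (2 * k) k ++ List.range' 0 k) v') =
    assemble n k x y z v := by
  funext a
  rw [writeDigits_range', writeDigits_two_blocks hz, assemble]
  split_ifs <;> first | rfl | omega | exact hv a (by omega)

theorem exists_assemble {h : ℕ} (hk : 3 * k ≤ h) {u : ℕ → ℕ} (hu : ∀ a < h, u a < n)
    (hv : ∀ a, 3 * k ≤ a → a < h → u a = v a) :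
    ∃ x < n ^ k, ∃ y < n ^ k, ∃ z < n ^ k, ∀ a < h, u a = assemble n k x y z v a := by
  obtain ⟨x, hx, hx'⟩ := exists_digits (n := n) k u fun i hi => hu i (by omega)
  obtain ⟨y, hy, hy'⟩ := exists_digits (n := n) k (fun i => u (k + i)) fun i hi => hu _ (by omega)
  obtain ⟨z, hz, hz'⟩ := exists_digits (n := n) k (fun i => u (2 * k + i))
    fun i hi => hu _ (by omega)
  refine ⟨x, hx, y, hy, z, hz, fun a ha => ?_⟩
  rw [assemble]
  split_ifs with h₁ h₂ h₃
  · exact (hx' a h₁).symm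
  · rw [hy' (a - k) (by omega)]; congr 1; omega
  · rw [hz' (a - 2 * k) (by omega)]; congr 1; omega
  · exact hv a (by omega) ha

end Blocks

/-! ### The triangle search and its output -/

/-- Copy the candidate into the first cells of array `2`. -/
def copyOut : ℕ → Prog
  | 0 => .skip
  | h + 1 => copyOut h ⨾ .const 21 h ⨾ .load 22 5 21 ⨾ .store 2 21 22

theorem copyOut_writesReg : ∀ {h x : ℕ}, (copyOut h).WritesReg x → x = 21 ∨ x = 22
  | 0, _, h => h.elim
  | _ + 1, _, h => by
    simp only [copyOut, Prog.WritesReg, or_false] at h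
    exact h.elim copyOut_writesReg id

theorem copyOut_writesArr : ∀ {h a : ℕ}, (copyOut h).WritesArr a → a = 2
  | 0, _, h => h.elim
  | _ + 1, _, h => by
    simp only [copyOut, Prog.WritesArr, false_or] at h
    exact h.elim copyOut_writesArr id

theorem run_copyOut {w : ℕ} {s : State} : ∀ {h : ℕ}, h < 2 ^ w →
    Run w (copyOut h) s (3 * h + 1) fun s' => ∀ a < h, s'.mem 2 a = s.mem 5 a
  | 0, _ => .skip (by simp)
  | h + 1, hw => by
    refine (Run.bind (run_copyOut (by omega)) fun s' hs' hF => ?_).mono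
      (show 3 * h + 1 + 3 ≤ _ by omega) fun _ => id
    refine .const_seq (by omega) (.load_seq (v := s'.mem 5 h) (by simp)
      (.store (i := h) (v := s'.mem 5 h) (by simp) (by simp) fun a ha => ?_))
    have h5 : s'.mem 5 = s.mem 5 := hF.mem 5 fun h' => by have := copyOut_writesArr h'; omega
    rw [State.mem_setMem, if_pos rfl, Function.update_apply, h5]
    split
    · next e => rw [e]
    · rw [State.mem_setReg, State.mem_setReg]; exact hs' a (by omega)

/-- Record the number of a candidate that passes the test and has a nonzero entry in the
product matrix. -/
def scanAct : Prog :=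
  .load 27 102 25 ⨾ .branch 2 27 (.branch 2 24 (.const 26 1 ⨾ .arith .add 28 25 2) .skip) .skip

/-- Report a candidate that passes the test. -/
def reportAct (h : ℕ) : Prog :=
  .branch 2 24 (copyOut h ⨾ .const 6 1) .skip

/-- Search for a candidate that meets the constraints `cs` and has the current values outside the
first three blocks of length `k`, using the program `P` for matrix multiplication. -/
def searchBlocks (P : Prog) (k h : ℕ) (cs : List (ℕ × ℕ × ℕ)) : Prog :=
  sweep 3 (List.range' k k ++ List.range' 0 k) (avoiding k (2 * k) cs) (.store 100 25 24) ⨾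
  sweep 3 (List.range' (2 * k) k ++ List.range' k k) (avoiding k 0 cs) (.store 101 25 24) ⨾
  .arith .add 100 4 2 ⨾
  P.shift ⨾
  .const 26 0 ⨾
  sweep 3 (List.range' (2 * k) k ++ List.range' 0 k) (avoiding k k cs) scanAct ⨾
  .branch 2 26
    (.arith .add 20 28 2 ⨾ decode (List.range' (2 * k) k ++ List.range' 0 k) ⨾
      sweep 4 (List.range' k k) cs (reportAct h))
    .skip

/-- Memory is allotted in layers so that inner programs spare the outer ones: registers `0` to `5`
and `7` hold parameters, `6` the success flag, `20` to `29` scratch and inner counters, those from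
`30` the data and counters of the hashing, and those from `100` belong to the relocated
multiplication. -/
theorem searchBlocks_writesReg {P : Prog} {k h x : ℕ} {cs : List (ℕ × ℕ × ℕ)}
    (hx : (searchBlocks P k h cs).WritesReg x) : x = 6 ∨ 20 ≤ x ∧ x < 29 ∨ 100 ≤ x := by
  rcases hx with h | h | h | h | h | h | (h | h | h) | h
  · have := sweep_writesReg h
    simp [Prog.WritesReg] at this; omega
  · have := sweep_writesReg h
    simp [Prog.WritesReg] at this; omega
  · simp only [Prog.WritesReg] at h; omega
  · have := h.shift_ge; omega
  · simp only [Prog.WritesReg] at h; omega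
  · have := sweep_writesReg h
    simp [scanAct, Prog.WritesReg] at this; omega
  · simp only [Prog.WritesReg] at h; omega
  · have := decode_writesReg h; omega
  · rcases sweep_writesReg h with h | (h | h) | h
    · omega
    · have := copyOut_writesReg h; omega
    · exact .inl h
    · exact h.elim
  · exact h.elim

theorem searchBlocks_writesArr {P : Prog} {k h a : ℕ} {cs : List (ℕ × ℕ × ℕ)}
    (ha : (searchBlocks P k h cs).WritesArr a) : a = 2 ∨ a = 5 ∨ 100 ≤ a := by
  rcases ha with h | h | h | h | h | h | (h | h | h) | h
  · have := sweep_writesArr h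
    simp only [Prog.WritesArr] at this; omega
  · have := sweep_writesArr h
    simp only [Prog.WritesArr] at this; omega
  · exact h.elim
  · have := h.shift_ge; omega
  · exact h.elim
  · have := sweep_writesArr h
    simp [scanAct, Prog.WritesArr] at this; omega
  · exact h.elim
  · have := decode_writesArr h; omega
  · rcases sweep_writesArr h with h | (h | h) | h
    · omega
    · have := copyOut_writesArr h; omega
    · exact h.elim
    · exact h.elim
  · exact h.elim

open Classical in
/-- Filling a matrix with the results of tests. -/
theorem run_fill {w n h L A : ℕ} {l : List ℕ} {cs : List (ℕ × ℕ × ℕ)} {s : State}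
    (hs : Ready w n h s) (hw : Roomy w n h) (hn : 1 ≤ n) (hlim : s.reg 3 = L) (hA : 100 ≤ A)
    (hl : ∀ a ∈ l, a < h) (hcs : Wellformed w h cs) :
    Run w (sweep 3 l cs (.store A 25 24)) s (L * (6 * l.length + 11 * cs.length + 7) + 2) fun s' =>
      (∀ m < L, s'.mem A m = if Sat (s.mem 6) n (writeDigits n m l (s.mem 5)) cs then 1 else 0) ∧
      Ready w n h s' ∧ ∀ a ∉ l, s'.mem 5 a = s.mem 5 a := by
  refine run_sweep (Ta := 1) hs hw hn hlim (by omega) hl hcs (by simp [Prog.WritesReg])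
    (fun a ha => ?_)
    (fun m s' => ∀ i < m, s'.mem A i =
      if Sat (s.mem 6) n (writeDigits n i l (s.mem 5)) cs then 1 else 0) (by simp)
    (fun m s₁ s₂ h₁₂ h₁ => by rwa [h₁₂.2 A (by omega)]) fun m s' hm hI _ h25 _ _ h24 => ?_
  · simp only [List.mem_cons, List.not_mem_nil, or_false] at ha
    simp only [Prog.WritesArr]; omega
  · refine .store h25 h24 fun i hi => ?_
    rw [State.mem_setMem, if_pos rfl, Function.update_apply]
    split
    · next e => rw [e]
    · exact hI i (by omega)

open Classical in
-- A nonzero product entry says that some middle block fits both outer blocks, and the test says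
-- that the outer blocks fit each other. Every hit overwrites the recorded number.
theorem run_scan {w n h L : ℕ} {l : List ℕ} {cs : List (ℕ × ℕ × ℕ)} {s : State}
    (hs : Ready w n h s) (hw : Roomy w n h) (hn : 1 ≤ n) (hlim : s.reg 3 = L) (h26 : s.reg 26 = 0)
    (hl : ∀ a ∈ l, a < h) (hcs : Wellformed w h cs) :
    Run w (sweep 3 l cs scanAct) s (L * (6 * l.length + 11 * cs.length + 11) + 2) fun s' =>
      ((s'.reg 26 = 1 ∧ s'.reg 28 < L ∧ s.mem 102 (s'.reg 28) ≠ 0 ∧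
          Sat (s.mem 6) n (writeDigits n (s'.reg 28) l (s.mem 5)) cs) ∨
        (s'.reg 26 = 0 ∧ ∀ m < L, s.mem 102 m ≠ 0 →
          ¬ Sat (s.mem 6) n (writeDigits n m l (s.mem 5)) cs)) ∧
      Ready w n h s' ∧ ∀ a ∉ l, s'.mem 5 a = s.mem 5 a := by
  refine (run_sweep (Ta := 5) hs hw hn hlim (by omega) hl hcs (by simp [Prog.WritesReg, scanAct])
    (by simp [Prog.WritesArr, scanAct])
    (fun m s' => s'.mem 102 = s.mem 102 ∧ ((s'.reg 26 = 1 ∧ s'.reg 28 < m ∧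
      s.mem 102 (s'.reg 28) ≠ 0 ∧ Sat (s.mem 6) n (writeDigits n (s'.reg 28) l (s.mem 5)) cs) ∨
        (s'.reg 26 = 0 ∧ ∀ i < m, s.mem 102 i ≠ 0 →
          ¬ Sat (s.mem 6) n (writeDigits n i l (s.mem 5)) cs))) (by simp [h26])
    (fun m s₁ s₂ h₁₂ h₁ => by
      rwa [h₁₂.2 102 (by omega), h₁₂.1 26 (by omega), h₁₂.1 28 (by omega)])
    fun m s' hm hI h2 h25 hf _ h24 => ?_).mono le_rfl fun s' hs' => ⟨hs'.1.2, hs'.2⟩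
  obtain ⟨h102, hI⟩ := hI
  refine .load_seq (v := s.mem 102 m) (by rw [h102, h25]) (.branch (T := 3) (fun h₁ => .branch
    (T := 2) (fun h₂ => ?_) fun h₂ => (Run.skip ?_).mono (by omega) fun _ => id)
    fun h₁ => (Run.skip ?_).mono (by omega) fun _ => id)
  all_goals simp only [State.reg_setReg, Nat.reduceEqDiff, if_true, if_false, h2] at h₁
  · simp only [State.reg_setReg, Nat.reduceEqDiff, if_false, h2, h24] at h₂
    have hsat : Sat (s.mem 6) n (writeDigits n m l (s.mem 5)) cs := by
      by_contra hcon
      rw [if_neg hcon] at h₂; omega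
    have h28 : m < 2 ^ w := h25 ▸ hf.1 25
    refine .const_seq (hs.one ▸ hs.fits.1 1) (.add (v := m) (by simp [h25, h2]) h28
      ⟨by simp [h102], .inl ?_⟩)
    simpa using ⟨by omega, hsat⟩
  · simp only [State.reg_setReg, Nat.reduceEqDiff, if_false, h2, h24] at h₂
    have hsat : ¬ Sat (s.mem 6) n (writeDigits n m l (s.mem 5)) cs := by
      intro hcon
      rw [if_pos hcon] at h₂; omega
    refine ⟨h102, hI.imp (fun h => ⟨h.1, ?_, h.2.2⟩) fun h => ⟨h.1, fun i hi hi' => ?_⟩⟩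
    · exact Nat.lt_succ_of_lt h.2.1
    · rcases Nat.lt_succ_iff_lt_or_eq.1 hi with hi | rfl
      · exact h.2 i hi hi'
      · exact hsat
  · refine ⟨h102, hI.imp (fun h => ⟨h.1, ?_, h.2.2⟩) fun h => ⟨h.1, fun i hi hi' => ?_⟩⟩
    · exact Nat.lt_succ_of_lt h.2.1
    · rcases Nat.lt_succ_iff_lt_or_eq.1 hi with hi | rfl
      · exact h.2 i hi hi'
      · omega

/-- The outcome of a search for candidates with the property `X`: either register `6` contains `1`
and array `2` contains a candidate that meets the constraints, or nothing was written and there is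
no candidate with the property `X`. -/
def Outcome (hm : ℕ → ℕ) (n h : ℕ) (cs : List (ℕ × ℕ × ℕ)) (X : (ℕ → ℕ) → Prop)
    (s s' : State) : Prop :=
  (s'.reg 6 = 1 ∧ ∃ v, (∀ a < h, v a < n) ∧ Sat hm n v cs ∧ ∀ a < h, s'.mem 2 a = v a) ∨
  (s'.reg 6 = s.reg 6 ∧ s'.mem 2 = s.mem 2 ∧
    ∀ v, (∀ a < h, v a < n) → Sat hm n v cs → ¬ X v)

open Classical in
theorem run_report {w n h L : ℕ} {l : List ℕ} {cs : List (ℕ × ℕ × ℕ)} {s : State}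
    (hs : Ready w n h s) (hw : Roomy w n h) (hn : 1 ≤ n) (hlim : s.reg 4 = L)
    (hl : ∀ a ∈ l, a < h) (hcs : Wellformed w h cs) :
    Run w (sweep 4 l cs (reportAct h)) s
      (L * (6 * l.length + 11 * cs.length + (3 * h + 3) + 6) + 2) fun s' =>
      Outcome (s.mem 6) n h cs (fun v => ∃ m < L, v = writeDigits n m l (s.mem 5)) s s' ∧
      Ready w n h s' ∧ ∀ a ∉ l, s'.mem 5 a = s.mem 5 a := by
  have hr : ∀ x, (reportAct h).WritesReg x → x = 6 ∨ x = 21 ∨ x = 22 := by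
    intro x hx
    simp only [reportAct, Prog.WritesReg, or_false] at hx
    exact hx.symm.imp id copyOut_writesReg
  have ha : ∀ a, (reportAct h).WritesArr a → a = 2 := by
    intro a ha
    simp only [reportAct, Prog.WritesArr, or_false] at ha
    exact copyOut_writesArr ha
  refine run_sweep (Ta := 3 * h + 3) hs hw hn hlim (by omega) hl hcs
    (fun x hx hx' => by have := hr x hx'; simp at hx; omega)
    (fun a ha₁ ha' => by have := ha a ha'; simp at ha₁; omega)
    (fun m s' => Outcome (s.mem 6) n h cs
      (fun v => ∃ i < m, v = writeDigits n i l (s.mem 5)) s s')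
    (Or.inr ⟨rfl, rfl, by simp⟩)
    (fun m s₁ s₂ h₁₂ h₁ => by
      rwa [Outcome, h₁₂.2 2 (by omega), h₁₂.1 6 (by omega)])
    fun m s' hm hI h2 h25 hf h5 h24 => .branch (T := 3 * h + 2) (fun h₁ => ?_) fun h₁ =>
      (Run.skip ?_).mono (by omega) fun _ => id
  all_goals rw [h2, h24] at h₁
  · have hsat : Sat (s.mem 6) n (writeDigits n m l (s.mem 5)) cs := by
      by_contra hcon
      rw [if_neg hcon] at h₁; omega
    refine (Run.bind (run_copyOut hw.length_lt) fun s'' hs'' _ =>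
      Run.const (hs.one ▸ hs.fits.1 1) (Or.inl ?_)).mono (T₁ := 3 * h + 1 + 1) le_rfl fun _ => id
    exact ⟨by simp, _, writeDigits_lt hn hs.cells, hsat, fun a ha => by
      rw [State.mem_setReg, hs'' a ha, h5]⟩
  · have hsat : ¬ Sat (s.mem 6) n (writeDigits n m l (s.mem 5)) cs := by
      intro hcon
      rw [if_pos hcon] at h₁; omega
    refine hI.imp id fun h => ⟨h.1, h.2.1, ?_⟩
    rintro v hv hv' ⟨i, hi, rfl⟩
    rcases Nat.lt_succ_iff_lt_or_eq.1 hi with hi | rfl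
    · exact h.2.2 _ hv hv' ⟨i, hi, rfl⟩
    · exact hsat hv'

theorem Run.shift {w T : ℕ} {P : Prog} {s : State} {Q : State → Prop}
    (h : Run w P s.upper T Q) : Run w P.shift s T fun s' => Q s'.upper := by
  obtain ⟨t, u, he, ht, hq⟩ := h
  obtain ⟨s', he', rfl⟩ := he.shift s rfl
  exact ⟨t, s', he', ht, hq⟩

theorem State.Fits.upper {w : ℕ} {s : State} (h : s.Fits w) : s.upper.Fits w :=
  ⟨fun _ => h.1 _, fun _ _ => h.2 _ _⟩

theorem Ready.of_frame {w n h : ℕ} {p : Prog} {s s' : State} (hs : Ready w n h s)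
    (hF : Frame w p s s') (hr : ∀ x < 3, ¬ p.WritesReg x) (hc : ∀ a < h, s'.mem 5 a < n) :
    Ready w n h s' :=
  ⟨hF.fits hs.fits, (hF.reg 0 (hr 0 (by omega))).trans hs.size,
    (hF.reg 1 (hr 1 (by omega))).trans hs.one, (hF.reg 2 (hr 2 (by omega))).trans hs.zero, hc⟩

theorem Wellformed.avoiding {w h k o : ℕ} {cs : List (ℕ × ℕ × ℕ)} (hcs : Wellformed w h cs) :
    Wellformed w h (avoiding k o cs) :=
  fun c hc => hcs c (List.mem_of_mem_filter hc)

theorem length_avoiding_le (k o : ℕ) (cs : List (ℕ × ℕ × ℕ)) :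
    (avoiding k o cs).length ≤ cs.length := List.length_filter_le _ _

/-- A time bound for each of the sweeps of `searchBlocks`. -/
def sweepTime (k h c : ℕ) : ℕ := 12 * k + 11 * c + 3 * h + 14

/-- The matrices are indexed by assignments of the first and second, and of the second and third
block. The scan finds an outer pair `(x, z)` that closes a triangle but not its middle vertex; the
latter is recovered by trying all `n ^ k` assignments of the second block once. Each of the four
sweeps costs at most `n ^ (2 * k) * sweepTime`, up to constants. -/
theorem run_searchBlocks {w n k h TP : ℕ} {P : Prog} {cs : List (ℕ × ℕ × ℕ)} {s : State}
    (hs : Ready w n h s) (hw : Roomy w n h) (hn : 1 ≤ n) (hk : 3 * k ≤ h)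
    (h3 : s.reg 3 = n ^ (2 * k)) (h4 : s.reg 4 = n ^ k) (hcs : Wellformed w h cs)
    (hP : ∀ (A B : Matrix (Fin (n ^ k)) (Fin (n ^ k)) Bool) (u : State), u.Fits w →
      HoldsMatrices (n ^ k) A B u → Run w P u TP (HoldsProduct (n ^ k) A B)) :
    Run w (searchBlocks P k h cs) s
      (4 * (n ^ (2 * k) * sweepTime k h cs.length) + TP + 12 * k + 30) fun s' =>
      Ready w n h s' ∧
      Outcome (s.mem 6) n h cs (fun v => ∀ a, 3 * k ≤ a → a < h → v a = s.mem 5 a) s s' := by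
  classical
  set N := n ^ k with hN
  have hNN : n ^ (2 * k) = N * N := by rw [hN, ← pow_add]; congr 1; omega
  have hN1 : 1 ≤ N := Nat.one_le_pow _ _ hn
  have hl₁ : ∀ a ∈ List.range' k k ++ List.range' 0 k, a < h := by
    simp only [List.mem_append, List.mem_range'_1]; omega
  have hl₂ : ∀ a ∈ List.range' (2 * k) k ++ List.range' k k, a < h := by
    simp only [List.mem_append, List.mem_range'_1]; omega
  have hl₃ : ∀ a ∈ List.range' (2 * k) k ++ List.range' 0 k, a < h := by
    simp only [List.mem_append, List.mem_range'_1]; omega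
  have hl₄ : ∀ a ∈ List.range' k k, a < h := by
    simp only [List.mem_range'_1]; omega
  have ho : ∀ o₁ o₂ a, o₁ ≤ 2 * k → o₂ ≤ 2 * k → 3 * k ≤ a →
      a ∉ List.range' o₁ k ++ List.range' o₂ k := by
    simp only [List.mem_append, List.mem_range'_1]; omega
  set hm := s.mem 6 with hhm
  set v₀ := s.mem 5 with hv₀
  have htime : ∀ c t, c ≤ cs.length → t ≤ 3 * h + 11 →
      n ^ (2 * k) * (6 * (k + k) + 11 * c + t) ≤ n ^ (2 * k) * sweepTime k h cs.length := by
    intro c t hc ht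
    refine Nat.mul_le_mul_left _ ?_
    rw [sweepTime]; omega
  have ht₁ := htime _ 7 (length_avoiding_le k (2 * k) cs) (by omega)
  have ht₂ := htime _ 7 (length_avoiding_le k 0 cs) (by omega)
  have ht₃ := htime _ 11 (length_avoiding_le k k cs) (by omega)
  have ht₄ : N * (6 * k + 11 * cs.length + (3 * h + 3) + 6) ≤
      n ^ (2 * k) * sweepTime k h cs.length := by
    refine Nat.mul_le_mul (by rw [hNN]; exact Nat.le_mul_of_pos_left _ hN1) ?_
    rw [sweepTime]; omega
  have hreg₀ : ∀ {A : ℕ} {l : List ℕ} {cs' : List (ℕ × ℕ × ℕ)} {s₁ s₂ : State},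
      Frame w (sweep 3 l cs' (.store A 25 24)) s₁ s₂ → ∀ x < 20, s₂.reg x = s₁.reg x :=
    fun hF x hx => hF.reg x fun h' => by
      have := sweep_writesReg h'
      simp [Prog.WritesReg] at this; omega
  have hmem₀ : ∀ {A : ℕ} {l : List ℕ} {cs' : List (ℕ × ℕ × ℕ)} {s₁ s₂ : State},
      Frame w (sweep 3 l cs' (.store A 25 24)) s₁ s₂ → ∀ a, a ≠ 5 → a ≠ A →
        s₂.mem a = s₁.mem a :=
    fun hF a h5 hA => hF.mem a fun h' => by
      have := sweep_writesArr h'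
      simp [Prog.WritesArr] at this; omega
  rw [searchBlocks]
  refine Run.mono (T₁ := n ^ (2 * k) * (6 * (k + k) + 11 * (avoiding k (2 * k) cs).length + 7) + 2 +
    (n ^ (2 * k) * (6 * (k + k) + 11 * (avoiding k 0 cs).length + 7) + 2 + (TP +
    (n ^ (2 * k) * (6 * (k + k) + 11 * (avoiding k k cs).length + 11) + 2 +
      (12 * k + (n ^ (2 * k) * sweepTime k h cs.length) + 10 + 1) + 1) + 1))) ?_ (by omega)
    fun _ => id
  have hfill₁ := run_fill (A := 100) hs hw hn h3 le_rfl hl₁ (hcs.avoiding (k := k) (o := 2 * k))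
  rw [List.length_append, List.length_range', List.length_range'] at hfill₁
  refine .bind hfill₁ ?_
  rintro s₁ ⟨hA, hs₁, hx₁⟩ hF₁
  have hfill₂ := run_fill (A := 101) hs₁ hw hn (by rw [hreg₀ hF₁ 3 (by omega), h3]) (by omega) hl₂
    (hcs.avoiding (k := k) (o := 0))
  rw [List.length_append, List.length_range', List.length_range'] at hfill₂
  refine .bind hfill₂ ?_
  rintro s₂ ⟨hB, hs₂, hx₂⟩ hF₂
  have h4₂ : s₂.reg 4 = N := by rw [hreg₀ hF₂ 4 (by omega), hreg₀ hF₁ 4 (by omega), h4]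
  have h3₂ : s₂.reg 3 = n ^ (2 * k) := by
    rw [hreg₀ hF₂ 3 (by omega), hreg₀ hF₁ 3 (by omega), h3]
  have h6₁ : s₁.mem 6 = hm := hmem₀ hF₁ 6 (by omega) (by omega)
  have h6₂ : s₂.mem 6 = hm := (hmem₀ hF₂ 6 (by omega) (by omega)).trans h6₁
  have hNw : N < 2 ^ w := h4₂ ▸ hs₂.fits.1 4
  have h1w : 1 < 2 ^ w := hs.one ▸ hs.fits.1 1
  have hidx : ∀ i r : Fin N, (i : ℕ) * N + r < n ^ (2 * k) := fun i r => by
    rw [hNN, ← sq]; exact mul_add_lt_sq i.2 r.2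
  refine .add_seq (v := N) (by rw [h4₂, hs₂.zero]; rfl) hNw ?_
  refine .bind (.shift (hP
    (fun i r => decide (Sat hm n (writeDigits n (i * N + r)
      (List.range' k k ++ List.range' 0 k) v₀) (avoiding k (2 * k) cs)))
    -- The second sweep starts from the candidate that the first one left behind, hence `s₁.mem 5`.
    -- It agrees with `v₀` from position `3 * k` on, which is all that the block lemmas need.
    (fun r i => decide (Sat hm n (writeDigits n (r * N + i)
      (List.range' (2 * k) k ++ List.range' k k) (s₁.mem 5)) (avoiding k 0 cs)))
    _ (hs₂.fits.setReg hNw).upper ⟨?_, fun i r => ?_, fun r i => ?_⟩)) ?_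
  · simp [State.upper]
  · simp only [decide_eq_true_eq]
    rw [← hA _ (hidx i r), ← hmem₀ hF₂ 100 (by omega) (by omega)]
    rfl
  · simp only [decide_eq_true_eq]
    rw [← h6₁, ← hB _ (hidx r i)]
    rfl
  intro s₄ hM hF₄
  have hM' : ∀ x < N, ∀ z < N, s₄.mem 102 (x * N + z) ≠ 0 ↔ ∃ y < N,
      Sat hm n (writeDigits n (x * N + y) (List.range' k k ++ List.range' 0 k) v₀)
        (avoiding k (2 * k) cs) ∧
      Sat hm n (writeDigits n (y * N + z) (List.range' (2 * k) k ++ List.range' k k) (s₁.mem 5))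
        (avoiding k 0 cs) := by
    intro x hx z hz
    have := hM ⟨x, hx⟩ ⟨z, hz⟩
    simp only [decide_eq_true_eq] at this
    refine this.trans ⟨fun ⟨y, hy⟩ => ⟨y, y.2, hy⟩, fun ⟨y, hy, hy'⟩ => ⟨⟨y, hy⟩, hy'⟩⟩
  have hreg₄ : ∀ x < 100, s₄.reg x = s₂.reg x := fun x hx => by
    rw [hF₄.reg x fun h' => by have := h'.shift_ge; omega, State.reg_setReg, if_neg (by omega)]
  have hmem₄ : ∀ a < 100, s₄.mem a = s₂.mem a := fun a ha =>
    hF₄.mem a fun h' => by have := h'.shift_ge; omega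
  have hs₄ : Ready w n h (s₄.setReg 26 0) :=
    ⟨(hF₄.fits (hs₂.fits.setReg hNw)).setReg (by positivity), by simp [hreg₄, hs₂.size],
      by simp [hreg₄, hs₂.one], by simp [hreg₄, hs₂.zero],
      by rw [State.mem_setReg, hmem₄ 5 (by omega)]; exact hs₂.cells⟩
  refine .const_seq (by positivity) ?_
  have hscan' := run_scan (L := n ^ (2 * k)) hs₄ hw hn (by simp [hreg₄, h3₂]) (by simp) hl₃
    (hcs.avoiding (k := k) (o := k))
  rw [List.length_append, List.length_range', List.length_range', State.mem_setReg,
    hmem₄ 6 (by omega), h6₂] at hscan'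
  refine .bind hscan' ?_
  rintro s₅ ⟨hscan, hs₅, hx₅⟩ hF₅
  have hreg₅ : ∀ x < 20, s₅.reg x = s₂.reg x := fun x hx => by
    rw [hF₅.reg x fun h' => by
      have := sweep_writesReg h'; simp [scanAct, Prog.WritesReg] at this; omega,
      State.reg_setReg, if_neg (by omega), hreg₄ x (by omega)]
  have hmem₅ : ∀ a < 100, a ≠ 5 → s₅.mem a = s₂.mem a := fun a ha ha5 => by
    rw [hF₅.mem a fun h' => by
      have := sweep_writesArr h'; simp [scanAct, Prog.WritesArr] at this; omega,
      State.mem_setReg, hmem₄ a ha]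
  have hv₁ : ∀ a, 3 * k ≤ a → s₁.mem 5 a = v₀ a := fun a ha =>
    hx₁ a (ho _ _ a (by omega) (by omega) ha)
  have hv₂ : ∀ a, 3 * k ≤ a → s₂.mem 5 a = v₀ a := fun a ha =>
    (hx₂ a (ho _ _ a (by omega) (by omega) ha)).trans (hv₁ a ha)
  have hv₅ : ∀ a, 3 * k ≤ a → s₅.mem 5 a = v₀ a := fun a ha => by
    rw [hx₅ a (ho _ _ a (by omega) (by omega) ha), hmem₄ 5 (by omega), hv₂ a ha]
  have h2₅ : s₅.mem 2 = s.mem 2 := by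
    rw [hmem₅ 2 (by omega) (by omega), hmem₀ hF₂ 2 (by omega) (by omega),
      hmem₀ hF₁ 2 (by omega) (by omega)]
  have h6₅ : s₅.reg 6 = s.reg 6 := by
    rw [hreg₅ 6 (by omega), hreg₀ hF₂ 6 (by omega), hreg₀ hF₁ 6 (by omega)]
  rw [hmem₄ 5 (by omega)] at hscan
  refine .branch (fun hlt => ?_) fun hlt => ?_
  · have h26 : s₅.reg 26 ≠ 0 := by rw [hs₅.zero] at hlt; omega
    obtain ⟨-, hL, hne, hsat⟩ := hscan.resolve_right fun h' => h26 h'.1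
    set m := s₅.reg 28 with hm28
    have hmw : m < 2 ^ w := hs₅.fits.1 28
    refine Run.mono (.add_seq (v := m) (by rw [hs₅.zero, ← hm28]; rfl) hmw (.bind (run_decode
      (n := n) (x := m) (by simp [hs₅.size]) (by simp [hs₅.zero]) (by simp) hmw
      fun a ha => (hl₃ a ha).trans hw.length_lt) fun s₆ h5₆ hF₆ => (run_report (s := s₆) (L := N)
        (.of_frame (s := s₅.setReg 20 m) ⟨hs₅.fits.setReg hmw, by simp [hs₅.size],
          by simp [hs₅.one], by simp [hs₅.zero], hs₅.cells⟩ hF₆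
          (fun x hx h' => by have := decode_writesReg h'; omega) ?_)
        hw hn ?_ hl₄ hcs).mono le_rfl fun s₇ hs₇ => ⟨hs₇.2.1, ?_⟩)) (Q := fun s' => Ready w n h s' ∧
          Outcome hm n h cs (fun v => ∀ a, 3 * k ≤ a → a < h → v a = v₀ a) s s') ?_ fun _ => id
    · rw [h5₆]
      exact writeDigits_lt hn hs₅.cells
    · rw [hF₆.reg 4 fun h' => by have := decode_writesReg h'; omega]
      simp [hreg₅, h4₂]
    · have h6₆ : s₆.mem 6 = hm := by
        rw [hF₆.mem 6 fun h' => by have := decode_writesArr h'; omega, State.mem_setReg,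
          hmem₅ 6 (by omega) (by omega), h6₂]
      have hO := hs₇.1
      rw [h6₆] at hO
      -- After a hit, failing to report is impossible: the nonzero product entry supplies a `y`, and
      -- the three pairwise tests combine to a full solution that the last sweep must have met.
      refine hO.imp id fun hcon => ?_
      exfalso
      have hz : m % N < N := Nat.mod_lt _ hN1
      have hx : m / N < N := Nat.div_lt_of_lt_mul (hNN ▸ hL)
      have hmd : m / N * N + m % N = m := Nat.div_add_mod' m N
      rw [← hmd] at hne hsat
      obtain ⟨y, hy, hy₁, hy₂⟩ := (hM' _ hx _ hz).1 hne
      refine hcon.2.2 (assemble n k (m / N) y (m % N) v₀) ?_ ?_ ⟨y, hy, ?_⟩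
      · rw [← writeDigits_eq_assemble hz hv₅]
        exact writeDigits_lt hn (writeDigits_lt hn hs₅.cells)
      · exact sat_iff_avoiding.2 ⟨(sat_first_second hy fun _ _ => rfl).1 hy₁,
          (sat_second_third hz hv₁).1 hy₂, (sat_first_third hz hv₂).1 hsat⟩
      · have heq := (writeDigits_eq_assemble (x := m / N) (y := y) hz hv₅).symm
        rwa [← hN, hmd, ← State.mem_setReg s₅ 20 m, ← h5₆] at heq
    · simp only [List.length_append, List.length_range']
      omega
  · refine (Run.skip ⟨hs₅, Or.inr ⟨h6₅, h2₅, fun u hu hsat hux => ?_⟩⟩).mono (by omega) fun _ => id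
    have h26 : s₅.reg 26 ≠ 1 := by rw [hs₅.zero] at hlt; omega
    have hnone := (hscan.resolve_left fun h' => h26 h'.1).2
    -- Without a hit there is no solution: its three blocks would make the product entry at `(x, z)`
    -- nonzero and pass the third test.
    obtain ⟨x, hx, y, hy, z, hz, hasm⟩ := exists_assemble hk hu hux
    have hsat' : Sat hm n (assemble n k x y z v₀) cs :=
      (Sat.congr fun c hc => ⟨hasm _ (hcs c hc).1, hasm _ (hcs c hc).2.1⟩).1 hsat
    rw [sat_iff_avoiding (k := k)] at hsat'
    refine hnone (x * N + z) (hidx ⟨x, hx⟩ ⟨z, hz⟩) ((hM' x hx z hz).2 ⟨y, hy, ?_, ?_⟩) ?_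
    · exact (sat_first_second hy fun _ _ => rfl).2 hsat'.1
    · exact (sat_second_third hz hv₁).2 hsat'.2.1
    · exact (sat_first_third hz hv₂).2 hsat'.2.2

/-! ## The loops around the search -/

/-- The outcome of a search: either register `6` contains `1` and array `2` has the property `V`, or
nothing was written and `D` is false. -/
def Reported (V : (ℕ → ℕ) → Prop) (D : Prop) (s s' : State) : Prop :=
  (s'.reg 6 = 1 ∧ V (s'.mem 2)) ∨ (s'.reg 6 = s.reg 6 ∧ s'.mem 2 = s.mem 2 ∧ ¬ D)

section Reported

variable {V : (ℕ → ℕ) → Prop} {D D' : Prop} {s s₁ s₂ s₃ : State}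

theorem Reported.unchanged (h6 : s₁.reg 6 = s.reg 6) (h2 : s₁.mem 2 = s.mem 2) (hD : ¬ D) :
    Reported V D s s₁ := .inr ⟨h6, h2, hD⟩

theorem Reported.imp (h : Reported V D s s₁) (hD : D' → D) : Reported V D' s s₁ :=
  Or.imp_right (fun h => ⟨h.1, h.2.1, fun hd => h.2.2 (hD hd)⟩) h

/-- A later success may replace an earlier answer, and a failure leaves flag and answer alone. So
the searches can all be run one after the other without stopping early. -/
theorem Reported.trans (h : Reported V D s s₁) (h' : Reported V D' s₁ s₂) :
    Reported V (D ∨ D') s s₂ := by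
  rcases h' with h' | ⟨h6', h2', hD'⟩
  · exact .inl h'
  · rcases h with ⟨h6, hV⟩ | ⟨h6, h2, hD⟩
    · exact .inl ⟨h6'.trans h6, h2' ▸ hV⟩
    · exact .inr ⟨h6'.trans h6, h2'.trans h2, not_or.2 ⟨hD, hD'⟩⟩

theorem Reported.congr_left (h : Reported V D s₁ s₂) (h6 : s₁.reg 6 = s.reg 6)
    (h2 : s₁.mem 2 = s.mem 2) : Reported V D s s₂ :=
  Or.imp_right (fun h => ⟨h.1.trans h6, h.2.1.trans h2, h.2.2⟩) h

theorem Reported.congr_right (h : Reported V D s s₁) (h6 : s₂.reg 6 = s₁.reg 6)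
    (h2 : s₂.mem 2 = s₁.mem 2) : Reported V D s s₂ :=
  Or.imp (fun h => ⟨h6.trans h.1, h2 ▸ h.2⟩) (fun h => ⟨h6.trans h.1, h2.trans h.2.1, h.2.2⟩) h

end Reported

/-- What register and array contents the search relies on. -/
structure Loaded (n k j T M R Q : ℕ) (s : State) : Prop where
  reg3 : s.reg 3 = n ^ (2 * k)
  reg4 : s.reg 4 = n ^ k
  reg5 : s.reg 5 = n ^ j
  reg7 : s.reg 7 = R
  reg30 : s.reg 30 = n ^ 2
  reg34 : s.reg 34 = M
  reg35 : s.reg 35 = T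
  reg39 : s.reg 39 = Q

theorem Loaded.congr {n k j T M R Q : ℕ} {s s' : State} (h : Loaded n k j T M R Q s)
    (h' : ∀ x ∈ [3, 4, 5, 7, 30, 34, 35, 39], s'.reg x = s.reg x) : Loaded n k j T M R Q s' :=
  ⟨(h' 3 (by simp)).trans h.reg3, (h' 4 (by simp)).trans h.reg4, (h' 5 (by simp)).trans h.reg5,
    (h' 7 (by simp)).trans h.reg7, (h' 30 (by simp)).trans h.reg30,
    (h' 34 (by simp)).trans h.reg34, (h' 35 (by simp)).trans h.reg35,
    (h' 39 (by simp)).trans h.reg39⟩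

/-- Search for a candidate that meets the constraints `cs`. -/
def searchExt (P : Prog) (k j : ℕ) (cs : List (ℕ × ℕ × ℕ)) : Prog :=
  .const 29 0 ⨾ .loop 29 5 (.arith .add 20 29 2 ⨾ decode (List.range' (3 * k) j) ⨾
    searchBlocks P k (3 * k + j) cs ⨾ .arith .add 29 29 1)

theorem searchExt_writesReg {P : Prog} {k j x : ℕ} {cs : List (ℕ × ℕ × ℕ)}
    (hx : (searchExt P k j cs).WritesReg x) : x = 6 ∨ 20 ≤ x ∧ x < 30 ∨ 100 ≤ x := by
  rcases hx with h | h | h | h | h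
  · simp only [Prog.WritesReg] at h; omega
  · simp only [Prog.WritesReg] at h; omega
  · have := decode_writesReg h; omega
  · have := searchBlocks_writesReg h; omega
  · simp only [Prog.WritesReg] at h; omega

theorem searchExt_writesArr {P : Prog} {k j a : ℕ} {cs : List (ℕ × ℕ × ℕ)}
    (ha : (searchExt P k j cs).WritesArr a) : a = 2 ∨ a = 5 ∨ 100 ≤ a := by
  rcases ha with h | h | h | h | h
  · exact h.elim
  · exact h.elim
  · have := decode_writesArr h; omega
  · exact searchBlocks_writesArr h
  · exact h.elim

/-- A time bound for `searchBlocks` with at most `c` constraints. -/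
def blocksTime (n k h c TP : ℕ) : ℕ := 4 * (n ^ (2 * k) * sweepTime k h c) + TP + 12 * k + 30

/-- The program `P` multiplies matrices of order `N` within `TP` steps. -/
def Multiplies (w N TP : ℕ) (P : Prog) : Prop :=
  ∀ (A B : Matrix (Fin N) (Fin N) Bool) (u : State), u.Fits w →
    HoldsMatrices N A B u → Run w P u TP (HoldsProduct N A B)

/-- Every candidate that meets the constraints may be reported. -/
def Sound (V : (ℕ → ℕ) → Prop) (hm : ℕ → ℕ) (n h : ℕ) (cs : List (ℕ × ℕ × ℕ)) : Prop :=
  ∀ v, (∀ a < h, v a < n) → Sat hm n v cs → ∀ o : ℕ → ℕ, (∀ a < h, o a = v a) → V o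

/-- Some candidate meets the constraints. -/
def Solvable (hm : ℕ → ℕ) (n h : ℕ) (cs : List (ℕ × ℕ × ℕ)) : Prop :=
  ∃ v : ℕ → ℕ, (∀ a < h, v a < n) ∧ Sat hm n v cs

theorem Outcome.reported {V : (ℕ → ℕ) → Prop} {hm : ℕ → ℕ} {n h : ℕ} {cs : List (ℕ × ℕ × ℕ)}
    {X : (ℕ → ℕ) → Prop} {s s' : State} (hV : Sound V hm n h cs)
    (hO : Outcome hm n h cs X s s') :
    Reported V (∃ v, (∀ a < h, v a < n) ∧ Sat hm n v cs ∧ X v) s s' := by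
  refine hO.imp (fun ⟨h6, v, hv, hsat, ho⟩ => ⟨h6, hV v hv hsat _ ho⟩) fun ⟨h6, h2, hno⟩ =>
    ⟨h6, h2, fun ⟨v, hv, hsat, hX⟩ => hno v hv hsat hX⟩

theorem run_searchExt {w n k j TP c : ℕ} {P : Prog} {cs : List (ℕ × ℕ × ℕ)} {s : State}
    {V : (ℕ → ℕ) → Prop} (hs : Ready w n (3 * k + j) s) (hw : Roomy w n (3 * k + j)) (hn : 1 ≤ n)
    (h3 : s.reg 3 = n ^ (2 * k)) (h4 : s.reg 4 = n ^ k) (h5 : s.reg 5 = n ^ j)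
    (hcs : Wellformed w (3 * k + j) cs) (hc : cs.length ≤ c) (hP : Multiplies w (n ^ k) TP P)
    (hV : Sound V (s.mem 6) n (3 * k + j) cs) :
    Run w (searchExt P k j cs) s (n ^ j * (blocksTime n k (3 * k + j) c TP + 6 * j + 4) + 2)
      fun s' => Ready w n (3 * k + j) s' ∧
        Reported V (Solvable (s.mem 6) n (3 * k + j) cs) s s' := by
  have hs' : Ready w n (3 * k + j) (s.setReg 29 0) :=
    ⟨hs.fits.setReg (by positivity), by simp [hs.size], by simp [hs.one], by simp [hs.zero],
      hs.cells⟩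
  have h1w : 1 < 2 ^ w := hs.one ▸ hs.fits.1 1
  have hjw : n ^ j < 2 ^ w := h5 ▸ hs.fits.1 5
  refine .const_seq (by positivity) ((Run.loop (T := 6 * j + 1 + (blocksTime n k (3 * k + j) c TP +
    1) + 1) (fun m s' => s'.reg 29 = m ∧ Ready w n (3 * k + j) s' ∧ Reported V
      (∃ v : ℕ → ℕ, (∀ a < 3 * k + j, v a < n) ∧ Sat (s.mem 6) n v cs ∧ ∃ i < m, ∀ a, 3 * k ≤ a →
        a < 3 * k + j → v a = i / n ^ (a - 3 * k) % n) s s') (n ^ j) ⟨by simp, hs', ?_⟩ ?_ ?_).mono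
        ?_ ?_)
  · exact .unchanged (by simp) rfl (by simp)
  · rintro m s₁ hm ⟨h29, hs₁, hR₁⟩ hF₁
    have hreg₁ : ∀ x < 6, s₁.reg x = s.reg x := fun x hx => by
      rw [hF₁.reg x fun h' => by
        have := searchExt_writesReg (P := P) (k := k) (j := j) (cs := cs) (Or.inr h'); omega,
        State.reg_setReg, if_neg (by omega)]
    have h6₁ : s₁.mem 6 = s.mem 6 := hF₁.mem 6 fun h' => by
      have := searchExt_writesArr (P := P) (k := k) (j := j) (cs := cs) (Or.inr h'); omega
    have hmw : m < 2 ^ w := by omega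
    refine ⟨by rw [h29, hreg₁ 5 (by omega), h5]; exact hm,
      .add_seq (v := m) (by rw [h29, hs₁.zero]; rfl) hmw ?_⟩
    have hdec := run_decode (l := List.range' (3 * k) j) (s := s₁.setReg 20 m) (n := n) (x := m)
      (w := w) (by simp [hs₁.size]) (by simp [hs₁.zero]) (by simp) hmw fun a ha => by
        have := hw.length_lt
        rw [List.mem_range'_1] at ha; omega
    rw [List.length_range'] at hdec
    refine .bind hdec ?_
    intro s₂ hd₂ hF₂
    have hreg₂ : ∀ x, x < 20 ∨ x = 29 → s₂.reg x = s₁.reg x := fun x hx => by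
      rw [hF₂.reg x fun h' => by have := decode_writesReg h'; omega, State.reg_setReg,
        if_neg (by omega)]
    have hmem₂ : ∀ a ≠ 5, s₂.mem a = s₁.mem a := fun a ha =>
      hF₂.mem a fun h' => ha (decode_writesArr h')
    have hs₂ : Ready w n (3 * k + j) s₂ := ⟨hF₂.fits (hs₁.fits.setReg hmw),
      by rw [hreg₂ 0 (by omega), hs₁.size], by rw [hreg₂ 1 (by omega), hs₁.one],
      by rw [hreg₂ 2 (by omega), hs₁.zero], by rw [hd₂]; exact writeDigits_lt hn hs₁.cells⟩
    have h6₂ : s₂.mem 6 = s.mem 6 := (hmem₂ 6 (by omega)).trans h6₁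
    refine .bind ((run_searchBlocks hs₂ hw hn (by omega)
      (by rw [hreg₂ 3 (by omega), hreg₁ 3 (by omega), h3])
      (by rw [hreg₂ 4 (by omega), hreg₁ 4 (by omega), h4]) hcs hP).mono (?_ : _ ≤
        blocksTime n k (3 * k + j) c TP) fun _ => id) ?_
    · rw [blocksTime]
      have : sweepTime k (3 * k + j) cs.length ≤ sweepTime k (3 * k + j) c := by
        rw [sweepTime, sweepTime]; omega
      have := Nat.mul_le_mul_left (n ^ (2 * k)) this
      omega
    rintro s₃ ⟨hs₃, hO₃⟩ hF₃
    rw [h6₂] at hO₃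
    have h29₃ : s₃.reg 29 = m := by
      rw [hF₃.reg 29 fun h' => by have := searchBlocks_writesReg h'; omega, hreg₂ 29 (by omega),
        h29]
    refine .add (v := m + 1) (by rw [h29₃, hs₃.one]) (by omega) ⟨by simp,
      ⟨hs₃.fits.setReg (by omega), by simp [hs₃.size], by simp [hs₃.one], by simp [hs₃.zero],
      hs₃.cells⟩, ?_⟩
    refine (hR₁.trans ((hO₃.reported hV).congr_left (hreg₂ 6 (by omega))
      (hmem₂ 2 (by omega)))).imp ?_ |>.congr_right (by simp) rfl
    rintro ⟨v, hv, hsat, i, hi, hvi⟩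
    rcases Nat.lt_succ_iff_lt_or_eq.1 hi with hi | rfl
    · exact .inl ⟨v, hv, hsat, i, hi, hvi⟩
    · refine .inr ⟨v, hv, hsat, fun a ha ha' => ?_⟩
      rw [hvi a ha ha', hd₂, writeDigits_range', if_pos (by omega)]
  · rintro s₁ ⟨h29, hs₁, hR₁⟩ hF₁
    rw [h29, hF₁.reg 5 fun h' => by
        have := searchExt_writesReg (P := P) (k := k) (j := j) (cs := cs) (Or.inr h'); omega]
    simp [h5]
  · exact le_of_eq (by ring)
  · rintro s₁ ⟨-, hs₁, hR₁⟩
    refine ⟨hs₁, hR₁.imp ?_⟩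
    rintro ⟨v, hv, hsat⟩
    obtain ⟨i, hi, hd⟩ := exists_digits j (fun a => v (3 * k + a)) fun a ha => hv _ (by omega)
    refine ⟨v, hv, hsat, i, hi, fun a ha ha' => ?_⟩
    rw [hd (a - 3 * k) (by omega)]
    congr 1; omega

/-- Search for a candidate that meets one of the lists of constraints. -/
def searchList (P : Prog) (k j : ℕ) : List (List (ℕ × ℕ × ℕ)) → Prog
  | [] => .skip
  | cs :: css => searchExt P k j cs ⨾ searchList P k j css

theorem searchList_writesReg {P : Prog} {k j x : ℕ} : ∀ {css : List (List (ℕ × ℕ × ℕ))},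
    (searchList P k j css).WritesReg x → x = 6 ∨ 20 ≤ x ∧ x < 30 ∨ 100 ≤ x
  | [], h => h.elim
  | _ :: _, h => h.elim searchExt_writesReg searchList_writesReg

theorem searchList_writesArr {P : Prog} {k j a : ℕ} : ∀ {css : List (List (ℕ × ℕ × ℕ))},
    (searchList P k j css).WritesArr a → a = 2 ∨ a = 5 ∨ 100 ≤ a
  | [], h => h.elim
  | _ :: _, h => h.elim searchExt_writesArr searchList_writesArr

/-- A time bound for `searchExt` with at most `c` constraints. -/
def extTime (n k j c TP : ℕ) : ℕ := n ^ j * (blocksTime n k (3 * k + j) c TP + 6 * j + 4) + 2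

theorem run_searchList {w n k j TP c : ℕ} {P : Prog} {hm : ℕ → ℕ} {V : (ℕ → ℕ) → Prop}
    (hw : Roomy w n (3 * k + j)) (hn : 1 ≤ n) (hP : Multiplies w (n ^ k) TP P) :
    ∀ {css : List (List (ℕ × ℕ × ℕ))} {s : State}, Ready w n (3 * k + j) s →
    s.reg 3 = n ^ (2 * k) → s.reg 4 = n ^ k → s.reg 5 = n ^ j → s.mem 6 = hm →
    (∀ cs ∈ css, Wellformed w (3 * k + j) cs ∧ cs.length ≤ c ∧ Sound V hm n (3 * k + j) cs) →
    Run w (searchList P k j css) s (css.length * extTime n k j c TP + 1)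
      fun s' => Ready w n (3 * k + j) s' ∧
        Reported V (∃ cs ∈ css, Solvable hm n (3 * k + j) cs) s s'
  | [], s, hs, _, _, _, _, _ => (Run.skip ⟨hs, .unchanged rfl rfl (by simp)⟩).mono (by simp)
      fun _ => id
  | cs :: css, s, hs, h3, h4, h5, h6, hcss => by
    subst h6
    obtain ⟨hwf, hc, hV⟩ := hcss cs (by simp)
    refine (Run.bind (run_searchExt hs hw hn h3 h4 h5 hwf hc hP hV)
      (T₂ := css.length * extTime n k j c TP + 1) ?_).mono ?_ fun _ => id
    · rintro s₁ ⟨hs₁, hR₁⟩ hF₁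
      have hreg : ∀ x, x < 6 → s₁.reg x = s.reg x := fun x hx =>
        hF₁.reg x fun h' => by have := searchExt_writesReg h'; omega
      refine (run_searchList hw hn hP hs₁ (by rw [hreg 3 (by omega), h3])
        (by rw [hreg 4 (by omega), h4]) (by rw [hreg 5 (by omega), h5])
        (hF₁.mem 6 fun h' => by have := searchExt_writesArr h'; omega)
        fun cs hcs => hcss cs (by simp [hcs])).mono le_rfl fun s₂ ⟨hs₂, hR₂⟩ => ⟨hs₂, ?_⟩
      refine (hR₁.trans hR₂).imp ?_
      simp
    · rw [List.length_cons, ← extTime]; linarith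

/-! ### Evaluating the hash functions and looping over them -/

/-- Replace the content of register `x` by its residue modulo the content of register `m`. -/
def modulo (x m t : ℕ) (q : Prog) : Prog :=
  .arith .div t x m ⨾ .arith .mul t t m ⨾ .arith .sub x x t ⨾ q

theorem Run.modulo {w x m t a b T : ℕ} {q : Prog} {s : State} {Q : State → Prop}
    (hx : s.reg x = a) (hm : s.reg m = b) (hxt : x ≠ t) (hmt : m ≠ t) (ha : a < 2 ^ w)
    (h : Run w q ((s.setReg t (a / b * b)).setReg x (a % b)) T Q) :
    Run w (modulo x m t q) s (T + 3) Q := by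
  refine .div_seq (v := a / b) (by rw [hx, hm]) ((Nat.div_le_self _ _).trans_lt ha)
    (.mul_seq (v := a / b * b) (by simp [hm, hmt]) ((Nat.div_mul_le_self _ _).trans_lt ha)
    (.sub_seq (v := a % b) ?_ ((Nat.mod_le _ _).trans_lt ha) ?_))
  · have := Nat.div_add_mod' a b
    simp [hx, hxt]; omega
  · have heq : (((s.setReg t (a / b)).setReg t (a / b * b)).setReg x (a % b)) =
        (s.setReg t (a / b * b)).setReg x (a % b) := by
      simp [State.setReg]
    rwa [heq]

/-- The entry of the matrix for the search: `0` unless the adjacency matrix has a `1`, and otherwise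
a positive number that depends on the color. -/
def hashEntry (adj col tab W : ℕ → ℕ) (M Q i r e : ℕ) : ℕ :=
  (W (tab (col e) % ((i + 1) * M + 1)) / Q ^ r % Q + 1) * adj e

/-- Compute the matrix for the search. -/
def hashFill : Prog :=
  .const 25 0 ⨾ .loop 25 30 (.load 20 1 25 ⨾ .load 20 3 20 ⨾ modulo 20 54 21 (.load 20 4 20 ⨾
    .arith .div 20 20 56 ⨾ modulo 20 39 21 (.arith .add 20 20 1 ⨾ .load 21 0 25 ⨾
    .arith .mul 20 20 21 ⨾ .store 6 25 20 ⨾ .arith .add 25 25 1)))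

theorem hashFill_writesReg {x : ℕ} (h : hashFill.WritesReg x) : x = 20 ∨ x = 21 ∨ x = 25 := by
  simp [hashFill, modulo, Prog.WritesReg] at h
  omega

theorem hashFill_writesArr {a : ℕ} (h : hashFill.WritesArr a) : a = 6 := by
  simpa [hashFill, modulo, Prog.WritesArr] using h

/-- At non-edges the color cell holds an arbitrary word; multiplication by the adjacency entry turns
whatever is computed from it into `0`. At edges the added `1` keeps the entry positive. -/
theorem run_hashFill {w n M Q i r : ℕ} {s : State} (hs : s.Fits w) (h1 : s.reg 1 = 1)
    (h30 : s.reg 30 = n ^ 2) (h39 : s.reg 39 = Q) (hQ : 1 ≤ Q)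
    (h54 : s.reg 54 = (i + 1) * M + 1) (h56 : s.reg 56 = Q ^ r) (hadj : ∀ e < n ^ 2, s.mem 0 e ≤ 1) :
    Run w hashFill s (n ^ 2 * 17 + 2) fun s' =>
      ∀ e < n ^ 2, s'.mem 6 e = hashEntry (s.mem 0) (s.mem 1) (s.mem 3) (s.mem 4) M Q i r e := by
  have hnw : n ^ 2 < 2 ^ w := h30 ▸ hs.1 30
  have hQw : Q < 2 ^ w := h39 ▸ hs.1 39
  refine .const_seq (by positivity) ((Run.loop (T := 15) (fun m s' => s'.reg 25 = m ∧ ∀ e < m,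
    s'.mem 6 e = hashEntry (s.mem 0) (s.mem 1) (s.mem 3) (s.mem 4) M Q i r e) (n ^ 2)
    ⟨by simp, by simp⟩ ?_ ?_).mono (by omega) fun s' hs' => hs'.2)
  · rintro m s₁ hm ⟨h25, hI⟩ hF
    have hreg : ∀ x, x ≠ 20 → x ≠ 21 → x ≠ 25 → s₁.reg x = s.reg x := fun x h20 h21 h25' => by
      rw [hF.reg x fun h' => by have := hashFill_writesReg (Or.inr h'); omega,
        State.reg_setReg, if_neg h25']
    have hmem : ∀ a ≠ 6, s₁.mem a = s.mem a := fun a ha =>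
      hF.mem a fun h' => ha (hashFill_writesArr (Or.inr h'))
    have hfit : ∀ a i, s.mem a i < 2 ^ w := hs.2
    have hlt : ∀ y, y / Q ^ r % Q + 1 < 2 ^ w := fun y => by
      have := Nat.mod_lt (y / Q ^ r) hQ; omega
    refine ⟨by rw [h25, hreg 30 (by omega) (by omega) (by omega), h30]; exact hm, ?_⟩
    refine .load_seq (v := s.mem 1 m) (by rw [h25, hmem 1 (by omega)]) (.load_seq
      (v := s.mem 3 (s.mem 1 m)) (by simp [hmem]) (.modulo (a := s.mem 3 (s.mem 1 m))
      (b := (i + 1) * M + 1) (by simp) (by simp [hreg, h54]) (by omega) (by omega) (hfit _ _)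
      (.load_seq (v := s.mem 4 (s.mem 3 (s.mem 1 m) % ((i + 1) * M + 1))) (by simp [hmem])
      (.div_seq (v := s.mem 4 (s.mem 3 (s.mem 1 m) % ((i + 1) * M + 1)) / Q ^ r)
        (by simp [hreg, h56]) ((Nat.div_le_self _ _).trans_lt (hfit _ _)) (.modulo
        (a := s.mem 4 (s.mem 3 (s.mem 1 m) % ((i + 1) * M + 1)) / Q ^ r) (b := Q) (by simp)
        (by simp [hreg, h39]) (by omega) (by omega)
        ((Nat.div_le_self _ _).trans_lt (hfit _ _)) (.add_seq
        (v := s.mem 4 (s.mem 3 (s.mem 1 m) % ((i + 1) * M + 1)) / Q ^ r % Q + 1)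
        (by simp [hreg, h1]) (hlt _) (.load_seq (v := s.mem 0 m) (by simp [hmem, h25])
        (.mul_seq (v := hashEntry (s.mem 0) (s.mem 1) (s.mem 3) (s.mem 4) M Q i r m)
          (by simp [hashEntry]) ?_ (.store_seq (i := m) (by simp [h25]) (by simp; rfl)
          (.add (v := m + 1) (by simp [h25, hreg, h1]) (by omega) ⟨by simp, fun e he => ?_⟩))))))))))
    · rw [hashEntry]
      exact (Nat.mul_le_mul_left _ (hadj m hm)).trans_lt (by rw [mul_one]; exact hlt _)
    · simp only [State.mem_setReg, State.mem_setMem, if_true, Function.update_apply]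
      split
      · next h => rw [h]
      · exact hI e (by omega)
  · rintro s₁ ⟨h25, -⟩ hF
    rw [h25, hF.reg 30 fun h' => by have := hashFill_writesReg (Or.inr h'); omega]
    simp [h30]

/-- Array `6` is known only below `n ^ 2`, and candidates with values below `n` read no other cells.
-/
theorem Sat.congr_matrix {hm hm' v : ℕ → ℕ} {w n h : ℕ} {cs : List (ℕ × ℕ × ℕ)}
    (hmm : ∀ e < n ^ 2, hm e = hm' e) (hcs : Wellformed w h cs) (hv : ∀ a < h, v a < n) :
    Sat hm n v cs ↔ Sat hm' n v cs := by
  refine forall₂_congr fun c hc => ?_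
  rw [Meets, Meets, hmm _ (mul_add_lt_sq (hv _ (hcs c hc).1) (hv _ (hcs c hc).2.1))]

theorem Solvable.congr {hm hm' : ℕ → ℕ} {w n h : ℕ} {cs : List (ℕ × ℕ × ℕ)}
    (hmm : ∀ e < n ^ 2, hm e = hm' e) (hcs : Wellformed w h cs) :
    Solvable hm n h cs ↔ Solvable hm' n h cs :=
  exists_congr fun _ => and_congr_right fun hv => Sat.congr_matrix hmm hcs hv

theorem Sound.congr {V : (ℕ → ℕ) → Prop} {hm hm' : ℕ → ℕ} {w n h : ℕ} {cs : List (ℕ × ℕ × ℕ)}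
    (hmm : ∀ e < n ^ 2, hm e = hm' e) (hcs : Wellformed w h cs) :
    Sound V hm n h cs ↔ Sound V hm' n h cs :=
  forall_congr' fun _ => forall_congr' fun hv => by rw [Sat.congr_matrix hmm hcs hv]

/-- Search with the hash functions given by each digit of the code words. -/
def digitLoop (P : Prog) (k j : ℕ) (css : List (List (ℕ × ℕ × ℕ))) : Prog :=
  .loop 55 7 (hashFill ⨾ searchList P k j css ⨾ .arith .mul 56 56 39 ⨾ .arith .add 55 55 1)

theorem digitLoop_writesReg {P : Prog} {k j x : ℕ} {css : List (List (ℕ × ℕ × ℕ))}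
    (hx : (digitLoop P k j css).WritesReg x) :
    x = 6 ∨ 20 ≤ x ∧ x < 30 ∨ x = 55 ∨ x = 56 ∨ 100 ≤ x := by
  rcases hx with h | h | h | h
  · have := hashFill_writesReg h; omega
  · have := searchList_writesReg h; omega
  · simp only [Prog.WritesReg] at h; omega
  · simp only [Prog.WritesReg] at h; omega

theorem digitLoop_writesArr {P : Prog} {k j a : ℕ} {css : List (List (ℕ × ℕ × ℕ))}
    (ha : (digitLoop P k j css).WritesArr a) : a = 2 ∨ a = 5 ∨ a = 6 ∨ 100 ≤ a := by
  rcases ha with h | h | h | h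
  · have := hashFill_writesArr h; omega
  · have := searchList_writesArr h; omega
  · exact h.elim
  · exact h.elim

/-- A time bound for the search with one hash function. -/
def roundTime (n k j c l TP : ℕ) : ℕ := n ^ 2 * 17 + l * extTime n k j c TP + 6

section

variable {w n k j T M R Q TP c : ℕ} {P : Prog} {css : List (List (ℕ × ℕ × ℕ))}
  {V : (ℕ → ℕ) → Prop} {adj col tab W : ℕ → ℕ}

theorem run_digitLoop {i : ℕ} {s : State} (hw : Roomy w n (3 * k + j)) (hn : 1 ≤ n)
    (hP : Multiplies w (n ^ k) TP P) (hs : Ready w n (3 * k + j) s)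
    (hl : Loaded n k j T M R Q s) (hQ : 1 ≤ Q) (hQR : Q ^ R < 2 ^ w)
    (h0 : s.mem 0 = adj) (h1 : s.mem 1 = col) (h3 : s.mem 3 = tab) (h4 : s.mem 4 = W)
    (hadj : ∀ e < n ^ 2, adj e ≤ 1) (h54 : s.reg 54 = (i + 1) * M + 1) (h55 : s.reg 55 = 0)
    (h56 : s.reg 56 = 1)
    (hcss : ∀ cs ∈ css, Wellformed w (3 * k + j) cs ∧ cs.length ≤ c)
    (hV : ∀ r < R, ∀ cs ∈ css, Sound V (hashEntry adj col tab W M Q i r) n (3 * k + j) cs) :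
    Run w (digitLoop P k j css) s (R * roundTime n k j c css.length TP + 1) fun s' =>
      Ready w n (3 * k + j) s' ∧ Reported V (∃ r < R, ∃ cs ∈ css,
        Solvable (hashEntry adj col tab W M Q i r) n (3 * k + j) cs) s s' := by
  refine (Run.loop (T := n ^ 2 * 17 + 2 + (css.length * extTime n k j c TP + 1 + 2))
    (fun m s' => s'.reg 55 = m ∧ s'.reg 56 = Q ^ m ∧ Ready w n (3 * k + j) s' ∧ Reported V
      (∃ r < m, ∃ cs ∈ css, Solvable (hashEntry adj col tab W M Q i r) n (3 * k + j) cs) s s') R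
    ⟨h55, by simpa using h56, hs, .unchanged rfl rfl (by simp)⟩ ?_ ?_).mono ?_
    fun s' hs' => hs'.2.2
  · rintro m s₁ hm ⟨h55₁, h56₁, hs₁, hR₁⟩ hF₁
    have hreg₁ : ∀ x, x < 6 ∨ x = 7 ∨ 30 ≤ x ∧ x < 55 → s₁.reg x = s.reg x := fun x hx =>
      hF₁.reg x fun h' => by
        have := digitLoop_writesReg (P := P) (k := k) (j := j) (css := css) h'; omega
    have hmem₁ : ∀ a < 5, a ≠ 2 → s₁.mem a = s.mem a := fun a ha ha2 => hF₁.mem a fun h' => by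
      have := digitLoop_writesArr (P := P) (k := k) (j := j) (css := css) h'; omega
    have hl₁ : Loaded n k j T M R Q s₁ := hl.congr fun x hx => hreg₁ x (by simp at hx; omega)
    have h0₁ := (hmem₁ 0 (by omega) (by omega)).trans h0
    have h1₁ := (hmem₁ 1 (by omega) (by omega)).trans h1
    have h3₁ := (hmem₁ 3 (by omega) (by omega)).trans h3
    have h4₁ := (hmem₁ 4 (by omega) (by omega)).trans h4
    refine ⟨by rw [h55₁, hl₁.reg7]; exact hm, .bind (run_hashFill (i := i) (M := M) hs₁.fits hs₁.one
      hl₁.reg30 hl₁.reg39 hQ ((hreg₁ 54 (by omega)).trans h54) h56₁ (by rwa [h0₁])) ?_⟩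
    intro s₂ hfill₂ hF₂
    rw [h0₁, h1₁, h3₁, h4₁] at hfill₂
    have hreg₂ : ∀ x, x < 20 ∨ 26 ≤ x → s₂.reg x = s₁.reg x := fun x hx =>
      hF₂.reg x fun h' => by have := hashFill_writesReg h'; omega
    have hmem₂ : ∀ a ≠ 6, s₂.mem a = s₁.mem a := fun a ha =>
      hF₂.mem a fun h' => ha (hashFill_writesArr h')
    have hs₂ : Ready w n (3 * k + j) s₂ := hs₁.of_frame hF₂
      (fun x hx h' => by have := hashFill_writesReg h'; omega)
      (by rw [hmem₂ 5 (by omega)]; exact hs₁.cells)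
    have hl₂ : Loaded n k j T M R Q s₂ := hl₁.congr fun x hx => hreg₂ x (by simp at hx; omega)
    refine .bind (run_searchList hw hn hP hs₂ hl₂.reg3 hl₂.reg4 hl₂.reg5 rfl fun cs hcs =>
      ⟨(hcss cs hcs).1, (hcss cs hcs).2,
        (Sound.congr hfill₂ (hcss cs hcs).1).2 (hV m hm cs hcs)⟩) ?_
    rintro s₃ ⟨hs₃, hR₃⟩ hF₃
    have hreg₃ : ∀ x, x < 6 ∨ x = 7 ∨ 30 ≤ x ∧ x < 100 → s₃.reg x = s₂.reg x := fun x hx =>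
      hF₃.reg x fun h' => by have := searchList_writesReg h'; omega
    have h55₃ : s₃.reg 55 = m := by rw [hreg₃ 55 (by omega), hreg₂ 55 (by omega), h55₁]
    have h56₃ : s₃.reg 56 = Q ^ m := by rw [hreg₃ 56 (by omega), hreg₂ 56 (by omega), h56₁]
    have hRw : R < 2 ^ w := hl.reg7 ▸ hs.fits.1 7
    -- The last round still computes the next power, so `Q ^ R` itself has to fit into a word.
    have hQm : Q ^ (m + 1) < 2 ^ w := (Nat.pow_le_pow_right hQ hm).trans_lt hQR
    refine .mul_seq (v := Q ^ (m + 1))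
      (by rw [h56₃, hreg₃ 39 (by omega), hl₂.reg39, pow_succ]) hQm
      (.add (v := m + 1) (by simp [h55₃, hs₃.one]) (by omega) ⟨by simp, by simp,
        ⟨(hs₃.fits.setReg hQm).setReg (by omega), by simp [hs₃.size], by simp [hs₃.one],
          by simp [hs₃.zero], hs₃.cells⟩, ?_⟩)
    refine (hR₁.trans (hR₃.congr_left (hreg₂ 6 (by omega)) (hmem₂ 2 (by omega)))).imp ?_
      |>.congr_right (by simp) rfl
    rintro ⟨r, hr, cs, hcs, hsol⟩
    rcases Nat.lt_succ_iff_lt_or_eq.1 hr with hr | rfl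
    · exact .inl ⟨r, hr, cs, hcs, hsol⟩
    · exact .inr ⟨cs, hcs, (Solvable.congr hfill₂ (hcss cs hcs).1).2 hsol⟩
  · rintro s₁ ⟨h55₁, -⟩ hF₁
    rw [h55₁, hF₁.reg 7 fun h' => by
      have := digitLoop_writesReg (P := P) (k := k) (j := j) (css := css) h'; omega, hl.reg7]
    omega
  · exact le_of_eq (by rw [roundTime]; ring)

/-- Search with all hash functions. -/
def hashLoop (P : Prog) (k j : ℕ) (css : List (List (ℕ × ℕ × ℕ))) : Prog :=
  .const 53 0 ⨾ .loop 53 35 (.arith .add 54 53 1 ⨾ .arith .mul 54 54 34 ⨾ .arith .add 54 54 1 ⨾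
    .const 55 0 ⨾ .const 56 1 ⨾ digitLoop P k j css ⨾ .arith .add 53 53 1)

theorem hashLoop_writesReg {x : ℕ} (hx : (hashLoop P k j css).WritesReg x) :
    x = 6 ∨ 20 ≤ x ∧ x < 30 ∨ 53 ≤ x ∧ x < 57 ∨ 100 ≤ x := by
  rcases hx with h | h | h | h | h | h | h | h
  on_goal 7 => have := digitLoop_writesReg h; omega
  all_goals simp only [Prog.WritesReg] at h; omega

theorem hashLoop_writesArr {a : ℕ} (ha : (hashLoop P k j css).WritesArr a) :
    a = 2 ∨ a = 5 ∨ a = 6 ∨ 100 ≤ a := by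
  rcases ha with h | h | h | h | h | h | h | h
  on_goal 7 => exact digitLoop_writesArr h
  all_goals exact h.elim

theorem run_hashLoop {s : State} (hw : Roomy w n (3 * k + j)) (hn : 1 ≤ n)
    (hP : Multiplies w (n ^ k) TP P) (hs : Ready w n (3 * k + j) s)
    (hl : Loaded n k j T M R Q s) (hQ : 1 ≤ Q) (hQR : Q ^ R < 2 ^ w) (hTM : T * M + 1 < 2 ^ w)
    (h0 : s.mem 0 = adj) (h1 : s.mem 1 = col) (h3 : s.mem 3 = tab) (h4 : s.mem 4 = W)
    (hadj : ∀ e < n ^ 2, adj e ≤ 1)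
    (hcss : ∀ cs ∈ css, Wellformed w (3 * k + j) cs ∧ cs.length ≤ c)
    (hV : ∀ i < T, ∀ r < R, ∀ cs ∈ css,
      Sound V (hashEntry adj col tab W M Q i r) n (3 * k + j) cs) :
    Run w (hashLoop P k j css) s (T * (R * roundTime n k j c css.length TP + 8) + 2) fun s' =>
      Ready w n (3 * k + j) s' ∧ Reported V (∃ i < T, ∃ r < R, ∃ cs ∈ css,
        Solvable (hashEntry adj col tab W M Q i r) n (3 * k + j) cs) s s' := by
  have hs' : Ready w n (3 * k + j) (s.setReg 53 0) :=
    ⟨hs.fits.setReg (by positivity), by simp [hs.size], by simp [hs.one], by simp [hs.zero],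
      hs.cells⟩
  have h1w : 1 < 2 ^ w := hs.one ▸ hs.fits.1 1
  refine .const_seq (by positivity) ((Run.loop
    (T := R * roundTime n k j c css.length TP + 1 + 1 + 5)
    (fun m s' => s'.reg 53 = m ∧ Ready w n (3 * k + j) s' ∧ Reported V
      (∃ i < m, ∃ r < R, ∃ cs ∈ css,
        Solvable (hashEntry adj col tab W M Q i r) n (3 * k + j) cs) s s') T
    ⟨by simp, hs', .unchanged (by simp) rfl (by simp)⟩ ?_ ?_).mono (by linarith)
    fun s' hs' => hs'.2)
  · rintro m s₁ hm ⟨h53₁, hs₁, hR₁⟩ hF₁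
    have hreg₁ : ∀ x, x < 6 ∨ x = 7 ∨ 30 ≤ x ∧ x < 53 → s₁.reg x = s.reg x := fun x hx => by
      rw [hF₁.reg x fun h' => by
        have := hashLoop_writesReg (P := P) (k := k) (j := j) (css := css) (Or.inr h'); omega,
        State.reg_setReg, if_neg (by omega)]
    have hmem₁ : ∀ a < 5, a ≠ 2 → s₁.mem a = s.mem a := fun a ha ha2 => hF₁.mem a fun h' => by
      have := hashLoop_writesArr (P := P) (k := k) (j := j) (css := css) (Or.inr h'); omega
    have hl₁ : Loaded n k j T M R Q s₁ := hl.congr fun x hx => hreg₁ x (by simp at hx; omega)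
    have hTw : T < 2 ^ w := hl.reg35 ▸ hs.fits.1 35
    have hle : (m + 1) * M + 1 < 2 ^ w :=
      (Nat.add_le_add_right (Nat.mul_le_mul_right M hm) 1).trans_lt hTM
    set s₂ := ((((s₁.setReg 54 (m + 1)).setReg 54 ((m + 1) * M)).setReg 54
      ((m + 1) * M + 1)).setReg 55 0).setReg 56 1 with hs₂def
    refine ⟨by rw [h53₁, hl₁.reg35]; exact hm, ?_⟩
    refine .add_seq (v := m + 1) (by rw [h53₁, hs₁.one]) (by omega) ?_
    refine .mul_seq (v := (m + 1) * M) (by simp [hl₁.reg34]) (Nat.lt_of_succ_lt hle) ?_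
    refine .add_seq (v := (m + 1) * M + 1) (by simp [hs₁.one]) hle ?_
    refine .const_seq (by omega) (.const_seq h1w ?_)
    rw [← hs₂def]
    refine .bind (T₁ := R * roundTime n k j c css.length TP + 1) (T₂ := 1)
      (run_digitLoop (i := m) (T := T) hw hn hP ?_ ?_ hQ hQR
        ((hmem₁ 0 (by omega) (by omega)).trans h0) ((hmem₁ 1 (by omega) (by omega)).trans h1)
        ((hmem₁ 3 (by omega) (by omega)).trans h3) ((hmem₁ 4 (by omega) (by omega)).trans h4)
        hadj (by simp [hs₂def]) (by simp [hs₂def]) (by simp [hs₂def]) hcss (hV m hm)) ?_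
    · exact ⟨((((hs₁.fits.setReg (by omega)).setReg
        (Nat.lt_of_succ_lt hle)).setReg hle).setReg
        (by omega)).setReg h1w, by simp [hs₂def, hs₁.size], by simp [hs₂def, hs₁.one],
        by simp [hs₂def, hs₁.zero], hs₁.cells⟩
    · refine hl₁.congr fun x hx => ?_
      simp only [List.mem_cons, List.not_mem_nil, or_false] at hx
      simp only [hs₂def, State.reg_setReg]
      rw [if_neg (by omega), if_neg (by omega), if_neg (by omega), if_neg (by omega),
        if_neg (by omega)]
    · rintro s₃ ⟨hs₃, hR₃⟩ hF₃
      have h53₃ : s₃.reg 53 = m := by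
        rw [hF₃.reg 53 fun h' => by have := digitLoop_writesReg h'; omega]
        simp [hs₂def, h53₁]
      refine .add (v := m + 1) (by rw [h53₃, hs₃.one]) (by omega) ⟨by simp,
        ⟨hs₃.fits.setReg (by omega), by simp [hs₃.size], by simp [hs₃.one], by simp [hs₃.zero],
          hs₃.cells⟩, ?_⟩
      refine (hR₁.trans (hR₃.congr_left (by simp [hs₂def]) rfl)).imp ?_ |>.congr_right (by simp) rfl
      rintro ⟨i, hi, hex⟩
      rcases Nat.lt_succ_iff_lt_or_eq.1 hi with hi | rfl
      · exact .inl ⟨i, hi, hex⟩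
      · exact .inr hex
  · rintro s₁ ⟨h53₁, -⟩ hF₁
    rw [h53₁, hF₁.reg 35 fun h' => by
      have := hashLoop_writesReg (P := P) (k := k) (j := j) (css := css) (Or.inr h'); omega]
    simp [hl.reg35]

end

/-! ## Preparing the hash functions -/

/-- Write the `c`-th power of the content of register `y` into register `x`. -/
def power (x y : ℕ) : ℕ → Prog
  | 0 => .const x 1
  | c + 1 => power x y c ⨾ .arith .mul x x y

theorem power_writesReg {x y z : ℕ} : ∀ {c : ℕ}, (power x y c).WritesReg z → z = x
  | 0, h => h
  | _ + 1, h => h.elim power_writesReg id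

theorem run_power {w x y v : ℕ} (hxy : y ≠ x) (hv : 1 ≤ v) : ∀ {c : ℕ} {s : State},
    s.reg y = v → v ^ c < 2 ^ w →
    Run w (power x y c) s (c + 1) fun s' => s' = s.setReg x (v ^ c)
  | 0, s, _, h => .const (by simpa using h) (by simp)
  | c + 1, s, hy, h => by
    have hle : v ^ c ≤ v ^ (c + 1) := Nat.pow_le_pow_right hv (by omega)
    refine .bind (run_power hxy hv hy (hle.trans_lt h)) ?_
    rintro s' rfl -
    refine .mul (v := v ^ (c + 1)) (by simp [hxy, hy, pow_succ]) h ?_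
    simp [State.setReg]

/-- For each position of the matrix of colors, write the position into the cell of array `3` whose
number is the color. -/
def tabulate : Prog :=
  .const 25 0 ⨾ .loop 25 30 (.load 20 1 25 ⨾ .store 3 20 25 ⨾ .arith .add 25 25 1)

/-- The array `tab` contains, for each color, a position that has this color. -/
def IsIndex (L : ℕ) (col tab : ℕ → ℕ) : Prop :=
  ∀ e < L, tab (col e) < L ∧ col (tab (col e)) = col e

/-- A repeated color overwrites its cell by a later position of the same color, which serves as
well. Only cells numbered by occurring colors are ever relied on, so the table needs no
initialization. -/
theorem run_tabulate {w L : ℕ} {s : State} (hs : s.Fits w) (h1 : s.reg 1 = 1)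
    (h30 : s.reg 30 = L) : Run w tabulate s (L * 4 + 2) fun s' =>
      IsIndex L (s.mem 1) (s'.mem 3) := by
  have hLw : L < 2 ^ w := h30 ▸ hs.1 30
  refine .const_seq (by positivity) ((Run.loop (T := 3) (fun m s' => s'.reg 25 = m ∧
    IsIndex m (s.mem 1) (s'.mem 3)) L ⟨by simp, by simp [IsIndex]⟩ ?_ ?_).mono (by omega)
    fun s' hs' => hs'.2)
  · rintro m s₁ hm ⟨h25, hI⟩ hF
    have hreg : ∀ x, x ≠ 20 → x ≠ 25 → s₁.reg x = s.reg x := fun x h20 h25' => by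
      rw [hF.reg x (by simp [Prog.WritesReg, h20, h25']), State.reg_setReg, if_neg h25']
    have h1₁ : s₁.mem 1 = s.mem 1 := hF.mem 1 (by simp [Prog.WritesArr])
    refine ⟨by rw [h25, hreg 30 (by omega) (by omega), h30]; exact hm, .load_seq
      (v := s.mem 1 m) (by rw [h25, h1₁]) (.store_seq (i := s.mem 1 m) (v := m) (by simp)
      (by simp [h25]) (.add (v := m + 1) (by simp [h25, hreg, h1]) (by omega)
      ⟨by simp, fun e he => ?_⟩))⟩
    simp only [State.mem_setReg, State.mem_setMem, if_true, Function.update_apply]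
    split
    · next h => exact ⟨by omega, h.symm⟩
    · next h =>
      have hne : e ≠ m := fun h' => h (by rw [h'])
      have := hI e (by omega)
      exact ⟨by omega, this.2⟩
  · rintro s₁ ⟨h25, -⟩ hF
    rw [h25, hF.reg 30 (by simp [Prog.WritesReg])]
    simp [h30]

/-- Find the least positive number whose `c`-th power is at least `n`. -/
def findBase (c : ℕ) : Prog :=
  .const 31 1 ⨾ power 32 31 c ⨾ .loop 32 0 (.arith .add 31 31 1 ⨾ power 32 31 c)

theorem findBase_writesReg {c x : ℕ} (h : (findBase c).WritesReg x) : x = 31 ∨ x = 32 := by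
  rcases h with h | h | h | h
  · exact .inl h
  · exact .inr (power_writesReg h)
  · exact .inl h
  · exact .inr (power_writesReg h)

theorem power_writesArr {x y a : ℕ} : ∀ {c : ℕ}, ¬ (power x y c).WritesArr a
  | 0, h => h
  | _ + 1, h => h.elim power_writesArr id

theorem findBase_writesArr {c a : ℕ} : ¬ (findBase c).WritesArr a := fun h => by
  rcases h with h | h | h | h
  · exact h
  · exact power_writesArr h
  · exact h
  · exact power_writesArr h

/-- The number `b` is a `c`-th root of `n`, up to a constant factor. -/
structure IsRoot (c n b : ℕ) : Prop where
  pos : 1 ≤ b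
  le : n ≤ b ^ c
  ge : b ^ c ≤ 2 ^ c * n

/-- For the least `b` with `n ≤ b ^ c`, minimality gives `(b - 1) ^ c < n`, and `b ≤ 2 * (b - 1)`
costs the factor `2 ^ c`; `b = 1` is separate. As `n ≤ n ^ c`, at most `n` rounds are needed. -/
theorem run_findBase {w c n : ℕ} {s : State} (hs : s.Fits w) (h1 : s.reg 1 = 1)
    (h0 : s.reg 0 = n) (hn : 1 ≤ n) (hc : 1 ≤ c) (hw : 2 ^ c * n < 2 ^ w) :
    Run w (findBase c) s (n * (c + 3) + c + 3) fun s' => IsRoot c n (s'.reg 31) := by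
  have h1w : 1 < 2 ^ w := h1 ▸ hs.1 1
  have hex : ∃ b, 1 ≤ b ∧ n ≤ b ^ c := ⟨n, hn, Nat.le_self_pow (by omega) n⟩
  classical
  obtain ⟨hb1, hbn⟩ := Nat.find_spec hex
  have hmin : ∀ m, 1 ≤ m → m < Nat.find hex → m ^ c < n := fun m hm hlt => by
    have := Nat.find_min hex hlt
    omega
  have hle : Nat.find hex ≤ n := Nat.find_min' hex ⟨hn, Nat.le_self_pow (by omega) n⟩
  have hge : Nat.find hex ^ c ≤ 2 ^ c * n := by
    rcases Nat.eq_or_lt_of_le hb1 with h | h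
    · rw [← h, one_pow]
      exact hn.trans (Nat.le_mul_of_pos_left _ (by positivity))
    · have := hmin (Nat.find hex - 1) (by omega) (by omega)
      calc Nat.find hex ^ c ≤ (2 * (Nat.find hex - 1)) ^ c := Nat.pow_le_pow_left (by omega) _
        _ = 2 ^ c * (Nat.find hex - 1) ^ c := mul_pow ..
        _ ≤ 2 ^ c * n := Nat.mul_le_mul_left _ this.le
  have hbw : ∀ m, m ≤ Nat.find hex → m ^ c < 2 ^ w := fun m hm =>
    ((Nat.pow_le_pow_left hm c).trans hge).trans_lt hw
  have hnw : n < 2 ^ w := h0 ▸ hs.1 0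
  refine Run.mono (.const_seq h1w (.bind (run_power (v := 1) (by omega) le_rfl (by simp)
    (by simpa using h1w)) fun s₁ hs₁ _ => Run.loop (T := c + 2) (fun m s' => s'.reg 31 = m + 1 ∧
      s'.reg 32 = (m + 1) ^ c) (Nat.find hex - 1) ⟨by simp [hs₁], by simp [hs₁]⟩ ?_ ?_)) ?_ ?_
  · rintro m s₂ hm ⟨h31, h32⟩ hF
    have hreg : ∀ x < 31, s₂.reg x = s.reg x := fun x hx => by
      rw [hF.reg x fun h' => by
        have := findBase_writesReg (c := c) (Or.inr (Or.inr h')); omega, hs₁, State.reg_setReg,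
        if_neg (by omega), State.reg_setReg, if_neg (by omega)]
    refine ⟨by rw [h32, hreg 0 (by omega), h0]; exact hmin _ (by omega) (by omega),
      .add_seq (v := m + 1 + 1) (by rw [h31, hreg 1 (by omega), h1]) (by omega)
      ((run_power (v := m + 1 + 1) (by omega) (by omega) (by simp) (hbw _ (by omega))).mono le_rfl
      ?_)⟩
    rintro s₃ rfl
    simp
  · rintro s₂ ⟨h31, h32⟩ hF
    rw [h32, hF.reg 0 fun h' => by
      have := findBase_writesReg (c := c) (Or.inr (Or.inr h')); omega, hs₁]
    rw [Nat.sub_add_cancel hb1]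
    simp [h0, hbn]
  · have : (Nat.find hex - 1) * (c + 2 + 1) ≤ n * (c + 3) := Nat.mul_le_mul_right _ (by omega)
    omega
  · rintro s₂ ⟨h31, -⟩
    rw [h31, Nat.sub_add_cancel hb1]
    exact ⟨hb1, hbn, hge⟩

/-- Find the length of the code words. -/
def findLength (Q : ℕ) : Prog :=
  .const 7 0 ⨾ .const 36 1 ⨾ .const 37 1 ⨾ .const 38 2 ⨾ .const 39 Q ⨾
    .loop 36 33 (.arith .add 7 7 1 ⨾ .arith .mul 36 36 38 ⨾ .arith .mul 37 37 39)

theorem run_findLength {w p Q : ℕ} {s : State} (h1 : s.reg 1 = 1) (h33 : s.reg 33 = p)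
    (hQ : 2 ≤ Q) (hw : Q ^ (Nat.clog 2 p + 1) < 2 ^ w) :
    Run w (findLength Q) s (Nat.clog 2 p * 4 + 6) fun s' =>
      s'.reg 7 = Nat.clog 2 p ∧ s'.reg 37 = Q ^ Nat.clog 2 p ∧ s'.reg 39 = Q := by
  have hQm : ∀ m ≤ Nat.clog 2 p + 1, Q ^ m < 2 ^ w := fun m hm =>
    (Nat.pow_le_pow_right (by omega) hm).trans_lt hw
  have h2m : ∀ m ≤ Nat.clog 2 p + 1, 2 ^ m < 2 ^ w := fun m hm =>
    (Nat.pow_le_pow_left hQ m).trans_lt (hQm m hm)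
  have h0w : 0 < 2 ^ w := by positivity
  have h1w : 1 < 2 ^ w := by simpa using hQm 0 (by omega)
  -- The extra `1` in the exponent of the word bound makes `Q` fit even for length `0`.
  have hQw : Q < 2 ^ w := by simpa using hQm 1 (by omega)
  refine .const_seq h0w (.const_seq h1w (.const_seq h1w (.const_seq (by omega) (.const_seq hQw
    ((Run.loop (T := 3) (fun m s' => s'.reg 7 = m ∧ s'.reg 36 = 2 ^ m ∧ s'.reg 37 = Q ^ m ∧
      s'.reg 39 = Q) (Nat.clog 2 p) ?_ ?_ ?_).mono (by omega) fun s' hs' =>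
      ⟨hs'.1, hs'.2.2.1, hs'.2.2.2⟩)))))
  · simp
  · rintro m s₁ hm ⟨h7, h36, h37, h39⟩ hF
    have hreg : ∀ x, x ≠ 7 → x ≠ 36 → x ≠ 37 → x ≠ 39 → x ≠ 38 → s₁.reg x = s.reg x :=
      fun x a b c d e => by
        rw [hF.reg x (by simp [Prog.WritesReg, a, b, c])]
        simp [a, b, c, d, e]
    have h38 : s₁.reg 38 = 2 := by rw [hF.reg 38 (by simp [Prog.WritesReg])]; simp
    have hmw : m + 1 < 2 ^ w := (Nat.lt_two_pow_self).trans (h2m (m + 1) (by omega))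
    refine ⟨?_, .add_seq (v := m + 1) (by simp [h7, hreg, h1]) hmw (.mul_seq (v := 2 ^ (m + 1))
      (by simp [h36, h38, pow_succ]) (h2m _ (by omega)) (.mul (v := Q ^ (m + 1))
      (by simp [h37, h39, pow_succ]) (hQm _ (by omega)) (by simp [h39])))⟩
    rw [h36, hreg 33 (by omega) (by omega) (by omega) (by omega) (by omega), h33]
    by_contra hcon
    have := (Nat.clog_le_iff_le_pow (b := 2) (by omega) (x := p) (y := m)).2 (by omega)
    omega
  · rintro s₁ ⟨-, h36, -, -⟩ hF
    rw [h36, hF.reg 33 (by simp [Prog.WritesReg])]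
    simpa [h33] using Nat.le_pow_clog (b := 2) (by omega) p

/-! ### The greedy code -/

/-- Count the common digits of the contents of registers `45` and `46`. -/
def countAgreement : Prog :=
  .const 47 0 ⨾ .const 48 0 ⨾ .loop 47 7 (.arith .add 49 45 2 ⨾ modulo 49 39 50 (
    .arith .add 51 46 2 ⨾ modulo 51 39 50 (
      .branch 49 51 .skip (.branch 51 49 .skip (.arith .add 48 48 1)) ⨾
      .arith .div 45 45 39 ⨾ .arith .div 46 46 39 ⨾ .arith .add 47 47 1)))

theorem countAgreement_writesReg {x : ℕ} (h : countAgreement.WritesReg x) : 45 ≤ x ∧ x < 52 := by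
  simp [countAgreement, modulo, Prog.WritesReg] at h
  omega

theorem countAgreement_writesArr {a : ℕ} : ¬ countAgreement.WritesArr a := by
  simp [countAgreement, modulo, Prog.WritesArr]

theorem run_countAgreement {w R Q u v : ℕ} {s : State} (hs : s.Fits w) (h1 : s.reg 1 = 1)
    (h2 : s.reg 2 = 0) (h7 : s.reg 7 = R) (h39 : s.reg 39 = Q) (h45 : s.reg 45 = u)
    (h46 : s.reg 46 = v) :
    Run w countAgreement s (R * 16 + 3) fun s' => s'.reg 48 = agreement Q R u v := by
  have hu : u < 2 ^ w := h45 ▸ hs.1 45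
  have hv : v < 2 ^ w := h46 ▸ hs.1 46
  have hR : R < 2 ^ w := h7 ▸ hs.1 7
  have hud : ∀ x, u / x < 2 ^ w := fun x => (Nat.div_le_self _ _).trans_lt hu
  have hvd : ∀ x, v / x < 2 ^ w := fun x => (Nat.div_le_self _ _).trans_lt hv
  refine .const_seq (by positivity) (.const_seq (by positivity) ((Run.loop (T := 15)
    (fun m s' => s'.reg 47 = m ∧ s'.reg 48 = agreement Q m u v ∧ s'.reg 45 = u / Q ^ m ∧
      s'.reg 46 = v / Q ^ m) R ?_ ?_ ?_).mono (by omega) fun s' hs' => hs'.2.1))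
  · simp [h45, h46, agreement]
  · rintro m s₁ hm ⟨h47, h48, h45₁, h46₁⟩ hF
    have hreg : ∀ x < 45, s₁.reg x = s.reg x := fun x hx => by
      rw [hF.reg x fun h' => by
        have := countAgreement_writesReg (Or.inr (Or.inr h')); omega]
      simp only [State.reg_setReg]
      rw [if_neg (by omega), if_neg (by omega)]
    have ha := agreement_succ Q m u v
    have hale := agreement_le Q m u v
    refine ⟨by rw [h47, hreg 7 (by omega), h7]; exact hm, .add_seq (v := u / Q ^ m)
      (by simp [h45₁, hreg, h2]) (hud _) (.modulo (a := u / Q ^ m) (b := Q) (by simp)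
      (by simp [hreg, h39]) (by omega) (by omega) (hud _) (.add_seq (v := v / Q ^ m)
      (by simp [h46₁, hreg, h2]) (hvd _) (.modulo (a := v / Q ^ m) (b := Q) (by simp)
      (by simp [hreg, h39]) (by omega) (by omega) (hvd _) ?_)))⟩
    have hlast : ∀ s₂ : State, s₂.reg 1 = 1 → s₂.reg 39 = Q → s₂.reg 47 = m →
        s₂.reg 45 = u / Q ^ m → s₂.reg 46 = v / Q ^ m → s₂.reg 48 = agreement Q (m + 1) u v →
        Run w (.arith .div 45 45 39 ⨾ .arith .div 46 46 39 ⨾ .arith .add 47 47 1) s₂ 3 fun s' =>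
          s'.reg 47 = m + 1 ∧ s'.reg 48 = agreement Q (m + 1) u v ∧ s'.reg 45 = u / Q ^ (m + 1) ∧
          s'.reg 46 = v / Q ^ (m + 1) := by
      intro s₂ a b c d e f
      refine .div_seq (v := u / Q ^ (m + 1)) (by rw [d, b, Nat.div_div_eq_div_mul, pow_succ])
        (hud _) (.div_seq (v := v / Q ^ (m + 1)) (by simp [e, b, Nat.div_div_eq_div_mul, pow_succ])
        (hvd _) (.add (v := m + 1) (by simp [c, a]) (by omega) (by simp [f])))
    refine Run.mono (T₁ := 3 + 3) (.seq (.branch (T := 2) (fun hlt => (Run.skip ?_).mono (by omega)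
      fun _ => id) fun hlt => .branch (fun hlt' => .skip ?_) fun hlt' =>
        .add (v := agreement Q m u v + 1) ?_ ?_ ?_)) (by omega) fun _ => id
    · simp only [State.reg_setReg, Nat.reduceEqDiff, if_true, if_false] at hlt
      rw [if_neg (by omega)] at ha
      exact hlast _ (by simp [hreg, h1]) (by simp [hreg, h39]) (by simp [h47]) (by simp [h45₁])
        (by simp [h46₁]) (by simp [h48, ha])
    · simp only [State.reg_setReg, Nat.reduceEqDiff, if_true, if_false] at hlt hlt'
      rw [if_neg (by omega)] at ha
      exact hlast _ (by simp [hreg, h1]) (by simp [hreg, h39]) (by simp [h47]) (by simp [h45₁])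
        (by simp [h46₁]) (by simp [h48, ha])
    · simp [h48, hreg, h1]
    · omega
    · simp only [State.reg_setReg, Nat.reduceEqDiff, if_true, if_false] at hlt hlt'
      rw [if_pos (by omega)] at ha
      exact hlast _ (by simp [hreg, h1]) (by simp [hreg, h39]) (by simp [h47]) (by simp [h45₁])
        (by simp [h46₁]) (by simp [ha])
  · rintro s₁ ⟨h47, -⟩ hF
    rw [h47, hF.reg 7 fun h' => by
        have := countAgreement_writesReg (Or.inr (Or.inr h')); omega]
    simp [h7]

/-- Test whether the content of register `42` is covered by the code words found so far. -/
def testCovered : Prog :=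
  .const 43 0 ⨾ .const 44 0 ⨾ .loop 44 41 (.load 45 4 44 ⨾ .arith .add 46 42 2 ⨾
    countAgreement ⨾ .arith .mul 48 48 40 ⨾ .branch 48 7 .skip (.const 43 1) ⨾
    .arith .add 44 44 1)

theorem testCovered_writesReg {x : ℕ} (h : testCovered.WritesReg x) : 43 ≤ x ∧ x < 52 := by
  rcases h with h | h | h | h | h | h | (h | h) | h
  on_goal 5 => have := countAgreement_writesReg h; omega
  all_goals simp only [Prog.WritesReg] at h
  all_goals omega

theorem testCovered_writesArr {a : ℕ} : ¬ testCovered.WritesArr a := fun h => by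
  rcases h with h | h | h | h | h | h | (h | h) | h
  on_goal 5 => exact countAgreement_writesArr h
  all_goals exact h

open Classical in
theorem run_testCovered {w R Q q cnt v : ℕ} {s : State} (hs : s.Fits w) (h1 : s.reg 1 = 1)
    (h2 : s.reg 2 = 0) (h7 : s.reg 7 = R) (h39 : s.reg 39 = Q) (h40 : s.reg 40 = q)
    (h41 : s.reg 41 = cnt) (h42 : s.reg 42 = v) (hqR : q * R < 2 ^ w) :
    Run w testCovered s (cnt * (R * 16 + 10) + 3) fun s' => s'.reg 43 =
      if ∃ i < cnt, R ≤ q * agreement Q R (s.mem 4 i) v then 1 else 0 := by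
  have hvw : v < 2 ^ w := h42 ▸ hs.1 42
  have hcw : cnt < 2 ^ w := h41 ▸ hs.1 41
  have h1w : 1 < 2 ^ w := h1 ▸ hs.1 1
  refine .const_seq (by positivity) (.const_seq (by positivity) ((Run.loop (T := R * 16 + 9)
    (fun m s' => s'.reg 44 = m ∧ s'.reg 43 =
      if ∃ i < m, R ≤ q * agreement Q R (s.mem 4 i) v then 1 else 0) cnt (by simp) ?_ ?_).mono
      (by linarith) fun s' hs' => hs'.2))
  · rintro m s₁ hm ⟨h44, h43⟩ hF
    have hreg : ∀ x < 43, s₁.reg x = s.reg x := fun x hx => by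
      rw [hF.reg x fun h' => by
        have := testCovered_writesReg (Or.inr (Or.inr h')); omega]
      simp only [State.reg_setReg]
      rw [if_neg (by omega), if_neg (by omega)]
    have hf₁ : s₁.Fits w := hF.fits ((hs.setReg (by positivity)).setReg (by positivity))
    have h4₁ : s₁.mem 4 = s.mem 4 :=
      hF.mem 4 fun h' => testCovered_writesArr (Or.inr (Or.inr h'))
    refine ⟨by rw [h44, hreg 41 (by omega), h41]; exact hm, ?_⟩
    refine Run.mono (.load_seq (v := s.mem 4 m) (by rw [h4₁, h44]) (.add_seq (v := v)
      (by simp [hreg, h42, h2]) hvw (.bind (run_countAgreement (R := R) (Q := Q) (u := s.mem 4 m)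
        (v := v) ((hf₁.setReg (hs.2 _ _)).setReg hvw) (by simp [hreg, h1]) (by simp [hreg, h2])
        (by simp [hreg, h7]) (by simp [hreg, h39]) (by simp) (by simp)) fun s₂ h48 hF₂ => .mul_seq
        (v := q * agreement Q R (s.mem 4 m) v) ?_ ?_ (.seq (T₁ := 2) (T₂ := 1) (.branch
        (fun hlt => .skip (.add (v := m + 1) ?_ (by omega) ⟨by simp, ?_⟩))
        fun hlt => .const h1w (.add (v := m + 1) ?_ (by omega) ⟨by simp, ?_⟩))))))
      (by omega) fun _ => id
    all_goals
      have hreg₂ : ∀ x < 45, s₂.reg x = s₁.reg x := fun x hx => by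
        rw [hF₂.reg x fun h' => by have := countAgreement_writesReg h'; omega]
        simp only [State.reg_setReg]
        rw [if_neg (by omega), if_neg (by omega)]
    · rw [h48, hreg₂ 40 (by omega), hreg 40 (by omega), h40, mul_comm]
    · exact (Nat.mul_le_mul_left _ (agreement_le ..)).trans_lt hqR
    · simp [hreg₂, h44, hreg, h1]
    · simp [hreg₂, h44, hreg, h1]
    · simp only [State.reg_setReg, Nat.reduceEqDiff, if_true, if_false, hreg₂ 7 (by omega),
        hreg 7 (by omega), h7] at hlt
      simp only [State.reg_setReg, Nat.reduceEqDiff, if_false, hreg₂ 43 (by omega), h43]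
      congr 1
      refine propext ⟨fun ⟨i, hi, h⟩ => ⟨i, by omega, h⟩, fun ⟨i, hi, h⟩ => ?_⟩
      rcases Nat.lt_succ_iff_lt_or_eq.1 hi with hi | rfl
      · exact ⟨i, hi, h⟩
      · omega
    · simp only [State.reg_setReg, Nat.reduceEqDiff, if_true, if_false, hreg₂ 7 (by omega),
        hreg 7 (by omega), h7] at hlt
      rw [if_pos ⟨m, by omega, by omega⟩]
      simp
  · rintro s₁ ⟨h44, -⟩ hF
    rw [h44, hF.reg 41 fun h' => by
      have := testCovered_writesReg (Or.inr (Or.inr h')); omega]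
    simp [h41]

/-- Build a maximal code in array `4`. -/
def greedy : Prog :=
  .const 41 0 ⨾ .const 42 0 ⨾ .loop 42 37 (testCovered ⨾
    .branch 43 1 (.store 4 41 42 ⨾ .arith .add 41 41 1) .skip ⨾ .arith .add 42 42 1)

theorem greedy_writesReg {x : ℕ} (h : greedy.WritesReg x) : 41 ≤ x ∧ x < 52 := by
  rcases h with h | h | h | ((h | h) | h) | h
  on_goal 3 => have := testCovered_writesReg h; omega
  all_goals simp only [Prog.WritesReg] at h
  all_goals omega

theorem greedy_writesArr {a : ℕ} (h : greedy.WritesArr a) : a = 4 := by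
  rcases h with h | h | h | ((h | h) | h) | h
  on_goal 3 => exact (testCovered_writesArr h).elim
  on_goal 3 => exact h
  all_goals exact h.elim

/-- A word is added exactly if no earlier code word covers it. Being uncovered keeps the code
separated, and a new word covers itself because it agrees with itself in all `R` places and `q ≥ 1`.
At most `B` words are stored, so a test takes at most `B` comparisons. -/
theorem run_greedy {w R q B : ℕ} {s : State} (hs : s.Fits w) (h1 : s.reg 1 = 1)
    (h2 : s.reg 2 = 0) (h7 : s.reg 7 = R) (h39 : s.reg 39 = 4 ^ q) (h40 : s.reg 40 = q)
    (h37 : s.reg 37 = B) (hB : B = (4 ^ q) ^ R) (hq : 1 ≤ q) (hqR : q * R < 2 ^ w) :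
    Run w greedy s (B * (B * (R * 16 + 10) + 8) + 3) fun s' =>
      ∃ cnt, IsCode q R cnt (s'.mem 4) := by
  classical
  have hBw : B < 2 ^ w := h37 ▸ hs.1 37
  refine .const_seq (by positivity) (.const_seq (by positivity) ((Run.loop
    (T := B * (R * 16 + 10) + 3 + 4) (fun m s' => s'.reg 42 = m ∧ s'.reg 41 ≤ m ∧
      (∀ i < s'.reg 41, ∀ i' < s'.reg 41, i ≠ i' →
        q * agreement (4 ^ q) R (s'.mem 4 i) (s'.mem 4 i') < R) ∧
      ∀ v < m, ∃ i < s'.reg 41, R ≤ q * agreement (4 ^ q) R (s'.mem 4 i) v) B (by simp) ?_ ?_).mono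
      (by linarith) fun s' hs' => ⟨s'.reg 41, hs'.2.2.1, hB ▸ hs'.2.2.2⟩))
  · rintro m s₁ hm ⟨h42, h41, hsep, hcov⟩ hF
    have hreg : ∀ x < 41, s₁.reg x = s.reg x := fun x hx => by
      rw [hF.reg x fun h' => by have := greedy_writesReg (Or.inr (Or.inr h')); omega]
      simp only [State.reg_setReg]
      rw [if_neg (by omega), if_neg (by omega)]
    have hf₁ : s₁.Fits w := hF.fits ((hs.setReg (by positivity)).setReg (by positivity))
    refine ⟨by rw [h42, hreg 37 (by omega), h37]; exact hm, ?_⟩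
    have hcntB : s₁.reg 41 * (R * 16 + 10) ≤ B * (R * 16 + 10) :=
      Nat.mul_le_mul_right _ (by omega)
    have hrun := run_testCovered (Q := 4 ^ q) hf₁ (by rw [hreg 1 (by omega), h1])
      (by rw [hreg 2 (by omega), h2]) (by rw [hreg 7 (by omega), h7])
      (by rw [hreg 39 (by omega), h39]) (by rw [hreg 40 (by omega), h40]) rfl h42 hqR
    refine .bind (T₂ := 4) (hrun.mono (T₂ := B * (R * 16 + 10) + 3) (by omega) fun _ => id)
      fun s₂ h43 hF₂ => ?_
    have hreg₂ : ∀ x < 43, s₂.reg x = s₁.reg x := fun x hx =>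
      hF₂.reg x fun h' => by have := testCovered_writesReg h'; omega
    have h4₂ : s₂.mem 4 = s₁.mem 4 := hF₂.mem 4 testCovered_writesArr
    have h1₂ : s₂.reg 1 = 1 := by rw [hreg₂ 1 (by omega), hreg 1 (by omega), h1]
    have h42₂ : s₂.reg 42 = m := by rw [hreg₂ 42 (by omega), h42]
    have h41₂ : s₂.reg 41 = s₁.reg 41 := hreg₂ 41 (by omega)
    refine Run.mono (T₁ := 3 + 1) (.seq (.branch (T := 2) (fun hlt => .store_seq (i := s₁.reg 41)
      (v := m) h41₂ h42₂ (.add (v := s₁.reg 41 + 1) (by simp [h41₂, h1₂]) (by omega)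
      (.add (v := m + 1) (by simp [h42₂, h1₂]) (by omega) ?_))) fun hlt =>
      (Run.skip (.add (v := m + 1) (by simp [h42₂, h1₂]) (by omega) ?_)).mono (by omega)
      fun _ => id)) (by omega) fun _ => id
    · rw [h43, h1₂] at hlt
      have hno : ∀ i < s₁.reg 41, q * agreement (4 ^ q) R (s₁.mem 4 i) m < R := by
        by_contra! hcon
        rw [if_pos hcon] at hlt; omega
      have hself : R ≤ q * agreement (4 ^ q) R m m := by
        rw [agreement_self]; exact Nat.le_mul_of_pos_left _ hq
      simp only [State.reg_setReg, State.mem_setReg, State.mem_setMem, Nat.reduceEqDiff, if_true,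
        if_false, h4₂]
      refine ⟨trivial, by omega, fun i hi i' hi' hne => ?_, fun v hv => ?_⟩
      · rcases Nat.lt_succ_iff_lt_or_eq.1 hi with hi | rfl
        · rcases Nat.lt_succ_iff_lt_or_eq.1 hi' with hi' | rfl
          · rw [Function.update_of_ne (by omega), Function.update_of_ne (by omega)]
            exact hsep i hi i' hi' hne
          · rw [Function.update_of_ne hne, Function.update_self]
            exact hno i hi
        · rw [Function.update_self, Function.update_of_ne hne.symm, agreement_comm]
          exact hno i' (by omega)
      · rcases Nat.lt_succ_iff_lt_or_eq.1 hv with hv | rfl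
        · obtain ⟨i, hi, hle⟩ := hcov v hv
          exact ⟨i, by omega, by rwa [Function.update_of_ne (by omega)]⟩
        · exact ⟨s₁.reg 41, by omega, by rwa [Function.update_self]⟩
    · rw [h43, h1₂] at hlt
      have hyes : ∃ i < s₁.reg 41, R ≤ q * agreement (4 ^ q) R (s₁.mem 4 i) m := by
        by_contra hcon
        rw [if_neg hcon] at hlt; omega
      simp only [State.reg_setReg, State.mem_setReg, Nat.reduceEqDiff, if_true, if_false, h4₂,
        h41₂]
      refine ⟨trivial, by omega, hsep, fun v hv => ?_⟩
      rcases Nat.lt_succ_iff_lt_or_eq.1 hv with hv | rfl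
      · exact hcov v hv
      · exact hyes
  · rintro s₁ ⟨h42, -⟩ hF
    rw [h42, hF.reg 37 fun h' => by have := greedy_writesReg (Or.inr (Or.inr h')); omega]
    simp [h37]

open Nat in
/-- Prepare the search for candidates with `h` entries. -/
def prepare (k j h σ c T : ℕ) : Prog :=
  .const 6 0 ⨾ power 30 0 2 ⨾ power 3 0 (2 * k) ⨾ power 4 0 k ⨾ power 5 0 j ⨾ .const 20 0 ⨾
  decode (List.range' 0 h) ⨾ tabulate ⨾ findBase c ⨾ .const 34 (T !) ⨾ .arith .mul 34 34 31 ⨾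
  .const 35 T ⨾ .arith .mul 33 35 34 ⨾ .arith .add 33 33 1 ⨾ findLength (4 ^ σ) ⨾ .const 40 σ ⨾
  greedy

/-- The length of the code words. -/
def codeLength (T b : ℕ) : ℕ := Nat.clog 2 (T * (T.factorial * b) + 1)

theorem le_two_pow_codeLength (T b : ℕ) : T * (T.factorial * b) + 1 ≤ 2 ^ codeLength T b :=
  Nat.le_pow_clog (by omega) _

/-- What the preparation achieves. -/
structure Prepared (w n k j h σ c T b : ℕ) (s s' : State) : Prop where
  root : IsRoot c n b
  ready : Ready w n h s'
  loaded : Loaded n k j T (T.factorial * b) (codeLength T b) (4 ^ σ) s'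
  index : IsIndex (n ^ 2) (s.mem 1) (s'.mem 3)
  code : ∃ cnt, IsCode σ (codeLength T b) cnt (s'.mem 4)
  reg6 : s'.reg 6 = 0
  mem0 : s'.mem 0 = s.mem 0
  mem1 : s'.mem 1 = s.mem 1

/-- A time bound for the construction of the code. -/
def codeTime (B R : ℕ) : ℕ := B * (B * (R * 16 + 10) + 8) + 3

/-- A time bound for `prepare`. -/
def prepareTime (n k j h c G : ℕ) : ℕ :=
  n ^ 2 * 4 + n * (c + 3) + G + (3 * k + j + 6 * h + c + 30)

/-- The base `b` is computed at run time, so the bounds on words and time are required for every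
number that could be the root. -/
theorem run_prepare {w n k j h σ c T G : ℕ} {s : State} (hs : s.Fits w) (h0 : s.reg 0 = n)
    (h1 : s.reg 1 = 1) (h2 : s.reg 2 = 0) (hn : 1 ≤ n) (hw : Roomy w n h) (hσ : 1 ≤ σ)
    (hc : 1 ≤ c) (hT : 1 ≤ T) (hkw : n ^ (2 * k) < 2 ^ w) (hjw : n ^ j < 2 ^ w)
    (hcw : 2 ^ c * n < 2 ^ w)
    (hbw : ∀ b, IsRoot c n b → (4 ^ σ) ^ (codeLength T b + 1) < 2 ^ w)
    (hG : ∀ b, IsRoot c n b →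
      codeTime ((4 ^ σ) ^ codeLength T b) (codeLength T b) + codeLength T b * 4 ≤ G) :
    Run w (prepare k j h σ c T) s (prepareTime n k j h c G) fun s' =>
      ∃ b, Prepared w n k j h σ c T b s s' := by
  have h1w : 1 < 2 ^ w := h1 ▸ hs.1 1
  have hkw' : n ^ k < 2 ^ w := (Nat.pow_le_pow_right hn (by omega)).trans_lt hkw
  refine Run.mono (.const_seq (by positivity) (.bind (run_power (v := n) (by omega) hn
    (by simp [h0]) hw.sq_lt) fun s₁ hs₁ _ => .bind (run_power (v := n) (by omega) hn
    (by simp [hs₁, h0]) hkw) fun s₂ hs₂ _ => .bind (run_power (v := n) (by omega) hn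
    (by simp [hs₂, hs₁, h0]) hkw') fun s₃ hs₃ _ => .bind (run_power (v := n) (by omega) hn
    (by simp [hs₃, hs₂, hs₁, h0]) hjw) fun s₄ hs₄ _ => .const_seq (by positivity)
    (.bind (T₁ := 6 * h + 1) (T₂ := (n ^ 2 * 4 + 2) + ((n * (c + 3) + c + 3) + (G + 13)))
      (Q := fun s' => s'.mem 5 = writeDigits n 0 (List.range' 0 h) (s₄.mem 5)) ?_ ?_)))
      (T₁ := _ + _ + 1) ?_ fun _ => id
  -- Decoding `0` initializes the candidate; before that its cells need not be below `n`.
  · refine (run_decode (s := s₄.setReg 20 0) (n := n) (x := 0) ?_ ?_ (by simp) (by positivity)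
      fun a ha => ?_).mono (by rw [List.length_range']) fun _ => id
    · simp [hs₄, hs₃, hs₂, hs₁, h0]
    · simp [hs₄, hs₃, hs₂, hs₁, h2]
    · rw [List.mem_range'_1] at ha
      exact lt_trans (by omega) hw.length_lt
  · intro s₅ hd₅ hF₅
    have hreg₅ : ∀ x, x < 20 ∨ 24 ≤ x → s₅.reg x = s₄.reg x := fun x hx => by
      rw [hF₅.reg x fun h' => by have := decode_writesReg h'; omega, State.reg_setReg,
        if_neg (by omega)]
    have hmem₄ : s₄.mem = s.mem := by simp [hs₄, hs₃, hs₂, hs₁]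
    have hmem₅ : ∀ a ≠ 5, s₅.mem a = s.mem a := fun a ha => by
      rw [hF₅.mem a fun h' => ha (decode_writesArr h'), State.mem_setReg, hmem₄]
    have hf₅ : s₅.Fits w := by
      refine hF₅.fits (State.Fits.setReg ?_ (by positivity))
      rw [hs₄, hs₃, hs₂, hs₁]
      exact ((((hs.setReg (by positivity)).setReg hw.sq_lt).setReg hkw).setReg hkw').setReg hjw
    have h0₅ : s₅.reg 0 = n := by rw [hreg₅ 0 (by omega)]; simp [hs₄, hs₃, hs₂, hs₁, h0]
    have h1₅ : s₅.reg 1 = 1 := by rw [hreg₅ 1 (by omega)]; simp [hs₄, hs₃, hs₂, hs₁, h1]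
    have h2₅ : s₅.reg 2 = 0 := by rw [hreg₅ 2 (by omega)]; simp [hs₄, hs₃, hs₂, hs₁, h2]
    have h3₅ : s₅.reg 3 = n ^ (2 * k) := by rw [hreg₅ 3 (by omega)]; simp [hs₄, hs₃, hs₂]
    have h4₅ : s₅.reg 4 = n ^ k := by rw [hreg₅ 4 (by omega)]; simp [hs₄, hs₃]
    have h5₅ : s₅.reg 5 = n ^ j := by rw [hreg₅ 5 (by omega)]; simp [hs₄]
    have h6₅ : s₅.reg 6 = 0 := by rw [hreg₅ 6 (by omega)]; simp [hs₄, hs₃, hs₂, hs₁]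
    have h30₅ : s₅.reg 30 = n ^ 2 := by rw [hreg₅ 30 (by omega)]; simp [hs₄, hs₃, hs₂, hs₁]
    have hcells₅ : ∀ a < h, s₅.mem 5 a < n := fun a ha => by
      rw [hd₅, writeDigits_range', if_pos (by omega)]
      exact Nat.mod_lt _ hn
    refine .bind (run_tabulate hf₅ h1₅ h30₅) fun s₆ htab₆ hF₆ => ?_
    rw [hmem₅ 1 (by omega)] at htab₆
    have hreg₆ : ∀ x, x ≠ 20 → x ≠ 25 → s₆.reg x = s₅.reg x := fun x h20 h25 =>
      hF₆.reg x (by simp [tabulate, Prog.WritesReg, h20, h25])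
    have hmem₆ : ∀ a ≠ 3, s₆.mem a = s₅.mem a := fun a ha =>
      hF₆.mem a (by simp [tabulate, Prog.WritesArr, ha])
    refine .bind (run_findBase (c := c) (n := n) (hF₆.fits hf₅)
      (by rw [hreg₆ 1 (by omega) (by omega), h1₅]) (by rw [hreg₆ 0 (by omega) (by omega), h0₅]) hn hc
      hcw) fun s₇ hroot hF₇ => ?_
    have hreg₇ : ∀ x, x < 20 ∨ x = 30 → s₇.reg x = s₅.reg x := fun x hx => by
      rw [hF₇.reg x fun h' => by have := findBase_writesReg h'; omega,
        hreg₆ x (by omega) (by omega)]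
    have hmem₇ : ∀ a, s₇.mem a = s₆.mem a := fun a => hF₇.mem a findBase_writesArr
    set b := s₇.reg 31 with hb
    have hQ : 2 ≤ 4 ^ σ :=
      (show 2 ≤ 4 ^ 1 by omega).trans (Nat.pow_le_pow_right (by omega) hσ)
    have hQR := hbw b hroot
    have hQR' : (4 ^ σ) ^ codeLength T b ≤ (4 ^ σ) ^ (codeLength T b + 1) :=
      Nat.pow_le_pow_right (by omega) (by omega)
    have hp : T * (T.factorial * b) + 1 < 2 ^ w :=
      ((le_two_pow_codeLength T b).trans (Nat.pow_le_pow_left hQ _)).trans_lt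
        (hQR'.trans_lt hQR)
    have hMT : T.factorial * b ≤ T * (T.factorial * b) := Nat.le_mul_of_pos_left _ hT
    have hfM : T.factorial ≤ T.factorial * b := Nat.le_mul_of_pos_right _ hroot.pos
    have hTT : T ≤ T * (T.factorial * b) :=
      Nat.le_mul_of_pos_right _ (Nat.mul_pos T.factorial_pos hroot.pos)
    have hσw : 4 ^ σ < 2 ^ w := by
      refine lt_of_le_of_lt ?_ hQR
      exact Nat.le_self_pow (by omega) _
    have hσlt : σ < 4 ^ σ := Nat.lt_pow_self (by omega)
    have hRw : σ * codeLength T b < 2 ^ w := by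
      refine lt_of_le_of_lt ?_ hQR
      rw [pow_succ, mul_comm]
      refine Nat.mul_le_mul ?_ hσlt.le
      exact (Nat.lt_pow_self (by omega)).le
    refine Run.mono (T₁ := codeLength T b * 4 + 6 +
      (codeTime ((4 ^ σ) ^ codeLength T b) (codeLength T b) + 1) + 1 + 1 + 1 + 1 + 1)
      (.const_seq (by omega) (.mul_seq (v := T.factorial * b) (by simp [hb]) (by omega)
      (.const_seq (by omega) (.mul_seq (v := T * (T.factorial * b)) (by simp) (by omega)
      (.add_seq (v := T * (T.factorial * b) + 1) (by simp [hreg₇, h1₅]) hp ?_)))))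
      (by have := hG b hroot; omega) fun _ => id
    set s₈ := ((((s₇.setReg 34 T.factorial).setReg 34 (T.factorial * b)).setReg 35 T).setReg 33
      (T * (T.factorial * b))).setReg 33 (T * (T.factorial * b) + 1) with hs₈
    have hf₈ : s₈.Fits w := by
      rw [hs₈]
      exact ((((hF₇.fits (hF₆.fits hf₅)).setReg (by omega)).setReg (by omega)).setReg
        (by omega)).setReg (by omega) |>.setReg hp
    have hreg₈ : ∀ x, x < 20 ∨ x = 30 → s₈.reg x = s₅.reg x := fun x hx => by
      simp only [hs₈, State.reg_setReg]
      rw [if_neg (by omega), if_neg (by omega), if_neg (by omega), if_neg (by omega),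
        if_neg (by omega), hreg₇ x hx]
    have hlen := run_findLength (s := s₈) (p := T * (T.factorial * b) + 1) (by rw [hreg₈ 1 (by omega), h1₅])
      (by simp [hs₈]) hQ hQR
    rw [← codeLength] at hlen
    refine .bind hlen fun s₉ ⟨h7₉, h37₉, h39₉⟩ hF₉ => ?_
    have hreg₉ : ∀ x, x < 7 ∨ 7 < x ∧ x < 36 → s₉.reg x = s₈.reg x := fun x hx =>
      hF₉.reg x fun h' => by simp [findLength, Prog.WritesReg] at h'; omega
    have hmem₉ : ∀ a, s₉.mem a = s₆.mem a := fun a => by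
      rw [hF₉.mem a (by simp [findLength, Prog.WritesArr])]
      simp [hs₈, hmem₇]
    have hf₉ := hF₉.fits hf₈
    refine .const_seq (by omega) ((run_greedy (B := (4 ^ σ) ^ codeLength T b)
      (R := codeLength T b) (q := σ) (hf₉.setReg (by omega))
      (by simp [hreg₉, hreg₈, h1₅]) (by simp [hreg₉, hreg₈, h2₅]) (by simpa using h7₉)
      (by simpa using h39₉) (by simp) (by simpa using h37₉) rfl hσ hRw).frame.mono le_rfl
      fun s' ⟨hcode, hF'⟩ => ⟨b, ?_⟩)
    have hreg' : ∀ x < 40, s'.reg x = s₉.reg x := fun x hx => by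
      rw [hF'.reg x fun h' => by have := greedy_writesReg h'; omega, State.reg_setReg,
        if_neg (by omega)]
    have hmem' : ∀ a ≠ 4, s'.mem a = s₆.mem a := fun a ha => by
      rw [hF'.mem a fun h' => ha (greedy_writesArr h'), State.mem_setReg, hmem₉]
    have hr : ∀ x < 7, s'.reg x = s₅.reg x := fun x hx => by
      rw [hreg' x (by omega), hreg₉ x (by omega), hreg₈ x (by omega)]
    have hm : ∀ a < 2, s'.mem a = s.mem a := fun a ha => by
      rw [hmem' a (by omega), hmem₆ a (by omega), hmem₅ a (by omega)]
    refine ⟨hroot, ⟨hF'.fits (hf₉.setReg (by omega)), (hr 0 (by omega)).trans h0₅,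
      (hr 1 (by omega)).trans h1₅, (hr 2 (by omega)).trans h2₅, ?_⟩,
      ⟨(hr 3 (by omega)).trans h3₅, (hr 4 (by omega)).trans h4₅, (hr 5 (by omega)).trans h5₅,
        (hreg' 7 (by omega)).trans h7₉, ?_, ?_, ?_, (hreg' 39 (by omega)).trans h39₉⟩, ?_, hcode,
      (hr 6 (by omega)).trans h6₅, hm 0 (by omega), hm 1 (by omega)⟩
    · rw [hmem' 5 (by omega), hmem₆ 5 (by omega)]
      exact hcells₅
    · rw [hreg' 30 (by omega), hreg₉ 30 (by omega), hreg₈ 30 (by omega), h30₅]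
    · rw [hreg' 34 (by omega), hreg₉ 34 (by omega)]; simp [hs₈]
    · rw [hreg' 35 (by omega), hreg₉ 35 (by omega)]; simp [hs₈]
    · rw [hmem' 3 (by omega)]
      exact htab₆
  · rw [prepareTime]; omega

/-! ## Rainbow copies as solutions of constraints -/

section Rainbow

variable {h n Q : ℕ} {H : SimpleGraph (Fin h)} {G : SimpleGraph (Fin n)} {c : G.edgeSet → ℕ}

open Classical in
/-- The constraints on a copy of `H` whose edges carry the labels prescribed by `π`. -/
noncomputable def labelConstraints (H : SimpleGraph (Fin h)) (π : H.edgeSet → ℕ) :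
    List (ℕ × ℕ × ℕ) :=
  ((Finset.univ : Finset (Fin h × Fin h)).filter fun p => p.1 ≠ p.2).toList.map fun p =>
    (p.1.1, p.2.1, if e : s(p.1, p.2) ∈ H.edgeSet then π ⟨s(p.1, p.2), e⟩ + 1 else 0)

open Classical in
/-- The systems of constraints for all labellings with distinct labels below `Q`. -/
noncomputable def allConstraints (H : SimpleGraph (Fin h)) (Q : ℕ) : List (List (ℕ × ℕ × ℕ)) :=
  (Finset.univ : Finset (H.edgeSet ↪ Fin Q)).toList.map fun π =>
    labelConstraints H fun e => (π e : ℕ)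

theorem length_labelConstraints_le (π : H.edgeSet → ℕ) :
    (labelConstraints H π).length ≤ h * h := by
  classical
  rw [labelConstraints, List.length_map, Finset.length_toList]
  exact (Finset.card_le_univ _).trans (by simp)

theorem wellformed_labelConstraints {w : ℕ} {π : H.edgeSet → ℕ} (hπ : ∀ e, π e < Q)
    (hQ : Q < 2 ^ w) : Wellformed w h (labelConstraints H π) := by
  intro x hx
  obtain ⟨p, -, rfl⟩ := List.mem_map.1 hx
  refine ⟨p.1.2, p.2.2, ?_⟩
  dsimp only
  split_ifs with e
  · exact (Nat.succ_le_of_lt (hπ _)).trans_lt hQ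
  · exact Nat.two_pow_pos w

theorem wellformed_allConstraints {w : ℕ} (hQ : Q < 2 ^ w) :
    ∀ cs ∈ allConstraints H Q, Wellformed w h cs ∧ cs.length ≤ h * h := by
  intro cs hcs
  obtain ⟨π, -, rfl⟩ := List.mem_map.1 hcs
  exact ⟨wellformed_labelConstraints (fun e => (π e).2) hQ, length_labelConstraints_le _⟩

/-- Labels are shifted by one, so that `0` is free to mean "only distinct" in a constraint and "no
edge" in the matrix. -/
theorem sat_labelConstraints {π : H.edgeSet → ℕ} {hm v : ℕ → ℕ} :
    Sat hm n v (labelConstraints H π) ↔ ∀ a b : Fin h, a ≠ b →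
      (∀ e : s(a, b) ∈ H.edgeSet, hm (v a * n + v b) = π ⟨s(a, b), e⟩ + 1) ∧
      (s(a, b) ∉ H.edgeSet → v a ≠ v b) := by
  classical
  have key : ∀ a b : Fin h, Meets hm n v
      (a.1, b.1, if e : s(a, b) ∈ H.edgeSet then π ⟨s(a, b), e⟩ + 1 else 0) ↔
      (∀ e : s(a, b) ∈ H.edgeSet, hm (v a * n + v b) = π ⟨s(a, b), e⟩ + 1) ∧
      (s(a, b) ∉ H.edgeSet → v a ≠ v b) := by
    intro a b
    by_cases e : s(a, b) ∈ H.edgeSet <;> simp [Meets, e]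
  constructor
  · intro hs a b hab
    exact (key a b).1 (hs _ (List.mem_map.2 ⟨(a, b), by simp [hab], rfl⟩))
  · intro hs x hx
    obtain ⟨p, hp, rfl⟩ := List.mem_map.1 hx
    exact (key p.1 p.2).2 (hs _ _ (by simpa using hp))

/-- The matrix `hm` labels the edges of `G` by functions of their colors, and the other pairs
of vertices by `0`. -/
def LabelsEdges (c : G.edgeSet → ℕ) (g : ℕ → ℕ) (hm : ℕ → ℕ) : Prop :=
  (∀ (u v : Fin n) (e : s(u, v) ∈ G.edgeSet), hm (u * n + v) = g (c ⟨s(u, v), e⟩) + 1) ∧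
  ∀ u v : Fin n, ¬ G.Adj u v → hm (u * n + v) = 0

/-- The vector `o` lists the vertices of a rainbow copy of `H`. -/
def ListsRainbowCopy (H : SimpleGraph (Fin h)) (c : G.edgeSet → ℕ) (o : ℕ → ℕ) : Prop :=
  ∃ φ : SimpleGraph.Copy H G, IsRainbow c φ ∧ ∀ v : Fin h, o v = φ v

/-- A positive entry forces an edge of `G`, hence also distinct endpoints; the other pairs are kept
distinct by their constraints. Equal colors would give equal labels, contradicting the injectivity
of `π`. Nothing is assumed about `g`. -/
theorem LabelsEdges.sound {g hm : ℕ → ℕ} (hL : LabelsEdges c g hm) (π : H.edgeSet ↪ Fin Q) :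
    Sound (ListsRainbowCopy H c) hm n h (labelConstraints H fun e => (π e : ℕ)) := by
  intro v hv hsat o ho
  rw [sat_labelConstraints] at hsat
  let f : Fin h → Fin n := fun a => ⟨v a, hv a a.2⟩
  have hedge : ∀ a b (e : s(a, b) ∈ H.edgeSet),
      hm (f a * n + f b) = (π ⟨s(a, b), e⟩ : ℕ) + 1 := fun a b e =>
    (hsat a b (H.ne_of_adj e)).1 e
  have hadj : ∀ {a b}, H.Adj a b → G.Adj (f a) (f b) := by
    intro a b e
    by_contra hne
    have h1 := hedge a b e
    rw [hL.2 _ _ hne] at h1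
    omega
  have hinj : Function.Injective f := by
    intro a b hab
    by_contra hne
    by_cases e : s(a, b) ∈ H.edgeSet
    · exact G.ne_of_adj (hadj e) hab
    · exact (hsat a b hne).2 e (congrArg Fin.val hab)
  refine ⟨⟨⟨f, hadj⟩, hinj⟩, ?_, fun a => ho a a.2⟩
  rintro ⟨e, he⟩ ⟨e', he'⟩ hee
  induction e with | _ a b =>
  induction e' with | _ a' b' =>
  have h1 := hedge a b he
  have h2 := hedge a' b' he'
  rw [hL.1 (f a) (f b) (hadj he)] at h1
  rw [hL.1 (f a') (f b') (hadj he')] at h2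
  have h3 : c ⟨s(f a, f b), hadj he⟩ = c ⟨s(f a', f b'), hadj he'⟩ := hee
  rw [h3] at h1
  exact π.injective (Fin.ext (by omega))

/-- The labelling is read off from the copy; it is among those enumerated because `g` separates the
colors of the copy. -/
theorem LabelsEdges.solvable {g hm : ℕ → ℕ} (hL : LabelsEdges c g hm) (φ : SimpleGraph.Copy H G)
    (hQ : ∀ x, g x < Q) (hinj : Function.Injective fun e => g (c (φ.toHom.mapEdgeSet e))) :
    ∃ cs ∈ allConstraints H Q, Solvable hm n h cs := by
  classical
  let π : H.edgeSet ↪ Fin Q := ⟨fun e => ⟨g (c (φ.toHom.mapEdgeSet e)), hQ _⟩, fun e e' hee =>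
    hinj (congrArg Fin.val hee)⟩
  refine ⟨_, List.mem_map.2 ⟨π, by simp, rfl⟩, fun a => if ha : a < h then φ ⟨a, ha⟩ else 0, ?_, ?_⟩
  · intro a ha
    simp [ha]
  · rw [sat_labelConstraints]
    intro a b hab
    refine ⟨fun e => ?_, fun _ => ?_⟩
    · simp only [Fin.is_lt, dif_pos]
      exact hL.1 (φ a) (φ b) (φ.toHom.map_adj e)
    · simpa [Fin.val_inj] using fun hh => hab (φ.injective hh)

theorem HoldsColoredGraph.labelsEdges {s : State} (hs : HoldsColoredGraph G c s)
    (tab W : ℕ → ℕ) (M Q i r : ℕ) :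
    LabelsEdges c (fun x => W (tab x % ((i + 1) * M + 1)) / Q ^ r % Q)
      (hashEntry (s.mem 0) (s.mem 1) tab W M Q i r) := by
  refine ⟨fun u v e => ?_, fun u v e => ?_⟩
  · have e' : G.Adj u v := e
    rw [hashEntry, hs.2.1, hs.2.2 u v e, if_pos e', mul_one]
  · rw [hashEntry, hs.2.1, if_neg e, mul_zero]

theorem HoldsColoredGraph.adj_le {s : State} (hs : HoldsColoredGraph G c s) :
    ∀ e < n ^ 2, s.mem 0 e ≤ 1 := by
  classical
  intro e he
  have hn : 0 < n := by
    rcases Nat.eq_zero_or_pos n with rfl | h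
    · simp at he
    · exact h
  have h1 := hs.2.1 ⟨e / n, Nat.div_lt_of_lt_mul (by rwa [← sq])⟩ ⟨e % n, Nat.mod_lt _ hn⟩
  simp only [Nat.div_add_mod'] at h1
  rw [h1]
  split_ifs <;> simp

theorem exists_solvable [Fintype H.edgeSet] {σ T b cc R cnt : ℕ} {tab W : ℕ → ℕ} {s : State}
    (hs : HoldsColoredGraph G c s) (hσ : Fintype.card H.edgeSet ^ 2 ≤ σ) (hT : T = 2 * cc * σ + 1)
    (hb : IsRoot cc n b) (hR : T * (T.factorial * b) + 1 ≤ 2 ^ R) (hR0 : 1 ≤ R)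
    (hW : IsCode σ R cnt W) (htab : IsIndex (n ^ 2) (s.mem 1) tab) (φ : SimpleGraph.Copy H G)
    (hφ : IsRainbow c φ) :
    ∃ i < T, ∃ r < R, ∃ cs ∈ allConstraints H (4 ^ σ),
      Solvable (hashEntry (s.mem 0) (s.mem 1) tab W (T.factorial * b) (4 ^ σ) i r) n h cs := by
  classical
  have hcol : ∀ e : G.edgeSet, ∃ x < n ^ 2, s.mem 1 x = c e := by
    rintro ⟨e, he⟩
    induction e with | _ u v =>
    exact ⟨u * n + v, mul_add_lt_sq u.2 v.2, hs.2.2 u v he⟩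
  have hlt : ∀ e : G.edgeSet, tab (c e) < n ^ 2 ∧ s.mem 1 (tab (c e)) = c e := by
    intro e
    obtain ⟨x, hx, hxe⟩ := hcol e
    simpa only [hxe] using htab x hx
  obtain ⟨i, hi, r, hr, hinj⟩ := exists_injOn_hashVal (Finset.univ : Finset H.edgeSet)
    (fun e => tab (c (φ.toHom.mapEdgeSet e))) (s := σ) (T := T) (b := b) (c := cc) (n := n) (R := R)
    (cnt := cnt) (W := W) (by simpa using hσ) hT hb.pos hb.le
    (by
      have : T - 1 + 1 = T := by omega
      -- Different colors have different tabulated positions, since the color can be read back from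
      -- the position.
      rw [modulus, this]; exact hR) hR0 hW (fun e _ => (hlt _).1) (fun e _ e' _ hee => hφ (by
        have h1 : tab (c (φ.toHom.mapEdgeSet e)) = tab (c (φ.toHom.mapEdgeSet e')) := hee
        show c _ = c _
        rw [← (hlt (φ.toHom.mapEdgeSet e)).2, h1, (hlt (φ.toHom.mapEdgeSet e')).2]))
  obtain ⟨cs, hcs, hsol⟩ := (hs.labelsEdges tab W (T.factorial * b) (4 ^ σ) i r).solvable φ
    (Q := 4 ^ σ) (fun x => Nat.mod_lt _ (by positivity))
    (fun e e' hee => hinj (by simp) (by simp) hee)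
  exact ⟨i, hi, r, hr, cs, hcs, hsol⟩

end Rainbow

/-! ## The search for a rainbow copy -/

section Search

variable {w n k j : ℕ} {P : Prog} {H : SimpleGraph (Fin (3 * k + j))} {G : SimpleGraph (Fin n)}
  {c : G.edgeSet → ℕ} {s : State}

/-- Decide whether there is a rainbow copy of `H`, by means of a program `P` that multiplies
matrices, a code over an alphabet of `4 ^ σ` letters, and `T` moduli. -/
noncomputable def searchRainbow (P : Prog) (H : SimpleGraph (Fin (3 * k + j))) (σ T : ℕ) : Prog :=
  .const 1 1 ⨾ .const 2 0 ⨾ .branch 0 1 (.const 0 0)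
    (prepare k j (3 * k + j) σ (6 * σ) T ⨾ hashLoop P k j (allConstraints H (4 ^ σ)) ⨾
      .arith .add 0 6 2)

/-- A time bound for `searchRainbow`. -/
def searchTime (n k j l σ T L G TP : ℕ) : ℕ :=
  prepareTime n k j (3 * k + j) (6 * σ) G +
    (T * (L * roundTime n k j ((3 * k + j) * (3 * k + j)) l TP + 8) + 2 + 1) + 1 + 1 + 1

theorem HoldsRainbowAnswer.of_reported {h : ℕ} {H : SimpleGraph (Fin h)} {D : Prop}
    {s₀ s s' : State} (hr : Reported (ListsRainbowCopy H c) D s₀ s) (h0 : s₀.reg 6 = 0)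
    (hD : ∀ φ : SimpleGraph.Copy H G, IsRainbow c φ → D) (h6 : s'.reg 0 = s.reg 6)
    (h2 : s'.mem 2 = s.mem 2) : HoldsRainbowAnswer H G c s' := by
  rcases hr with ⟨h1, hV⟩ | ⟨h1, -, hnD⟩
  · refine .inl ⟨h6.trans h1, ?_⟩
    rw [h2]
    exact hV
  · exact .inr ⟨h6.trans (h1.trans h0), fun ⟨φ, hφ⟩ => hnD (hD φ hφ)⟩

theorem run_searchRainbow [Fintype H.edgeSet] {σ T L GP TP : ℕ} (hs : s.Fits w)
    (hG : HoldsColoredGraph G c s) (hh : 2 ≤ 3 * k + j)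
    (hσ : Fintype.card H.edgeSet ^ 2 ≤ σ) (hσ1 : 1 ≤ σ) (hT : T = 2 * (6 * σ) * σ + 1)
    (h1w : 1 < 2 ^ w)
    (hw : Roomy w n (3 * k + j)) (hkw : n ^ (2 * k) < 2 ^ w) (hjw : n ^ j < 2 ^ w)
    (hcw : 2 ^ (6 * σ) * n < 2 ^ w)
    (hbw : ∀ b, IsRoot (6 * σ) n b → (4 ^ σ) ^ (codeLength T b + 1) < 2 ^ w)
    (hGP : ∀ b, IsRoot (6 * σ) n b →
      codeTime ((4 ^ σ) ^ codeLength T b) (codeLength T b) + codeLength T b * 4 ≤ GP)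
    (hL : ∀ b, IsRoot (6 * σ) n b → codeLength T b ≤ L)
    (hQ : 4 ^ σ < 2 ^ w) (hTw : ∀ b, IsRoot (6 * σ) n b → T * (T.factorial * b) + 1 < 2 ^ w)
    (hP : 1 ≤ n → Multiplies w (n ^ k) TP P) :
    Run w (searchRainbow P H σ T) s
      (searchTime n k j (allConstraints H (4 ^ σ)).length σ T L GP TP)
      (HoldsRainbowAnswer H G c) := by
  refine .const_seq h1w (.const_seq (by positivity) (.branch (fun hlt => ?_) fun hge => ?_))
  · have hn : n = 0 := by simpa [hG.1] using hlt
    subst hn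
    refine (Run.const (by positivity) (.inr ⟨by simp, fun ⟨φ, _⟩ => ?_⟩)).mono
      (by rw [prepareTime]; omega) fun _ => id
    exact (φ ⟨0, by omega⟩).elim0
  · have hn : 1 ≤ n := by
      have : ¬ n = 0 := by simpa [hG.1] using hge
      omega
    have hfit : ((s.setReg 1 1).setReg 2 0).Fits w :=
      (hs.setReg h1w).setReg (by positivity)
    refine .bind (run_prepare hfit (by simp [hG.1]) (by simp) (by simp) hn hw hσ1 (by omega)
      (by omega) hkw hjw hcw hbw hGP) fun s₁ ⟨b, hp⟩ _ => ?_
    have hm0 : s₁.mem 0 = s.mem 0 := hp.mem0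
    have hm1 : s₁.mem 1 = s.mem 1 := hp.mem1
    have hR0 : 1 ≤ codeLength T b := by
      have hb := hp.root.pos
      refine Nat.clog_pos (by norm_num) ?_
      have : 1 ≤ T * (T.factorial * b) :=
        Nat.mul_pos (by omega) (Nat.mul_pos T.factorial_pos hb)
      omega
    obtain ⟨cnt, hW⟩ := hp.code
    refine .bind ((run_hashLoop (T := T) hw hn (hP hn) hp.ready hp.loaded
      (Nat.one_le_pow _ _ (by norm_num))
      ((Nat.pow_le_pow_right (by positivity) (by omega)).trans_lt (hbw b hp.root))
      (hTw b hp.root) hm0 hm1 rfl rfl hG.adj_le (wellformed_allConstraints hQ)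
      (V := ListsRainbowCopy H c) fun i _ r _ cs hcs => ?_).mono (T₂ := _)
      (Nat.add_le_add_right (Nat.mul_le_mul_left _ (Nat.add_le_add_right
        (Nat.mul_le_mul_right _ (hL b hp.root)) _)) _) fun _ => id) fun s₂ ⟨hr, hrep⟩ _ => ?_
    · obtain ⟨π, -, rfl⟩ := List.mem_map.1 hcs
      exact (hG.labelsEdges _ _ _ _ _ _).sound π
    · refine .add (v := s₂.reg 6) (by simp [hr.zero]) (hr.fits.1 6) ?_
      refine .of_reported hrep hp.reg6 (fun φ hφ => ?_) (by simp) (by simp)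
      exact exists_solvable hG hσ hT hp.root (le_two_pow_codeLength T b) hR0 hW hp.index φ hφ

end Search

/-! ## Graphs with at most one vertex -/

theorem exists_isRainbow_of_subsingleton {h n : ℕ} [Subsingleton (Fin h)]
    (H : SimpleGraph (Fin h)) {G : SimpleGraph (Fin n)} (c : G.edgeSet → ℕ) (f : Fin h → Fin n) :
    ∃ φ : SimpleGraph.Copy H G, IsRainbow c φ ∧ ⇑φ = f := by
  have hno : ∀ e, e ∉ H.edgeSet := by
    intro e he
    induction e with | _ a b => exact H.ne_of_adj he (Subsingleton.elim a b)
  exact ⟨⟨⟨f, fun {a b} hab => (hno s(a, b) hab).elim⟩, Function.injective_of_subsingleton f⟩,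
    fun e => (hno _ e.2).elim, rfl⟩

/-- Place a single vertex. -/
def placeVertex (h : ℕ) : Prog :=
  if h = 0 then .const 0 1 else
    .const 1 0 ⨾ .branch 1 0 (.const 0 1 ⨾ .store 2 1 1) (.const 0 0)

theorem run_placeVertex {h n w : ℕ} (hh : h ≤ 1) (H : SimpleGraph (Fin h))
    {G : SimpleGraph (Fin n)} {c : G.edgeSet → ℕ} {s : State} (h1w : 1 < 2 ^ w)
    (hG : HoldsColoredGraph G c s) : Run w (placeVertex h) s 4 (HoldsRainbowAnswer H G c) := by
  have : Subsingleton (Fin h) := Fin.subsingleton_iff_le_one.2 hh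
  rw [placeVertex]
  split_ifs with h0
  · subst h0
    obtain ⟨φ, hφ, -⟩ := exists_isRainbow_of_subsingleton H c Fin.elim0
    exact (Run.const h1w (.inl ⟨by simp, φ, hφ, fun v => v.elim0⟩)).mono (by norm_num) fun _ => id
  · refine .const_seq (by positivity) (.branch (T := 2) (fun hlt => ?_) fun hge => ?_)
    · have hn : 0 < n := by simpa [hG.1] using hlt
      obtain ⟨φ, hφ, hf⟩ := exists_isRainbow_of_subsingleton H c fun _ => ⟨0, hn⟩
      refine .const_seq h1w (.store (i := 0) (v := 0) (by simp) (by simp)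
        (.inl ⟨by simp, φ, hφ, fun v => ?_⟩))
      have hv : (v : ℕ) = 0 := by omega
      simp [hf, hv]
    · have hn : n = 0 := by simpa [hG.1] using hge
      subst hn
      exact (Run.const (by positivity) (.inr ⟨by simp, fun ⟨φ, _⟩ =>
        (φ ⟨0, by omega⟩).elim0⟩)).mono (by norm_num) fun _ => id

/-! ## Resource bounds -/

/-- The factor by which the number of words over the code alphabet, cubed, exceeds `n`. -/
def codeFactor (σ T : ℕ) : ℕ := (2 * (T * T.factorial + 1)) ^ (6 * σ) * 2 ^ (6 * σ)

theorem one_le_codeFactor (σ T : ℕ) : 1 ≤ codeFactor σ T :=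
  Nat.mul_pos (by positivity) (by positivity)

/-- Rounding the largest modulus up to a power of two at most doubles it, so `2 ^ R` is linear in
`b`. -/
theorem two_pow_codeLength_le {T b : ℕ} (hT : 1 ≤ T) (hb : 1 ≤ b) :
    2 ^ codeLength T b ≤ 2 * ((T * T.factorial + 1) * b) := by
  have h1 : 1 ≤ T * (T.factorial * b) :=
    Nat.mul_pos hT (Nat.mul_pos T.factorial_pos hb)
  have h2 : 1 < T * (T.factorial * b) + 1 := by omega
  have h3 : (codeLength T b).pred + 1 = codeLength T b :=
    Nat.succ_pred_eq_of_pos (Nat.clog_pos (by norm_num) h2)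
  have h4 : 2 ^ (codeLength T b).pred < T * (T.factorial * b) + 1 :=
    Nat.pow_pred_clog_lt_self (by norm_num) h2
  rw [← h3, pow_succ, mul_comm]
  refine Nat.mul_le_mul_left _ (h4.le.trans ?_)
  rw [add_mul, mul_assoc, one_mul]
  omega

/-- The cube of `(4 ^ σ) ^ R` is `(2 ^ R) ^ (6 * σ)`, that is `O(b ^ (6 * σ))`; taking the `6 *
σ`-th root of `n` as `b` makes this linear in `n`. -/
theorem code_cube_le {n σ T b : ℕ} (hT : 1 ≤ T) (hb : IsRoot (6 * σ) n b) :
    ((4 ^ σ) ^ codeLength T b) ^ 3 ≤ codeFactor σ T * n := by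
  calc ((4 ^ σ) ^ codeLength T b) ^ 3 = (2 ^ codeLength T b) ^ (6 * σ) := by
        rw [show (4 : ℕ) = 2 ^ 2 by norm_num]
        simp only [← pow_mul]
        ring_nf
    _ ≤ (2 * ((T * T.factorial + 1) * b)) ^ (6 * σ) :=
      Nat.pow_le_pow_left (two_pow_codeLength_le hT hb.pos) _
    _ = (2 * (T * T.factorial + 1)) ^ (6 * σ) * b ^ (6 * σ) := by rw [← mul_assoc, mul_pow]
    _ ≤ (2 * (T * T.factorial + 1)) ^ (6 * σ) * (2 ^ (6 * σ) * n) :=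
      Nat.mul_le_mul_left _ hb.ge
    _ = _ := by rw [codeFactor, mul_assoc]

theorem two_pow_codeLength_le_pow {σ T b : ℕ} (hσ : 1 ≤ σ) :
    2 ^ codeLength T b ≤ (4 ^ σ) ^ codeLength T b :=
  Nat.pow_le_pow_left ((by norm_num : 2 ≤ 4 ^ 1).trans (Nat.pow_le_pow_right (by norm_num) hσ)) _

/-- As `R ≤ B`, every term is at most a multiple of `B ^ 3`; the coefficients add up to `16 + 10 + 8
+ 3 + 4 = 41`. -/
theorem codeTime_le {n σ T b : ℕ} (hσ : 1 ≤ σ) (hT : 1 ≤ T) (hb : IsRoot (6 * σ) n b) :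
    codeTime ((4 ^ σ) ^ codeLength T b) (codeLength T b) + codeLength T b * 4 ≤
      41 * (codeFactor σ T * n) := by
  have h1 := two_pow_codeLength_le_pow (T := T) (b := b) hσ
  have h2 := code_cube_le hT hb
  have h3 : codeLength T b < 2 ^ codeLength T b := Nat.lt_two_pow_self
  have h4 : 1 ≤ (4 ^ σ) ^ codeLength T b := Nat.one_le_pow _ _ (by positivity)
  generalize (4 ^ σ) ^ codeLength T b = B at *
  generalize codeLength T b = R at *
  have h5 : R ≤ B := h3.le.trans h1
  refine le_trans ?_ (Nat.mul_le_mul_left 41 h2)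
  have h6 : B ≤ B ^ 2 := Nat.le_self_pow (by norm_num) B
  have h7 : B ^ 2 ≤ B ^ 3 := Nat.pow_le_pow_right h4 (by norm_num)
  have h8 : B * B * R ≤ B ^ 3 := by
    rw [pow_succ, sq]; exact Nat.mul_le_mul_left _ h5
  have h9 : codeTime B R = 16 * (B * B * R) + 10 * B ^ 2 + 8 * B + 3 := by rw [codeTime]; ring
  omega

theorem codeLength_le_log {n σ T b : ℕ} (hσ : 1 ≤ σ) (hT : 1 ≤ T) (hb : IsRoot (6 * σ) n b) :
    codeLength T b ≤ Nat.log 2 (codeFactor σ T * n) := by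
  refine Nat.le_log_of_pow_le (by norm_num) ((two_pow_codeLength_le_pow (T := T) (b := b) hσ).trans
    ((Nat.le_self_pow (by norm_num) _).trans (code_cube_le hT hb)))

/-- Words of this many times `log₂ (n + 2)` bits suffice for the search. -/
def wordFactor (h k j σ T d : ℕ) : ℕ :=
  (codeFactor σ T * 4 ^ σ + h) + (2 * k + j + 2) + (k + 1) * d

/-- A constant factor `D` is absorbed into the exponent by `D < 2 ^ D ≤ (n + 2) ^ D`. -/
theorem mul_lt_two_pow_of_wordFactor {n w h k j σ T d x : ℕ}
    (hw : (n + 2) ^ wordFactor h k j σ T d ≤ 2 ^ w)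
    (hx : x ≤ (codeFactor σ T * 4 ^ σ + h) * (n + 2) ^ (2 * k + j + 2)) : x < 2 ^ w := by
  set D := codeFactor σ T * 4 ^ σ + h
  calc x ≤ D * (n + 2) ^ (2 * k + j + 2) := hx
    _ < 2 ^ D * (n + 2) ^ (2 * k + j + 2) :=
      Nat.mul_lt_mul_of_pos_right Nat.lt_two_pow_self (by positivity)
    _ ≤ (n + 2) ^ D * (n + 2) ^ (2 * k + j + 2) :=
      Nat.mul_le_mul_right _ (Nat.pow_le_pow_left (by omega) _)
    _ = (n + 2) ^ (D + (2 * k + j + 2)) := (pow_add _ _ _).symm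
    _ ≤ (n + 2) ^ wordFactor h k j σ T d := Nat.pow_le_pow_right (by omega) (by
      rw [wordFactor]; omega)
    _ ≤ 2 ^ w := hw

theorem pow_add_two_pow_le {n w h k j σ T d : ℕ} (hn : 1 ≤ n)
    (hw : (n + 2) ^ wordFactor h k j σ T d ≤ 2 ^ w) : (n ^ k + 2) ^ d ≤ 2 ^ w := by
  have h1 : n ^ k + 2 ≤ (n + 2) ^ (k + 1) := by
    have h2 : n ^ k ≤ (n + 2) ^ k := Nat.pow_le_pow_left (by omega) k
    have h3 : 1 ≤ (n + 2) ^ k := Nat.one_le_pow _ _ (by omega)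
    rw [pow_succ]
    nlinarith
  calc (n ^ k + 2) ^ d ≤ ((n + 2) ^ (k + 1)) ^ d := Nat.pow_le_pow_left h1 d
    _ = (n + 2) ^ ((k + 1) * d) := (pow_mul _ _ _).symm
    _ ≤ (n + 2) ^ wordFactor h k j σ T d := Nat.pow_le_pow_right (by omega) (by
      rw [wordFactor]; omega)
    _ ≤ 2 ^ w := hw

/-- A time bound for the treatment of one hash function and all labellings, per unit of work. -/
def roundFactor (k j l : ℕ) : ℕ :=
  17 + l * (4 * sweepTime k (3 * k + j) ((3 * k + j) * (3 * k + j)) + 12 * k + 6 * j + 37) + 6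

/-- The constant in the time bound for `searchRainbow`. -/
def searchFactor (k j l σ T : ℕ) : ℕ :=
  (4 + (6 * σ + 3) + 41 * codeFactor σ T + (3 * k + j + 6 * (3 * k + j) + 6 * σ + 30)) +
    (T * (roundFactor k j l + 8) + 6)

/-- Here `y` is one common unit of work; later it is the integer part of `n ^ j` times the bound for
one matrix multiplication. -/
theorem roundTime_le {n k j l TP y : ℕ} (hy : 1 ≤ y) (h2 : n ^ 2 ≤ y)
    (hkj : n ^ j * n ^ (2 * k) ≤ y) (hTP : n ^ j * TP ≤ y) (hj : n ^ j ≤ y) :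
    roundTime n k j ((3 * k + j) * (3 * k + j)) l TP ≤ roundFactor k j l * y := by
  have h1 : extTime n k j ((3 * k + j) * (3 * k + j)) TP ≤
      (4 * sweepTime k (3 * k + j) ((3 * k + j) * (3 * k + j)) + 12 * k + 6 * j + 37) * y := by
    rw [extTime, blocksTime]
    generalize sweepTime k (3 * k + j) ((3 * k + j) * (3 * k + j)) = S
    calc n ^ j * (4 * (n ^ (2 * k) * S) + TP + 12 * k + 30 + 6 * j + 4) + 2 =
          4 * S * (n ^ j * n ^ (2 * k)) + n ^ j * TP + (12 * k + 6 * j + 34) * n ^ j + 2 := by ring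
      _ ≤ 4 * S * y + y + (12 * k + 6 * j + 34) * y + 2 * y := by gcongr; omega
      _ = _ := by ring
  rw [roundTime, roundFactor]
  have h3 := Nat.mul_le_mul_left l h1
  generalize extTime n k j ((3 * k + j) * (3 * k + j)) TP = E at *
  generalize 4 * sweepTime k (3 * k + j) ((3 * k + j) * (3 * k + j)) + 12 * k + 6 * j + 37 = F at *
  calc n ^ 2 * 17 + l * E + 6 ≤ y * 17 + l * (F * y) + 6 * y := by omega
    _ = _ := by ring

theorem searchTime_le {n k j l σ T L TP y : ℕ} (hy : 1 ≤ y) (h2 : n ^ 2 ≤ y)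
    (hkj : n ^ j * n ^ (2 * k) ≤ y) (hTP : n ^ j * TP ≤ y) (hj : n ^ j ≤ y) :
    searchTime n k j l σ T L (41 * (codeFactor σ T * n)) TP ≤
      searchFactor k j l σ T * (y * (L + 1)) := by
  have h1 := roundTime_le (l := l) hy h2 hkj hTP hj
  have hny : n ≤ y := (Nat.le_self_pow (by norm_num) n).trans h2
  rw [searchTime, prepareTime, searchFactor]
  generalize roundTime n k j ((3 * k + j) * (3 * k + j)) l TP = A at *
  generalize roundFactor k j l = ρ at *
  generalize codeFactor σ T = κ
  generalize 3 * k + j + 6 * (3 * k + j) + 6 * σ + 30 = z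
  have h3 : y ≤ y * (L + 1) := Nat.le_mul_of_pos_right _ (by omega)
  have h4 : L * A ≤ ρ * (y * (L + 1)) := by
    calc L * A ≤ (L + 1) * (ρ * y) := Nat.mul_le_mul (by omega) h1
      _ = _ := by ring
  generalize y * (L + 1) = Y at *
  have h5 : n ^ 2 * 4 + n * (6 * σ + 3) + 41 * (κ * n) + z ≤
      4 * Y + (6 * σ + 3) * Y + 41 * κ * Y + z * Y := by
    have h6 : n ≤ Y := hny.trans h3
    have h7 : n ^ 2 ≤ Y := h2.trans h3
    have h8 : 1 ≤ Y := hy.trans h3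
    have h9 := Nat.mul_le_mul_left (6 * σ + 3) h6
    have h10 := Nat.mul_le_mul_left (41 * κ) h6
    have h11 := Nat.mul_le_mul_left z h8
    linarith
  have h12 : T * (L * A + 8) ≤ T * ((ρ + 8) * Y) := by
    refine Nat.mul_le_mul_left _ ?_
    linarith
  have h13 : 1 ≤ Y := hy.trans h3
  calc _ ≤ (4 * Y + (6 * σ + 3) * Y + 41 * κ * Y + z * Y) + (T * ((ρ + 8) * Y) + 6) := by omega
    _ ≤ (4 * Y + (6 * σ + 3) * Y + 41 * κ * Y + z * Y) + (T * ((ρ + 8) * Y) + 6 * Y) := by omega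
    _ = _ := by ring

/-- Since `log 2 ≤ log n`, the constant `log κ` and the summand `1` can be charged to `log n`. -/
theorem cast_log_add_one_le {κ n : ℕ} (hκ : 1 ≤ κ) (hn : 2 ≤ n) :
    ((Nat.log 2 (κ * n) + 1 : ℕ) : ℝ) ≤
      (Real.log κ / Real.log 2 + 2) / Real.log 2 * Real.log n := by
  have h2 : 0 < Real.log 2 := Real.log_pos (by norm_num)
  have hn' : (2 : ℝ) ≤ n := by exact_mod_cast hn
  have hκ' : (1 : ℝ) ≤ κ := by exact_mod_cast hκ
  have h3 : Real.log 2 ≤ Real.log n := Real.log_le_log (by norm_num) hn'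
  have h4 : 0 ≤ Real.log κ := Real.log_nonneg hκ'
  have h5 : (Nat.log 2 (κ * n) : ℝ) * Real.log 2 ≤ Real.log κ + Real.log n := by
    rw [← Real.log_mul (by positivity) (by positivity), ← Real.log_pow]
    refine Real.log_le_log (by positivity) ?_
    exact_mod_cast Nat.pow_log_le_self 2 (Nat.mul_pos hκ (by omega)).ne'
  have h6 : Real.log κ ≤ Real.log κ / Real.log 2 * Real.log n := by
    rw [div_mul_eq_mul_div, le_div_iff₀ h2]
    exact mul_le_mul_of_nonneg_left h3 h4
  rw [div_mul_eq_mul_div, le_div_iff₀ h2]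
  push_cast
  linarith

/-! ### Assembling the time bound -/

theorem multiplies_floor {P : Prog} {N w : ℕ} {b : ℝ}
    (hP : ∀ (A B : Matrix (Fin N) (Fin N) Bool) (s : State),
      s.Fits w → HoldsMatrices N A B s →
        ∃ (t : ℕ) (s' : State), Exec w P s t s' ∧ HoldsProduct N A B s' ∧ (t : ℝ) ≤ b) :
    Multiplies w N ⌊b⌋₊ P := by
  intro A B u hu hAB
  obtain ⟨t, s', he, hp, ht⟩ := hP A B u hu hAB
  exact ⟨t, s', he, Nat.le_floor ht, hp⟩

theorem exists_program_of_le_one {h : ℕ} (hh : h ≤ 1) (H : SimpleGraph (Fin h)) {e : ℝ}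
    (he : 0 ≤ e) :
    ∃ (P : Prog) (d : ℕ) (K : ℝ),
      ∀ (n : ℕ) (G : SimpleGraph (Fin n)) (c : G.edgeSet → ℕ) (w : ℕ) (s : State),
        (n + 2) ^ d ≤ 2 ^ w → s.Fits w → HoldsColoredGraph G c s →
          ∃ (t : ℕ) (s' : State),
            Exec w P s t s' ∧ HoldsRainbowAnswer H G c s' ∧
              (2 ≤ n → (t : ℝ) ≤ K * ((n : ℝ) ^ e * Real.log n)) := by
  refine ⟨placeVertex h, 1, 4 / Real.log 2, fun n G c w s hw _ hG => ?_⟩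
  obtain ⟨t, s', hex, ht, hans⟩ := run_placeVertex (w := w) hh H (by rw [pow_one] at hw; omega) hG
  refine ⟨t, s', hex, hans, fun hn => ?_⟩
  have h2 : 0 < Real.log 2 := Real.log_pos (by norm_num)
  have hn' : (2 : ℝ) ≤ n := by exact_mod_cast hn
  have h3 : Real.log 2 ≤ Real.log n := Real.log_le_log (by norm_num) hn'
  have h4 : (1 : ℝ) ≤ (n : ℝ) ^ e := Real.one_le_rpow (by linarith) he
  have h5 : (t : ℝ) ≤ 4 := by exact_mod_cast ht
  rw [div_mul_eq_mul_div, le_div_iff₀ h2]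
  nlinarith [mul_le_mul h4 h3 h2.le (by linarith)]

theorem exists_program_of_two_le {ω : ℝ} (hω : MatrixMulInTime ω) {k j : ℕ} (hh : 2 ≤ 3 * k + j)
    (H : SimpleGraph (Fin (3 * k + j))) :
    ∃ (P : Prog) (d : ℕ) (K : ℝ),
      ∀ (n : ℕ) (G : SimpleGraph (Fin n)) (c : G.edgeSet → ℕ) (w : ℕ) (s : State),
        (n + 2) ^ d ≤ 2 ^ w → s.Fits w → HoldsColoredGraph G c s →
          ∃ (t : ℕ) (s' : State),
            Exec w P s t s' ∧ HoldsRainbowAnswer H G c s' ∧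
              (2 ≤ n → (t : ℝ) ≤ K * ((n : ℝ) ^ (ω * k + j) * Real.log n)) := by
  classical
  obtain ⟨P, d, C, hP⟩ := hω
  -- The added `1` keeps `σ` positive when `H` has no edges; the alphabet and the root exponent `6 *
  -- σ` need this.
  obtain ⟨σ, hσ⟩ : ∃ σ, σ = Fintype.card H.edgeSet ^ 2 + 1 := ⟨_, rfl⟩
  obtain ⟨T, hT⟩ : ∃ T, T = 2 * (6 * σ) * σ + 1 := ⟨_, rfl⟩
  have hσ1 : 1 ≤ σ := by omega
  have hT1 : 1 ≤ T := by omega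
  set l := (allConstraints H (4 ^ σ)).length
  refine ⟨searchRainbow P H σ T, wordFactor (3 * k + j) k j σ T d, searchFactor k j l σ T * (C *
    ((Real.log (codeFactor σ T) / Real.log 2 + 2) / Real.log 2)), fun n G c w s hw hs hG => ?_⟩
  have hκ := one_le_codeFactor σ T
  have h4σ : 1 ≤ 4 ^ σ := Nat.one_le_pow _ _ (by norm_num)
  have hD : codeFactor σ T * 4 ^ σ ≤ codeFactor σ T * 4 ^ σ + (3 * k + j) := Nat.le_add_right _ _
  have hD1 : 1 ≤ codeFactor σ T * 4 ^ σ + (3 * k + j) := (Nat.mul_pos hκ h4σ).trans_le hD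
  have hword : ∀ x, x ≤ (codeFactor σ T * 4 ^ σ + (3 * k + j)) * (n + 2) ^ (2 * k + j + 2) →
      x < 2 ^ w := fun x => mul_lt_two_pow_of_wordFactor hw
  have hpow : ∀ m ≤ 2 * k + j + 2, n ^ m < 2 ^ w := fun m hm => hword _
    (((Nat.pow_le_pow_left (by omega) m).trans (Nat.pow_le_pow_right (by omega) hm)).trans
      (Nat.le_mul_of_pos_left _ hD1))
  have hconst : ∀ x ≤ codeFactor σ T * 4 ^ σ + (3 * k + j), x < 2 ^ w := fun x hx => hword _
    (hx.trans (Nat.le_mul_of_pos_right _ (by positivity)))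
  have hlin : codeFactor σ T * n * 4 ^ σ < 2 ^ w := hword _ (by
    rw [mul_right_comm]
    exact Nat.mul_le_mul hD ((by omega : n ≤ n + 2).trans (Nat.le_self_pow (by omega) _)))
  have hlin' : codeFactor σ T * n < 2 ^ w := (Nat.le_mul_of_pos_right _ h4σ).trans_lt hlin
  have hB : ∀ b, IsRoot (6 * σ) n b → (4 ^ σ) ^ codeLength T b ≤ codeFactor σ T * n :=
    fun b hb => (Nat.le_self_pow (by norm_num) _).trans (code_cube_le hT1 hb)
  have hrun := run_searchRainbow (H := H) (σ := σ) (T := T) (L := Nat.log 2 (codeFactor σ T * n))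
    (GP := 41 * (codeFactor σ T * n)) (TP := ⌊C * ((n ^ k : ℕ) : ℝ) ^ ω⌋₊) (P := P) hs hG hh
    (by omega) hσ1 hT (hconst 1 hD1) ⟨hpow 2 (by omega), hconst _ (Nat.le_add_left _ _)⟩
    (hpow _ (by omega)) (hpow _ (by omega))
    ((Nat.mul_le_mul_right _ (Nat.le_mul_of_pos_left _ (by positivity))).trans_lt hlin')
    (fun b hb => by
      rw [pow_succ]
      exact (Nat.mul_le_mul_right _ (hB b hb)).trans_lt hlin)
    (fun b hb => codeTime_le hσ1 hT1 hb) (fun b hb => codeLength_le_log hσ1 hT1 hb)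
    (hconst _ ((Nat.le_mul_of_pos_left _ hκ).trans hD))
    (fun b hb => (((le_two_pow_codeLength T b).trans (two_pow_codeLength_le_pow hσ1)).trans
      (hB b hb)).trans_lt hlin')
    (fun hn => multiplies_floor fun A B u => hP _ A B w u (Nat.one_le_pow _ _ hn)
      (pow_add_two_pow_le hn hw))
  obtain ⟨t, s', hex, ht, hans⟩ := hrun
  refine ⟨t, s', hex, hans, fun hn => ?_⟩
  have hn0 : (0 : ℝ) < n := by exact_mod_cast (by omega : 0 < n)
  have hX : (n : ℝ) ^ (ω * k + j) = ((n ^ k : ℕ) : ℝ) ^ ω * (n : ℝ) ^ j := by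
    rw [Real.rpow_add hn0, Real.rpow_natCast, mul_comm ω, Real.rpow_mul hn0.le, Real.rpow_natCast,
      Nat.cast_pow]
  -- This takes the place of assuming `2 ≤ ω`: the sweeps over `n ^ (2 * k)` entries are charged to
  -- the multiplication. It also shows that the bound is nonnegative.
  have hsq : ((n ^ k : ℕ) : ℝ) ^ 2 ≤ C * ((n ^ k : ℕ) : ℝ) ^ ω :=
    sq_le_of_multiplies (Nat.one_le_pow _ _ (by omega)) fun A B w u hw => hP _ A B w u
      (Nat.one_le_pow _ _ (by omega)) hw
  set Z := C * ((n ^ k : ℕ) : ℝ) ^ ω with hZ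
  have hZ0 : 0 ≤ Z := (by positivity : (0 : ℝ) ≤ ((n ^ k : ℕ) : ℝ) ^ 2).trans hsq
  have hZX : C * (n : ℝ) ^ (ω * k + j) = n ^ j * Z := by rw [hX, hZ]; ring
  have hy2 : n ^ j * n ^ (2 * k) ≤ ⌊n ^ j * Z⌋₊ := Nat.le_floor (by
    push_cast at hsq ⊢
    rw [mul_comm 2 k, pow_mul]
    exact mul_le_mul_of_nonneg_left hsq (by positivity))
  have hyT : n ^ j * ⌊Z⌋₊ ≤ ⌊n ^ j * Z⌋₊ := Nat.le_floor (by
    push_cast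
    exact mul_le_mul_of_nonneg_left (Nat.floor_le hZ0) (by positivity))
  have hyj : n ^ j ≤ ⌊n ^ j * Z⌋₊ :=
    (Nat.le_mul_of_pos_right _ (Nat.one_le_pow _ _ (by omega))).trans hy2
  -- From `2 ≤ 3 * k + j` follows `2 ≤ j + 2 * k`, so reading the whole input is affordable.
  have hynn : n ^ 2 ≤ ⌊n ^ j * Z⌋₊ := le_trans (by
    rw [← pow_add]; exact Nat.pow_le_pow_right (by omega) (by omega)) hy2
  have hle := ht.trans (searchTime_le (l := l) (σ := σ) (T := T)
    (L := Nat.log 2 (codeFactor σ T * n)) ((Nat.one_le_pow _ _ (by omega)).trans hyj) hynn hy2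
    hyT hyj)
  calc (t : ℝ) ≤ ((searchFactor k j l σ T *
        (⌊n ^ j * Z⌋₊ * (Nat.log 2 (codeFactor σ T * n) + 1)) : ℕ) : ℝ) := by exact_mod_cast hle
    _ = searchFactor k j l σ T *
        (⌊n ^ j * Z⌋₊ * ((Nat.log 2 (codeFactor σ T * n) + 1 : ℕ) : ℝ)) := by push_cast; ring
    _ ≤ searchFactor k j l σ T * ((n ^ j * Z) *
        ((Real.log (codeFactor σ T) / Real.log 2 + 2) / Real.log 2 * Real.log n)) := by
      refine mul_le_mul_of_nonneg_left (mul_le_mul (Nat.floor_le (by positivity))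
        (cast_log_add_one_le hκ hn) (by positivity) (by positivity)) (by positivity)
    _ = _ := by rw [← hZX]; ring

end WordRAM

theorem theorem6 (ω : ℝ) (hω : WordRAM.MatrixMulInTime ω) (k j : ℕ) (hj : j ∈ ({0, 1, 2} : Set ℕ))
    (H : SimpleGraph (Fin (3 * k + j))) :
    ∃ (P : WordRAM.Prog) (d : ℕ) (K : ℝ),
      ∀ (n : ℕ) (G : SimpleGraph (Fin n)) (c : G.edgeSet → ℕ) (w : ℕ) (s : WordRAM.State),
        (n + 2) ^ d ≤ 2 ^ w → s.Fits w → WordRAM.HoldsColoredGraph G c s →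
          ∃ (t : ℕ) (s' : WordRAM.State),
            WordRAM.Exec w P s t s' ∧ WordRAM.HoldsRainbowAnswer H G c s' ∧
              (2 ≤ n → (t : ℝ) ≤ K * ((n : ℝ) ^ (ω * k + j) * Real.log n)) := by
  rcases le_or_gt (3 * k + j) 1 with h1 | h2
  · have hk : k = 0 := by omega
    exact WordRAM.exists_program_of_le_one h1 H (by simp [hk])
  · exact WordRAM.exists_program_of_two_le hω h2 H
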